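/- Let $K$ be an oriented knot given by a diagram on the sphere with $n\ge 1$ crossings (numbered, as are the $n$ components of the diagram from undercrossing to undercrossing). Crossing $\alpha$ has overstrand $o_\alpha$ and understrands $l_\alpha,r_\alpha$ to the left and right of the oriented overstrand; $\epsilon_1=\pm1$ is the sign of crossing $1$. The framed knot DGA of the diagram is the free noncommutative algebra over $\mathbb Z[\lambda^{\pm1},\mu^{\pm1}]$ on generators $a_{ij}$ ($i\ne j$) of degree $0$, $b_{\alpha i},c_{i\alpha}$ of degree $1$ and $d_{\alpha\beta},e_\alpha$ of degree $2$, with differential determined by the graded Leibniz rule and $$\partial A=0,\quad \partial B=\Psi^L A,\quad \partial C=A\Psi^R,\quad \partial D=B\Psi^R-\Psi^L C,\quad \partial e_\alpha=(B\Psi^R_1-\Psi^L_2C)_{\alpha\alpha},$$ where $A,B,C,D$ are the $n\times n$ matrices of generators, $A_{ii}=1+\mu$, and the nonzero entries of the other matrices are $(\Psi^L)_{\alpha r_\alpha}=1$ (or $\lambda^{-\epsilon_1}$ if $\alpha=1$), $(\Psi^L)_{\alpha l_\alpha}=\mu$, $(\Psi^L)_{\alpha o_\alpha}=-A_{l_\alpha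 o_\alpha}$; $(\Psi^R)_{r_\alpha\alpha}=\mu$ (or $\lambda^{\epsilon_1}\mu$ if $\alpha=1$), $(\Psi^R)_{l_\alpha\alpha}=1$, $(\Psi^R)_{o_\alpha\alpha}=-A_{o_\alpha l_\alpha}$; $\Psi^L_2$ consists of the $l$ and $o$ entries of $\Psi^L$, and $\Psi^R_1$ of the $r$ entries of $\Psi^R$ (entries in coinciding positions are added). Let $X$ be the complement of $K$, $\tilde X$ its infinite cyclic cover, and let the Alexander invariant $H(K)=H_1(\tilde X;\mathbb Z)=G'/G''$, $G=\pi_1(X)$, be the $\mathbb Z[t^{\pm1}]$-module on which $t$ acts by conjugation by a meridian. The Alexander polynomial is a generator of the order ideal (zeroth Fitting ideal) of $H(K)$, defined up to units. Set $\lambda=1$. The framed knot DGA over $\mathbb Z[\mu^{\pm1}]$ then has the canonical augmentation $\varepsilon(a_{ij})=1+\mu$, $\varepsilon(b_{\alpha i})=\varepsilon(c_{i\alpha})=\varepsilon(d_{\alpha\beta})=\varepsilon(e_\alpha)=0$ (that is, $\varepsilon\circ\partial=0$). Its linearization at $\varepsilon$ (the free $\mathbb Z[\mu^{\pm1}]$-module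 on the generators, with differential the linear part of $\partial$ after each generator $g$ is replaced by $g+\varepsilon(g)$) is a complex; let $HC^{\mathrm{lin}}_*$ be its homology, and $HC^{\mathrm{lin}}_*(\,\cdot\,;k)$ the homology of the same complex over $k[\mu^{\pm1}]$, for a field $k$. Then the Alexander invariant and the Alexander polynomial of $K$ are recovered from this linearized DGA, in the following sense. 1. Let $H_c,H_b\subset HC^{\mathrm{lin}}_1$ be the sets of classes of those cycles that lie in the span of the differences $c_{i\alpha}-c_{j\alpha}$, respectively $b_{\alpha i}-b_{\alpha j}$. Then $H_c\cong H(K)$, with $\mu$ acting as $-t$, and $H_b\cong H(K)$, with $\mu$ acting as $-t^{-1}$. Moreover $H_b\cap H_c=0$ and $H_b\oplus H_c$ is a direct summand of $HC^{\mathrm{lin}}_1$. The Alexander polynomial of $K$ exists, i.e. the order ideal of $H(K)$ is principal. 2. Let $K_1,K_2$ be knots given by diagrams as above and let $k$ be a field. If $HC^{\mathrm{lin}}_1(K_1;k)\cong HC^{\mathrm{lin}}_1(K_2;k)$ as $k[\mu^{\pm1}]$-modules, then $k\otimes_{\mathbb Z} H(K_1)\cong k\otimes_{\mathbb Z} H(K_2)$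 as $k[t^{\pm1}]$-modules. 3. If $HC^{\mathrm{lin}}_1(K_1)\cong HC^{\mathrm{lin}}_1(K_2)$ as $\mathbb Z[\mu^{\pm1}]$-modules, then the Alexander polynomials of $K_1$ and $K_2$ agree up to units of $\mathbb Z[t^{\pm1}]$. -/

import Mathlib

open LaurentPolynomial TensorProduct

/-! ### Knot diagrams -/

/-- The combinatorial data of an oriented knot diagram with `n` crossings.  A point of
`Fin n × Bool` is a passage of the knot through a crossing: `(α, true)` is the passage over
crossing `α`, and `(α, false)` the passage under it.  The edge of the diagram that leaves the
passage `x` is also denoted by `x`; it leads to the passage `next x`. -/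
structure KnotCode (n : ℕ) where
  /-- the passage that follows a given one along the oriented knot -/
  next : Equiv.Perm (Fin n × Bool)
  /-- there is one component: the passages form one cycle -/
  isCycleOn : next.IsCycleOn Set.univ
  /-- `true` for a positive crossing, `false` for a negative one -/
  positive : Fin n → Bool
  /-- the number of the component of the diagram (from undercrossing to undercrossing) that
  contains the edge leaving a given passage -/
  strand : Fin n × Bool → Fin n
  /-- the component does not change along an overcrossing -/
  strand_over : ∀ α, strand (α, true) = strand (next.symm (α, true))
  /-- distinct components, each starting at its undercrossing, have distinct numbers -/
  strand_under : Function.Injective fun α => strand (α, false)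

namespace KnotCode

variable {n : ℕ} (D : KnotCode n)

/-- The successor of a directed edge on the boundary of the face to its left.  The directed edge
`(x, true)` is the edge from `x` to `next x`, and `(x, false)` is the same edge run backwards.
On arrival at a crossing one turns left, onto the other branch: for the direction of the knot,
a left turn off the overpass follows the underpass exactly at a positive crossing, and a left
turn off the underpass follows the overpass exactly at a negative one. -/
def leftTurn (e : (Fin n × Bool) × Bool) : (Fin n × Bool) × Bool :=
  let y : Fin n × Bool := if e.2 then D.next e.1 else e.1
  let other : Fin n × Bool := (y.1, !y.2)
  if e.2 = (y.2 == D.positive y.1) then (other, true) else (D.next.symm other, false)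

/-- The faces: orbits of directed edges under left turns. -/
def Face : Type := Quot fun e e' => D.leftTurn e = e'

end KnotCode

/-- An oriented knot diagram with `n` crossings on the sphere.  The underlying four-valent map has
`n` vertices and `2 n` edges, so it is spherical if and only if it has `n + 2` faces. -/
structure KnotDiagram (n : ℕ) extends KnotCode n where
  card_face : Nat.card toKnotCode.Face = n + 2

namespace KnotDiagram

section diagram

variable {n : ℕ} (D : KnotDiagram n)

/-- the overstrand of a crossing -/
def o (α : Fin n) : Fin n := D.strand (α, true)

/-- the understrand that starts at a crossing -/
def outgoing (α : Fin n) : Fin n := D.strand (α, false)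

/-- the understrand that ends at a crossing -/
def incoming (α : Fin n) : Fin n := D.strand (D.next.symm (α, false))

/-- the understrand to the left of the oriented overstrand -/
def l (α : Fin n) : Fin n := if D.positive α then D.outgoing α else D.incoming α

/-- the understrand to the right of the oriented overstrand -/
def r (α : Fin n) : Fin n := if D.positive α then D.incoming α else D.outgoing α

/-- the sign of a crossing -/
def sgn (α : Fin n) : ℤ := if D.positive α then 1 else -1

end diagram

/-! ### The Alexander invariant -/

section alexander

variable {n : ℕ} (D : KnotDiagram n)

/-- The Wirtinger relations `x_r x_o = x_o x_l`, one for each crossing. -/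
def wirtingerRels : Set (FreeGroup (Fin n)) :=
  Set.range fun α => FreeGroup.of (D.r α) * FreeGroup.of (D.o α) *
    (FreeGroup.of (D.o α) * FreeGroup.of (D.l α))⁻¹

/-- The knot group, by its Wirtinger presentation: one meridian for each strand. -/
abbrev KnotGroup : Type := PresentedGroup D.wirtingerRels

/-- The Alexander invariant `H₁(X̃; ℤ)` of the infinite cyclic cover `X̃` of the knot complement.
As `π₁(X̃)` is the commutator subgroup `G'` of the knot group `G`, this is `G' / G''`. -/
def AlexanderInvariant : Type := Additive (Abelianization (commutator D.KnotGroup))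

noncomputable instance : AddCommGroup D.AlexanderInvariant :=
  inferInstanceAs (AddCommGroup (Additive (Abelianization (commutator D.KnotGroup))))

variable [NeZero n]

/-- a meridian of the knot -/
def meridian : D.KnotGroup := PresentedGroup.of 0

/-- The generator `t` of the deck group, acting on `G' / G''` by `g ↦ x g x⁻¹`, `x` a meridian. -/
noncomputable def deck : D.AlexanderInvariant ≃ₗ[ℤ] D.AlexanderInvariant :=
  (MulEquiv.toAdditive
    (MulEquiv.abelianizationCongr (MulAut.conjNormal D.meridian :
      commutator D.KnotGroup ≃* commutator D.KnotGroup))).toIntLinearEquiv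

/-- The action of `ℤ[t, t⁻¹]` on the Alexander invariant, `t` acting by `deck`. -/
noncomputable def laurentAction : ℤ[T;T⁻¹] →ₐ[ℤ] Module.End ℤ D.AlexanderInvariant :=
  AddMonoidAlgebra.lift ℤ (Module.End ℤ D.AlexanderInvariant) ℤ
    ((LinearEquiv.automorphismGroup.toLinearMapMonoidHom (R := ℤ) (M := D.AlexanderInvariant)).comp
      (zpowersHom _ D.deck))

noncomputable instance : Module ℤ[T;T⁻¹] D.AlexanderInvariant :=
  Module.compHom D.AlexanderInvariant D.laurentAction.toRingHom

theorem T_one_smul (x : D.AlexanderInvariant) : (T 1 : ℤ[T;T⁻¹]) • x = D.deck x := by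
  change D.laurentAction (T 1) x = _
  rw [laurentAction, show (T 1 : ℤ[T;T⁻¹]) = AddMonoidAlgebra.single 1 1 from rfl,
    AddMonoidAlgebra.lift_single]
  simp [zpowersHom]

end alexander

end KnotDiagram

/-- The order ideal (zeroth Fitting ideal) of a finitely generated module: it is generated by the
determinants of the square matrices of relations among generating tuples. -/
def orderIdeal (R M : Type*) [CommRing R] [AddCommGroup M] [Module R M] : Ideal R :=
  Ideal.span {x | ∃ (m : ℕ) (g : Fin m → M) (X : Matrix (Fin m) (Fin m) R),
    Submodule.span R (Set.range g) = ⊤ ∧ (∀ i, ∑ j, X i j • g j = 0) ∧ X.det = x}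

/-- `Δ` is an Alexander polynomial of the knot: a generator of the order ideal of the Alexander
invariant.  It is determined up to a unit `± t ^ k`. -/
def KnotDiagram.IsAlexanderPolynomial {n : ℕ} [NeZero n] (D : KnotDiagram n)
    (Δ : ℤ[T;T⁻¹]) : Prop :=
  Ideal.span {Δ} = orderIdeal ℤ[T;T⁻¹] D.AlexanderInvariant

/-- The quotient of a submodule `Z` by its intersection with a submodule `B`. -/
abbrev Subquotient {R M : Type*} [CommRing R] [AddCommGroup M] [Module R M]
    (Z B : Submodule R M) : Type _ :=
  Z ⧸ B.submoduleOf Z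

/-- The submodule of classes in `Subquotient Z B` of the elements of `Z` that lie in `N`. -/
def Subquotient.classesOf {R M : Type*} [CommRing R] [AddCommGroup M] [Module R M]
    (Z B N : Submodule R M) : Submodule R (Subquotient Z B) :=
  (N.submoduleOf Z).map (B.submoduleOf Z).mkQ

/-! ### The framed knot DGA -/

/-- The generators of the framed knot DGA. -/
inductive DGAGen (n : ℕ) : Type
  | a (i j : Fin n) (h : i ≠ j)
  | b (α i : Fin n)
  | c (i α : Fin n)
  | d (α β : Fin n)
  | e (α : Fin n)

namespace DGAGen

/-- the degree of a generator -/
def deg {n : ℕ} : DGAGen n → ℕ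
  | a _ _ _ => 0
  | b _ _ => 1
  | c _ _ => 1
  | d _ _ => 2
  | e _ => 2

end DGAGen

/-- The underlying algebra of the framed knot DGA, over a commutative ring `S` of coefficients. -/
abbrev DGAAlg (n : ℕ) (S : Type*) [CommRing S] : Type _ := FreeAlgebra S (DGAGen n)

namespace KnotDiagram

section dga

variable {n : ℕ} [NeZero n] (D : KnotDiagram n) {S : Type*} [CommRing S]

/-! In this section `lam` and `mu` are units of the coefficient ring `S`.  The framed knot DGA
itself is the case `S = ℤ[λ^±1, μ^±1]`; the framed knot DGA with `λ = 1` is `S = ℤ[μ^±1]`,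
`lam = 1`, `mu = μ`.  The crossing that carries `λ` is crossing `0`.  If some of the strands
`o α`, `l α`, `r α` coincide, the contributions to a matrix entry are added, and `a_ii` stands
for `1 + μ`. -/

/-- the matrix `A` -/
noncomputable def matA (mu : Sˣ) : Matrix (Fin n) (Fin n) (DGAAlg n S) := fun i j =>
  open Classical in
  if h : i = j then algebraMap S _ (1 + mu) else FreeAlgebra.ι S (DGAGen.a i j h)

/-- the matrix `B` -/
noncomputable def matB : Matrix (Fin n) (Fin n) (DGAAlg n S) := fun α i =>
  FreeAlgebra.ι S (DGAGen.b α i)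

/-- the matrix `C` -/
noncomputable def matC : Matrix (Fin n) (Fin n) (DGAAlg n S) := fun i α =>
  FreeAlgebra.ι S (DGAGen.c i α)

/-- the matrix `Ψᴸ₂` -/
noncomputable def psiL2 (mu : Sˣ) : Matrix (Fin n) (Fin n) (DGAAlg n S) := fun α i =>
  (if i = D.l α then algebraMap S _ (mu : S) else 0) -
    (if i = D.o α then matA mu (D.l α) (D.o α) else 0)

/-- the matrix `Ψᴸ` -/
noncomputable def psiL (lam mu : Sˣ) : Matrix (Fin n) (Fin n) (DGAAlg n S) := fun α i =>
  (if i = D.r α then algebraMap S _ (if α = 0 then ((lam ^ (-D.sgn 0) : Sˣ) : S) else 1) else 0) +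
    D.psiL2 mu α i

/-- the matrix `Ψᴿ₁` -/
noncomputable def psiR1 (lam mu : Sˣ) : Matrix (Fin n) (Fin n) (DGAAlg n S) := fun i α =>
  if i = D.r α then
    algebraMap S _ (if α = 0 then ((lam ^ D.sgn 0 * mu : Sˣ) : S) else (mu : S)) else 0

/-- the matrix `Ψᴿ` -/
noncomputable def psiR (lam mu : Sˣ) : Matrix (Fin n) (Fin n) (DGAAlg n S) := fun i α =>
  D.psiR1 lam mu i α + (if i = D.l α then 1 else 0) -
    (if i = D.o α then matA mu (D.o α) (D.l α) else 0)

/-- The differential on generators. -/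
noncomputable def diffGen (lam mu : Sˣ) : DGAGen n → DGAAlg n S
  | .a _ _ _ => 0
  | .b α i => (D.psiL lam mu * matA mu : Matrix (Fin n) (Fin n) (DGAAlg n S)) α i
  | .c i α => (matA mu * D.psiR lam mu : Matrix (Fin n) (Fin n) (DGAAlg n S)) i α
  | .d α β => (matB * D.psiR lam mu - D.psiL lam mu * matC : Matrix (Fin n) (Fin n) (DGAAlg n S)) α β
  | .e α => (matB * D.psiR1 lam mu - D.psiL2 mu * matC : Matrix (Fin n) (Fin n) (DGAAlg n S)) α α

/-- The automorphism `x ↦ (-1) ^ |x| x` of the graded algebra. -/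
noncomputable def gradeSign : DGAAlg n S →ₐ[S] DGAAlg n S :=
  FreeAlgebra.lift S fun g => (-1 : S) ^ g.deg • FreeAlgebra.ι S g

/-- The homomorphism `x ↦ !![(-1) ^ |x| x, ∂ x; 0, x]`, which encodes the graded Leibniz rule. -/
noncomputable def diffHom (lam mu : Sˣ) :
    DGAAlg n S →ₐ[S] Matrix (Fin 2) (Fin 2) (DGAAlg n S) :=
  FreeAlgebra.lift S fun g =>
    !![gradeSign (FreeAlgebra.ι S g), D.diffGen lam mu g; 0, FreeAlgebra.ι S g]

/-- The differential `∂` of the framed knot DGA: it is given by `diffGen` on generators and satisfies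
the graded Leibniz rule. -/
noncomputable def diff (lam mu : Sˣ) : DGAAlg n S →ₗ[S] DGAAlg n S where
  toFun x := D.diffHom lam mu x 0 1
  map_add' x y := by simp
  map_smul' s x := by simp

theorem diffHom_aux (lam mu : Sˣ) (x : DGAAlg n S) :
    D.diffHom lam mu x 0 0 = gradeSign x ∧ D.diffHom lam mu x 1 0 = 0 ∧
      D.diffHom lam mu x 1 1 = x := by
  induction x using FreeAlgebra.induction with
  | grade0 s =>
    simp [Matrix.algebraMap_matrix_apply]
  | grade1 g => simp [diffHom]
  | mul x y hx hy =>
    simp [Matrix.mul_apply, Fin.sum_univ_two, hx, hy]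
  | add x y hx hy => simp [hx, hy]

theorem diff_ι (lam mu : Sˣ) (g : DGAGen n) :
    D.diff lam mu (FreeAlgebra.ι S g) = D.diffGen lam mu g := by
  simp [diff, diffHom]

theorem diff_mul (lam mu : Sˣ) (x y : DGAAlg n S) :
    D.diff lam mu (x * y) = D.diff lam mu x * y + gradeSign x * D.diff lam mu y := by
  have hx := D.diffHom_aux lam mu x
  have hy := D.diffHom_aux lam mu y
  simp [diff, Matrix.mul_apply, Fin.sum_univ_two, hx, hy, add_comm]

end dga

/-! ### Linearization -/

section linearization

variable {n : ℕ} {S : Type*} [CommRing S]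

/-- The linear part at `ε` of an element of the algebra: substitute `g + ε g` for each generator
`g` and keep the terms of word length one.  (Terms of word length at most one are recorded in the
square-zero extension of `S` by the free module on the generators.) -/
noncomputable def linearPart (ε : DGAAlg n S →ₐ[S] S) : DGAAlg n S →ₗ[S] (DGAGen n →₀ S) :=
  (TrivSqZeroExt.sndHom S (DGAGen n →₀ S)).comp
    (FreeAlgebra.lift S fun g =>
      (TrivSqZeroExt.inl (ε (FreeAlgebra.ι S g)) + TrivSqZeroExt.inr (Finsupp.single g 1) :
        TrivSqZeroExt S (DGAGen n →₀ S))).toLinearMap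

theorem linearPart_ι (ε : DGAAlg n S →ₐ[S] S) (g : DGAGen n) :
    linearPart ε (FreeAlgebra.ι S g) = Finsupp.single g 1 := by
  simp [linearPart]

theorem linearPart_mul (ε : DGAAlg n S →ₐ[S] S) (x y : DGAAlg n S) :
    linearPart ε (x * y) = ε x • linearPart ε y + ε y • linearPart ε x := by
  have h : ∀ z : DGAAlg n S, ((FreeAlgebra.lift S fun g =>
      (TrivSqZeroExt.inl (ε (FreeAlgebra.ι S g)) + TrivSqZeroExt.inr (Finsupp.single g 1) :
        TrivSqZeroExt S (DGAGen n →₀ S))) z).fst = ε z := by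
    intro z
    induction z using FreeAlgebra.induction with
    | grade0 s => simp [TrivSqZeroExt.algebraMap_eq_inl]
    | grade1 g => simp
    | mul x y hx hy => simp [hx, hy]
    | add x y hx hy => simp [hx, hy]
  simp [linearPart, h]

variable [NeZero n] (D : KnotDiagram n)

/-- The differential of the linearization of the framed knot DGA at `ε`. -/
noncomputable def linearizedDiff (lam mu : Sˣ) (ε : DGAAlg n S →ₐ[S] S) :
    (DGAGen n →₀ S) →ₗ[S] (DGAGen n →₀ S) :=
  Finsupp.linearCombination S fun g => linearPart ε (D.diff lam mu (FreeAlgebra.ι S g))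

/-- The canonical augmentation, `a_ij ↦ 1 + μ` and all other generators `↦ 0`. -/
noncomputable def canonicalAug (mu : Sˣ) : DGAAlg n S →ₐ[S] S :=
  FreeAlgebra.lift S fun g => match g with
    | .a _ _ _ => 1 + (mu : S)
    | _ => 0

end linearization

/-! The framed knot DGA with `λ = 1`, over a ring `S` with a unit `m` in the role of `μ`, and its
linearization at the canonical augmentation. -/

section lambdaOne

variable {n : ℕ} [NeZero n] (D : KnotDiagram n) {S : Type*} [CommRing S] (m : Sˣ)

/-- The differential of the linearized complex, on the free module on the generators of the DGA. -/
noncomputable def linDiff : (DGAGen n →₀ S) →ₗ[S] (DGAGen n →₀ S) :=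
  D.linearizedDiff 1 m (canonicalAug m)

/-- the chains of degree `i` -/
noncomputable def chainsDeg (n : ℕ) (S : Type*) [CommRing S] (i : ℕ) :
    Submodule S (DGAGen n →₀ S) :=
  Finsupp.supported S S {g | g.deg = i}

/-- the cycles of degree `i` of the linearized complex -/
noncomputable def cycles (i : ℕ) : Submodule S (DGAGen n →₀ S) :=
  chainsDeg n S i ⊓ (D.linDiff m).ker

/-- the boundaries of degree `i` of the linearized complex -/
noncomputable def boundaries (i : ℕ) : Submodule S (DGAGen n →₀ S) :=
  (chainsDeg n S (i + 1)).map (D.linDiff m)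

/-- the linearized homology in degree `i` -/
abbrev LinHomology (i : ℕ) : Type _ :=
  Subquotient (D.cycles m i) (D.boundaries m i)

/-- the classes of the cycles in the span of the differences `b_{α i} - b_{α j}` -/
noncomputable def bClasses : Submodule S (D.LinHomology m 1) :=
  Subquotient.classesOf (D.cycles m 1) (D.boundaries m 1)
    (Submodule.span S {x | ∃ α i j : Fin n,
      x = Finsupp.single (DGAGen.b α i) 1 - Finsupp.single (DGAGen.b α j) 1})

/-- the classes of the cycles in the span of the differences `c_{i α} - c_{j α}` -/
noncomputable def cClasses : Submodule S (D.LinHomology m 1) :=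
  Subquotient.classesOf (D.cycles m 1) (D.boundaries m 1)
    (Submodule.span S {x | ∃ α i j : Fin n,
      x = Finsupp.single (DGAGen.c i α) 1 - Finsupp.single (DGAGen.c j α) 1})

end lambdaOne

/-- the unit `μ` of `k[μ, μ⁻¹]` -/
noncomputable def mu (k : Type*) [CommRing k] : (k[T;T⁻¹])ˣ where
  val := T 1
  inv := T (-1)
  val_inv := by rw [← T_add]; simp
  inv_val := by rw [← T_add]; simp

end KnotDiagram

/-! Write `m` for μ and t for `-m`. At the canonical augmentation the rows of Ψᴸ become the
abelianized Wirtinger relations `relVec m`, and the columns of Ψᴿ become `coVec m`, unit multiples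
of the relations for `m⁻¹`. The relations satisfy one linear dependency whose coefficients are
units, up to sign powers of t read off from an Alexander numbering of the regions
(`sum_weight_smul_relVec`). So one relation may be traded for the triviality of the first meridian,
and a square matrix `presMatrix m` presents a module `AlexModule m`. An affine action of the knot
group, which is Fox calculus, identifies this module with the Alexander invariant (`alexEquiv`). The
determinant is a unit at t = 1, so it is nonzero, and it generates the order ideal
(`orderIdeal_of_presentation`).

Degree one chains in the span of the differences of generators are pairs of matrices β, γ with
vanishing row sums, and the cycle condition is a bilinear equation in them (`linDiff_eq_zero_iff`).
If β = 0, the equation forces γ to be the dependency times one vector, and boundaries of the d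
identify vectors that agree modulo the relations. This gives H_c, and H_b is symmetric
(`range_cSection`, `range_bSection`). The retractions `cRetract` and `bRetract` split both off.

For the converse statements, put A = `AlexModule m` and A' = `AlexModule m⁻¹`. The torsion of the
homology is A' plus the dependencies with coefficients in A between the relations for `m⁻¹`
(`torsionEquiv`). The multiples of the standard dependency split off a copy of A, and the rest is
the kernel on A of the transposed presentation matrix of A'. Over a principal ideal domain a
nonsingular square matrix is equivalent to its transpose, so this kernel is Hom(A', A). Moreover A'
≅ A if the domain contains a field: colourings of the regions map onto colourings of the strands and
embed into the dual dependencies, which gives an inequality of lengths of Hom spaces, and exchanging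
`m` with `m⁻¹` gives the opposite one (`nonempty_alexModule_inv_equiv`). So the torsion is N ⊕ N ⊕
End N with N = A. If N has a_t cyclic p-primary summands of exponent at least t, this module has
(a_t + 1)² - 1 of them, so it determines N (`nonempty_equiv_of_prod_end_equiv`).

Over ℤ, the homology is first localized at the nonzero integers. The determinants over ℚ then agree
up to units. As they are units at t = 1, no prime number divides them, and Gauss's argument brings
the divisibilities back to ℤ (`associated_det`). -/

set_option linter.unusedSectionVars false

/-! ### Faces, strands and flows on a spherical diagram. -/

namespace KnotCode

variable {n : ℕ} (D : KnotCode n)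

theorem passage_induction {p : Fin n × Bool → Prop} {x₀ : Fin n × Bool} (h₀ : p x₀)
    (hs : ∀ x, p x → p (D.next x)) (x : Fin n × Bool) : p x := by
  obtain ⟨i, hi⟩ := (D.isCycleOn.2 (Set.mem_univ x₀) (Set.mem_univ x)).exists_nat_pow_eq
  rw [← hi]
  clear hi
  induction i with
  | zero => simpa using h₀
  | succ i ih => rw [pow_succ', Equiv.Perm.mul_apply]; exact hs _ ih

theorem eq_of_next_eq {Y : Type*} {u : Fin n × Bool → Y} (hu : ∀ x, u (D.next x) = u x)
    (x y : Fin n × Bool) : u x = u y :=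
  D.passage_induction (p := fun x => u x = u y) rfl (fun x hx => (hu x).trans hx) x

/-- the edge that arrives at the overpass of a crossing -/
def ov (α : Fin n) : Fin n × Bool := D.next.symm (α, true)

/-- the edge that arrives at the underpass of a crossing -/
def un (α : Fin n) : Fin n × Bool := D.next.symm (α, false)

@[simp] theorem next_ov (α : Fin n) : D.next (D.ov α) = (α, true) := by simp [ov]
@[simp] theorem next_un (α : Fin n) : D.next (D.un α) = (α, false) := by simp [un]

/-- the face to the left of an edge -/
def left (x : Fin n × Bool) : D.Face := Quot.mk _ (x, true)

/-- the face to the right of an edge -/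
def right (x : Fin n × Bool) : D.Face := Quot.mk _ (x, false)

theorem left_or_right (F : D.Face) : ∃ x, F = D.left x ∨ F = D.right x := by
  obtain ⟨⟨x, b⟩, rfl⟩ := Quot.exists_rep F
  cases b
  · exact ⟨x, Or.inr rfl⟩
  · exact ⟨x, Or.inl rfl⟩

section corners

variable {α : Fin n}

theorem left_ov_of_pos (h : D.positive α = true) : D.left (D.ov α) = D.left (α, false) :=
  Quot.sound (by simp [leftTurn, h])

theorem left_un_of_pos (h : D.positive α = true) : D.left (D.un α) = D.right (D.ov α) :=
  Quot.sound (by simp [leftTurn, h]; rfl)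

theorem right_under_of_pos (h : D.positive α = true) : D.right (α, false) = D.left (α, true) :=
  Quot.sound (by simp [leftTurn, h])

theorem right_over_of_pos (h : D.positive α = true) : D.right (α, true) = D.right (D.un α) :=
  Quot.sound (by simp [leftTurn, h]; rfl)

theorem left_ov_of_neg (h : D.positive α = false) : D.left (D.ov α) = D.right (D.un α) :=
  Quot.sound (by simp [leftTurn, h]; rfl)

theorem left_un_of_neg (h : D.positive α = false) : D.left (D.un α) = D.left (α, true) :=
  Quot.sound (by simp [leftTurn, h])

theorem right_over_of_neg (h : D.positive α = false) : D.right (α, true) = D.left (α, false) :=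
  Quot.sound (by simp [leftTurn, h])

theorem right_under_of_neg (h : D.positive α = false) : D.right (α, false) = D.right (D.ov α) :=
  Quot.sound (by simp [leftTurn, h]; rfl)

end corners

theorem passage_cases {p : Fin n × Bool → Prop} (h : ∀ α, p (α, true)) (h' : ∀ α, p (α, false))
    (x : Fin n × Bool) : p x := by
  obtain ⟨α, b⟩ := x
  cases b
  exacts [h' α, h α]

/-- The dual graph of a diagram is connected. -/
theorem face_const {Y : Type*} {u : D.Face → Y} (hu : ∀ x, u (D.left x) = u (D.right x))
    (F G : D.Face) : u F = u G := by
  have key : ∀ x y, u (D.left x) = u (D.left y) := by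
    refine D.eq_of_next_eq fun x => ?_
    obtain ⟨y, rfl⟩ := D.next.symm.surjective x
    rw [Equiv.apply_symm_apply]
    revert y
    refine passage_cases (fun α => ?_) fun α => ?_ <;> rcases h : D.positive α
    · exact (congrArg u (D.left_un_of_neg h)).symm.trans ((hu _).trans
        (congrArg u (D.left_ov_of_neg h).symm))
    · exact (congrArg u (D.right_under_of_pos h)).symm.trans ((hu _).symm.trans
        (congrArg u (D.left_ov_of_pos h).symm))
    · exact (congrArg u (D.right_over_of_neg h)).symm.trans ((hu _).symm.trans
        (congrArg u (D.left_un_of_neg h).symm))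
    · exact (congrArg u (D.left_ov_of_pos h)).symm.trans ((hu _).trans
        (congrArg u (D.left_un_of_pos h).symm))
  obtain ⟨x, rfl | rfl⟩ := D.left_or_right F <;> obtain ⟨y, rfl | rfl⟩ := D.left_or_right G
  · exact key x y
  · exact (key x y).trans (hu y)
  · exact (hu x).symm.trans (key x y)
  · exact (hu x).symm.trans ((key x y).trans (hu y))

/-- The numbers of the components are exactly the numbers of the outgoing understrands. -/
theorem strand_under_bijective : Function.Bijective fun α => D.strand (α, false) :=
  Finite.injective_iff_bijective.1 D.strand_under

/-- Following the knot, the underpass met last supplies `α`; neither the strand nor `u` has changed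
since. -/
theorem exists_under [NeZero n] (x : Fin n × Bool) {Y : Type*} {u : Fin n × Bool → Y}
    (hu : ∀ α, u (α, true) = u (D.ov α)) :
    ∃ α, D.strand x = D.strand (α, false) ∧ u x = u (α, false) := by
  refine D.passage_induction (x₀ := (0, false)) (p := fun x =>
    ∃ α, D.strand x = D.strand (α, false) ∧ u x = u (α, false)) ⟨0, rfl, rfl⟩ (fun x hx => ?_) x
  obtain ⟨y, rfl⟩ := D.next.symm.surjective x
  rw [Equiv.apply_symm_apply]
  revert y
  refine passage_cases (fun α => ?_) fun α _ => ⟨α, rfl, rfl⟩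
  rintro ⟨β, h1, h2⟩
  exact ⟨β, (D.strand_over α).trans h1, (hu α).trans h2⟩

/-- A function on the edges that does not change along overcrossings only depends on the
component. -/
theorem eq_of_strand_eq [NeZero n] {Y : Type*} {u : Fin n × Bool → Y}
    (hu : ∀ α, u (α, true) = u (D.ov α)) {x y : Fin n × Bool} (h : D.strand x = D.strand y) :
    u x = u y := by
  obtain ⟨α, h1, h2⟩ := D.exists_under x hu
  obtain ⟨β, h3, h4⟩ := D.exists_under y hu
  rw [h2, h4, D.strand_under (h1.symm.trans (h.trans h3))]

/-- reindexing of a sum over the edges by their ends -/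
theorem sum_next {Y : Type*} [AddCommMonoid Y] (u : Fin n × Bool → Y) :
    ∑ x, u (D.next.symm x) = ∑ x, u x := Equiv.sum_comp D.next.symm u

theorem sum_passages {Y : Type*} [AddCommMonoid Y] (u : Fin n × Bool → Y) :
    ∑ x, u x = ∑ α, (u (α, true) + u (α, false)) := by
  simp [Fintype.sum_prod_type]

/-- the coboundary of a function on the crossings -/
def vertexBoundary (k : Type*) [Field k] : (Fin n → k) →ₗ[k] (Fin n × Bool → k) where
  toFun y x := y (D.next x).1 - y x.1
  map_add' y z := by ext x; simp; ring
  map_smul' c y := by ext x; simp; ring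

variable (k : Type*) [Field k]

/-- The kernel consists of functions that are constant along the knot, hence of constants. -/
theorem finrank_range_vertexBoundary [NeZero n] :
    n ≤ Module.finrank k (D.vertexBoundary k).range + 1 := by
  have h := (D.vertexBoundary k).finrank_range_add_finrank_ker
  have h2 : Module.finrank k (D.vertexBoundary k).ker ≤ 1 := by
    refine finrank_le_one ⟨1, ?_⟩ fun v => ?_
    · ext x; simp [vertexBoundary]
    · refine ⟨v.1 0, ?_⟩
      ext α
      have := D.eq_of_next_eq (u := fun x => v.1 x.1) (fun x => ?_) (0, true) (α, true)
      · simpa using this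
      · have := congrFun v.2 x
        simpa [vertexBoundary, sub_eq_zero] using this
  rw [Module.finrank_fin_fun] at h
  omega

/-- Around a crossing, the differences across the incoming and the outgoing edges agree. -/
theorem difference_in_eq_out {Y : Type*} [AddCommGroup Y] (u : D.Face → Y) (α : Fin n) :
    (u (D.left (D.ov α)) - u (D.right (D.ov α))) + (u (D.left (D.un α)) - u (D.right (D.un α))) =
      (u (D.left (α, true)) - u (D.right (α, true))) +
        (u (D.left (α, false)) - u (D.right (α, false))) := by
  rcases h : D.positive α
  · rw [D.left_ov_of_neg h, D.left_un_of_neg h, D.right_over_of_neg h, D.right_under_of_neg h]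
    abel
  · rw [D.left_ov_of_pos h, D.left_un_of_pos h, D.right_over_of_pos h, D.right_under_of_pos h]
    abel

/-- Summation by parts: regrouped by crossings, each coefficient `y α` meets incoming minus outgoing
values. -/
theorem sum_boundary_smul {Z : Type*} [AddCommGroup Z] [Module k Z] {g : Fin n × Bool → Z}
    (hg : ∀ α, g (D.ov α) + g (D.un α) = g (α, true) + g (α, false)) (y : Fin n → k) :
    ∑ x, D.vertexBoundary k y x • g x = 0 := by
  simp only [vertexBoundary, LinearMap.coe_mk, AddHom.coe_mk, sub_smul, Finset.sum_sub_distrib]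
  rw [← D.sum_next fun x => y (D.next x).1 • g x, sub_eq_zero, sum_passages, sum_passages]
  refine Finset.sum_congr rfl fun α _ => ?_
  simp only [Equiv.apply_symm_apply, ← smul_add]
  rw [← hg, ov, un]

section faces

variable [Finite D.Face]

/-- the map that takes an edge to the difference of the faces on its two sides -/
noncomputable def faceDifference : (Fin n × Bool → k) →ₗ[k] (D.Face → k) :=
  open Classical in
  Fintype.linearCombination k fun x => (Pi.single (D.left x) 1 - Pi.single (D.right x) 1)

/-- Modulo the differences across edges all faces have the same image, since the dual graph is
connected. So the cokernel is at most a line. -/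
theorem finrank_range_faceDifference [NeZero n] :
    Nat.card D.Face ≤ Module.finrank k (D.faceDifference k).range + 1 := by
  classical
  have := Fintype.ofFinite D.Face
  have h := Submodule.finrank_quotient_add_finrank (D.faceDifference k).range
  have h2 : Module.finrank k ((D.Face → k) ⧸ (D.faceDifference k).range) ≤ 1 := by
    set π := (D.faceDifference k).range.mkQ with hπ
    have hc : ∀ F G : D.Face, π (Pi.single F 1) = π (Pi.single G 1) :=
      D.face_const fun x => by
        rw [← sub_eq_zero, ← map_sub, hπ, Submodule.mkQ_apply, Submodule.Quotient.mk_eq_zero]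
        exact ⟨Pi.single x 1, by simp [faceDifference]⟩
    refine finrank_le_one (π (Pi.single (D.left (0, true)) 1)) fun v => ?_
    obtain ⟨v, rfl⟩ := Submodule.mkQ_surjective _ v
    refine ⟨∑ F, v F, ?_⟩
    conv_rhs => rw [pi_eq_sum_univ' v]
    rw [Finset.sum_smul, map_sum]
    refine Finset.sum_congr rfl fun F _ => ?_
    have : (v F • fun j => if j = F then (1 : k) else 0) = v F • Pi.single F 1 := by
      ext j; simp [Pi.single_apply]
    rw [hc _ F, ← map_smul]
  rw [Module.finrank_fintype_fun_eq_card, ← Nat.card_eq_fintype_card] at h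
  omega

/-- Vanishing first homology of the sphere, by counting: one inclusion is clear, the two ranks are
at least `n - 1` and `n + 1`, and there are `2 n` edges. -/
theorem ker_faceDifference [NeZero n] (hF : n + 2 ≤ Nat.card D.Face) :
    (D.faceDifference k).ker = (D.vertexBoundary k).range := by
  classical
  have := Fintype.ofFinite D.Face
  symm
  apply Submodule.eq_of_le_of_finrank_le
  · rintro _ ⟨y, rfl⟩
    rw [LinearMap.mem_ker]
    simp only [faceDifference, Fintype.linearCombination_apply]
    convert D.sum_boundary_smul k (g := fun x =>
      (Pi.single (D.left x) (1 : k) - Pi.single (D.right x) 1 : D.Face → k)) (fun α => ?_) y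
    exact D.difference_in_eq_out (fun F => (Pi.single F 1 : D.Face → k)) α
  · have h1 := (D.faceDifference k).finrank_range_add_finrank_ker
    have h2 := D.finrank_range_faceDifference k
    have h3 := D.finrank_range_vertexBoundary k
    simp only [Module.finrank_fintype_fun_eq_card, Fintype.card_prod, Fintype.card_fin,
      Fintype.card_bool] at h1
    omega

/-- On a spherical diagram, a function on the edges for which the sums over the incoming and the
outgoing edges of each crossing agree is the difference of a function on the faces. -/
theorem exists_face_function [NeZero n] (hF : n + 2 ≤ Nat.card D.Face) {Z : Type*} [AddCommGroup Z]
    [Module k Z] (g : Fin n × Bool → Z)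
    (hg : ∀ α, g (D.ov α) + g (D.un α) = g (α, true) + g (α, false)) :
    ∃ Φ : D.Face → Z, ∀ x, Φ (D.left x) - Φ (D.right x) = g x := by
  classical
  have := Fintype.ofFinite D.Face
  -- The linear map defined by `g` vanishes on the kernel of `faceDifference`, so it factors through
  -- the range. Over a field it extends from there to all functions on the faces.
  obtain ⟨h, hh⟩ : ∃ h : (D.Face → k) →ₗ[k] Z,
      h ∘ₗ D.faceDifference k = Fintype.linearCombination k g := by
    obtain ⟨s, hs⟩ := (D.faceDifference k).rangeRestrict.exists_rightInverse_of_surjective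
      (LinearMap.range_rangeRestrict _)
    obtain ⟨h, hh⟩ := LinearMap.exists_extend (Fintype.linearCombination k g ∘ₗ s)
    refine ⟨h, LinearMap.ext fun v => ?_⟩
    have h1 := LinearMap.congr_fun hh ((D.faceDifference k).rangeRestrict v)
    have h2 := LinearMap.congr_fun hs ((D.faceDifference k).rangeRestrict v)
    refine h1.trans ?_
    simp only [LinearMap.comp_apply, LinearMap.id_apply] at h2 ⊢
    rw [← sub_eq_zero, ← map_sub]
    have h3 : s ((D.faceDifference k).rangeRestrict v) - v ∈ (D.faceDifference k).ker := by
      rw [LinearMap.mem_ker, map_sub, sub_eq_zero]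
      exact congrArg Subtype.val h2
    rw [D.ker_faceDifference k hF] at h3
    obtain ⟨y, hy⟩ := h3
    rw [← hy, Fintype.linearCombination_apply]
    exact D.sum_boundary_smul k hg y
  refine ⟨fun F => h (Pi.single F 1), fun x => ?_⟩
  have := LinearMap.congr_fun hh (Pi.single x 1)
  simpa [faceDifference, Fintype.linearCombination_apply_single] using this

end faces

end KnotCode

/-! ### The Alexander numbering of the regions. -/

namespace KnotDiagram

variable {n : ℕ} [NeZero n] (D : KnotDiagram n)

instance : Finite D.Face :=
  Nat.finite_of_card_ne_zero (by rw [D.card_face]; omega)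

/-- The constant flow `1` on the edges is a face difference over `ℚ`. Rounding down commutes with
adding one and makes it integral. -/
theorem exists_alexanderNumbering :
    ∃ W : D.Face → ℤ, ∀ x, W (D.left x) = W (D.right x) + 1 := by
  obtain ⟨Φ, hΦ⟩ := D.exists_face_function ℚ D.card_face.ge (fun _ => (1 : ℚ)) fun _ => rfl
  refine ⟨fun F => ⌊Φ F⌋, fun x => ?_⟩
  rw [← Int.floor_add_one, ← hΦ x, add_sub_cancel]

/-- An Alexander numbering: it decreases by one when an edge is crossed from left to right. -/
noncomputable def numbering : D.Face → ℤ := D.exists_alexanderNumbering.choose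

theorem numbering_left (x : Fin n × Bool) :
    D.numbering (D.left x) = D.numbering (D.right x) + 1 :=
  D.exists_alexanderNumbering.choose_spec x

/-- the Alexander number of the face to the right of an edge -/
noncomputable def index (x : Fin n × Bool) : ℤ := D.numbering (D.right x)

/-- The two branches exchange their indices at a crossing, whatever its sign. This, with
`index_over`, turns a Wirtinger relation into a flow condition. -/
theorem index_under (α : Fin n) : D.index (α, false) = D.index (D.ov α) := by
  rcases h : D.positive α
  · exact congrArg D.numbering (D.right_under_of_neg h)
  · have := congrArg D.numbering (D.left_ov_of_pos h)
    rw [numbering_left, numbering_left] at this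
    exact (add_right_cancel this).symm

theorem index_over (α : Fin n) : D.index (α, true) = D.index (D.un α) := by
  rcases h : D.positive α
  · have := congrArg D.numbering (D.left_un_of_neg h)
    rw [numbering_left, numbering_left] at this
    exact (add_right_cancel this).symm
  · exact congrArg D.numbering (D.right_over_of_pos h)

theorem index_ov_of_pos {α : Fin n} (h : D.positive α = true) :
    D.index (D.ov α) = D.index (D.un α) + 1 := by
  have := congrArg D.numbering (D.left_un_of_pos h)
  rw [numbering_left] at this
  exact this.symm

theorem index_un_of_neg {α : Fin n} (h : D.positive α = false) :
    D.index (D.un α) = D.index (D.ov α) + 1 := by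
  have := congrArg D.numbering (D.left_ov_of_neg h)
  rw [numbering_left] at this
  exact this.symm

end KnotDiagram

/-! ### The Alexander module and its square presentation matrix. -/

namespace KnotDiagram

variable {n : ℕ} [NeZero n] (D : KnotDiagram n) {S : Type*} [CommRing S] (m : Sˣ)

/-- The abelianized Wirtinger relation of a crossing, with `-m` in the role of `t`. -/
def relVec (α : Fin n) : Fin n → S :=
  Pi.single (D.r α) 1 + (m : S) • Pi.single (D.l α) 1 - (1 + (m : S)) • Pi.single (D.o α) 1

theorem sum_relVec_smul {Z : Type*} [AddCommGroup Z] [Module S Z] (α : Fin n) (f : Fin n → Z) :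
    ∑ i, D.relVec m α i • f i = f (D.r α) + (m : S) • f (D.l α) - (1 + (m : S)) • f (D.o α) := by
  simp [relVec, Pi.single_apply, sub_smul, add_smul, Finset.sum_sub_distrib,
    Finset.sum_add_distrib]

theorem strand_ov (α : Fin n) : D.strand (D.ov α) = D.o α := (D.strand_over α).symm

/-- The weight of a crossing in the relation between the abelianized Wirtinger relations. -/
noncomputable def weight (α : Fin n) : Sˣ :=
  if D.positive α then (-m) ^ D.index (D.un α) else -(-m) ^ D.index (D.ov α)

/-- The relation of a crossing as a weighted sum over the four edges at it. -/
theorem weight_smul_relVec {Z : Type*} [AddCommGroup Z] [Module S Z] (α : Fin n)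
    (f : Fin n → Z) :
    (D.weight m α : S) • ∑ i, D.relVec m α i • f i =
      ((((-m) ^ D.index (D.ov α) : Sˣ) : S) • f (D.strand (D.ov α)) +
        (((-m) ^ D.index (D.un α) : Sˣ) : S) • f (D.strand (D.un α))) -
      ((((-m) ^ D.index (α, true) : Sˣ) : S) • f (D.strand (α, true)) +
        (((-m) ^ D.index (α, false) : Sˣ) : S) • f (D.strand (α, false))) := by
  rw [sum_relVec_smul, index_over, index_under, strand_ov, weight]
  rcases h : D.positive α
  · rw [D.index_un_of_neg h, r, l, o, outgoing, incoming, KnotCode.un]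
    simp only [h, Bool.false_eq_true, if_false, zpow_add, zpow_one]
    push_cast
    module
  · rw [D.index_ov_of_pos h, r, l, o, outgoing, incoming, KnotCode.un]
    simp only [h, if_true, zpow_add, zpow_one]
    push_cast
    module

/-- Every edge arrives at one passage and leaves one, so its two contributions cancel. -/
theorem sum_weight_smul {Z : Type*} [AddCommGroup Z] [Module S Z] (f : Fin n → Z) :
    ∑ α, (D.weight m α : S) • ∑ i, D.relVec m α i • f i = 0 := by
  simp only [weight_smul_relVec, Finset.sum_sub_distrib]
  rw [sub_eq_zero]
  have h := D.sum_next fun x => (((-m) ^ D.index x : Sˣ) : S) • f (D.strand x)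
  rwa [KnotCode.sum_passages, KnotCode.sum_passages] at h

theorem sum_weight_smul_relVec : ∑ α, (D.weight m α : S) • D.relVec m α = 0 := by
  have h := D.sum_weight_smul m fun i => (Pi.single i 1 : Fin n → S)
  simpa [← pi_eq_sum_univ'] using h

/-- A square presentation matrix of the Alexander module: the relation of crossing `0` is replaced
by the relation that makes the first meridian trivial. -/
def presMatrix : Matrix (Fin n) (Fin n) S :=
  (Matrix.of (D.relVec m)).updateRow 0 (Pi.single 0 1)

/-- The row space of the presentation matrix. -/
def relSpan : Submodule S (Fin n → S) := Submodule.span S (Set.range (D.presMatrix m).row)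

/-- The Alexander module over a ring `S`, with `-m` in the role of `t`. -/
abbrev AlexModule : Type _ := (Fin n → S) ⧸ D.relSpan m

theorem single_zero_mem_relSpan : (Pi.single 0 1 : Fin n → S) ∈ D.relSpan m :=
  Submodule.subset_span ⟨0, by simp [presMatrix, Matrix.row]⟩

/-- The relation omitted from the matrix follows from the others, because its coefficient in the
weighted dependency is a unit. -/
theorem relVec_mem_relSpan (α : Fin n) : D.relVec m α ∈ D.relSpan m := by
  have h : ∀ α, α ≠ 0 → D.relVec m α ∈ D.relSpan m := fun α hα =>
    Submodule.subset_span ⟨α, by ext; simp [presMatrix, Matrix.row, hα]⟩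
  by_cases hα : α = 0
  · have h0 := D.sum_weight_smul_relVec m
    rw [← Finset.add_sum_erase _ _ (Finset.mem_univ (0 : Fin n)), add_eq_zero_iff_eq_neg] at h0
    rw [hα, ← Submodule.smul_mem_iff_of_isUnit _ (D.weight m 0).isUnit, h0]
    exact Submodule.neg_mem _ (Submodule.sum_mem _ fun β hβ =>
      Submodule.smul_mem _ _ (h β (Finset.ne_of_mem_erase hβ)))
  · exact h α hα

theorem relSpan_le {P : Submodule S (Fin n → S)} (h0 : Pi.single 0 1 ∈ P)
    (h : ∀ α, D.relVec m α ∈ P) : D.relSpan m ≤ P := by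
  refine Submodule.span_le.2 ?_
  rintro _ ⟨α, rfl⟩
  by_cases hα : α = 0
  · subst hα
    simpa [presMatrix, Matrix.row] using h0
  · have : (D.presMatrix m).row α = D.relVec m α := by
      ext; simp [presMatrix, Matrix.row, hα]
    rw [this]
    exact h α

theorem relSpan_eq_range : D.relSpan m = (D.presMatrix m).vecMulLinear.range :=
  (range_vecMulLinear _).symm

theorem presMatrix_map {S' : Type*} [CommRing S'] (φ : S →+* S') :
    (D.presMatrix m).map φ = D.presMatrix (Units.map φ m) := by
  ext α i
  by_cases hα : α = 0
  · subst hα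
    simp [presMatrix, Pi.single_apply, apply_ite φ]
  · simp [presMatrix, relVec, hα, Pi.single_apply, apply_ite φ]

theorem map_det_presMatrix {S' : Type*} [CommRing S'] (φ : S →+* S') :
    φ (D.presMatrix m).det = (D.presMatrix (Units.map φ m)).det := by
  rw [RingHom.map_det, ← presMatrix_map]; rfl

variable {m}

/-- At `t = 1` a relation identifies the two understrands of its crossing. Along the knot all
generators become equal to the one of strand `0`, which is zero. -/
theorem relSpan_eq_top (hm : (m : S) = -1) : D.relSpan m = ⊤ := by
  have h : ∀ x, (Pi.single (D.strand x) 1 : Fin n → S) ∈ D.relSpan m := by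
    obtain ⟨α, hα⟩ := D.strand_under_bijective.2 0
    refine D.passage_induction (x₀ := (α, false)) ?_ fun x hx => ?_
    · change D.strand (α, false) = 0 at hα
      rw [hα]
      exact D.single_zero_mem_relSpan m
    · obtain ⟨y, rfl⟩ := D.next.symm.surjective x
      rw [Equiv.apply_symm_apply]
      revert y
      refine KnotCode.passage_cases (fun α h => ?_) fun α h => ?_
      · rwa [D.strand_over]
      · have := D.relVec_mem_relSpan m α
        rw [relVec, hm, add_neg_cancel, zero_smul, sub_zero, neg_one_smul, ← sub_eq_add_neg] at this
        rcases hp : D.positive α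
        · simp only [r, l, hp, outgoing, incoming] at this
          exact (Submodule.sub_mem_iff_left _ h).1 this
        · simp only [r, l, hp, outgoing, incoming] at this
          exact (Submodule.sub_mem_iff_right _ h).1 this
  rw [eq_top_iff, ← (Pi.basisFun S (Fin n)).span_eq, Submodule.span_le]
  rintro _ ⟨i, rfl⟩
  obtain ⟨α, rfl⟩ := D.strand_under_bijective.2 i
  simpa using h (α, false)

theorem isUnit_det_presMatrix (hm : (m : S) = -1) : IsUnit (D.presMatrix m).det := by
  rw [← Matrix.isUnit_iff_isUnit_det, ← Matrix.vecMul_surjective_iff_isUnit]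
  have := D.relSpan_eq_top hm
  rw [relSpan_eq_range] at this
  exact LinearMap.range_eq_top.1 this

/-- Modulo `1 + m`, that is at `t = 1`, the determinant becomes a unit of a nonzero ring. -/
theorem det_presMatrix_ne_zero (hm : ¬ IsUnit (1 + (m : S))) : (D.presMatrix m).det ≠ 0 := by
  intro h0
  have hI : Ideal.span {1 + (m : S)} ≠ ⊤ := by rwa [Ne, Ideal.span_singleton_eq_top]
  have := Ideal.Quotient.nontrivial_iff.2 hI
  have h := D.map_det_presMatrix m (Ideal.Quotient.mk (Ideal.span {1 + (m : S)}))
  rw [h0, map_zero] at h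
  refine not_isUnit_zero (h ▸ D.isUnit_det_presMatrix ?_)
  rw [eq_neg_iff_add_eq_zero, Units.coe_map, MonoidHom.coe_coe, ← map_one (Ideal.Quotient.mk _),
    ← map_add, Ideal.Quotient.eq_zero_iff_mem, add_comm]
  exact Ideal.mem_span_singleton_self _

theorem sum_coords_relVec (α : Fin n) : ∑ i, D.relVec m α i = 0 := by
  have := D.sum_relVec_smul m α (fun _ => (1 : S))
  simp only [smul_eq_mul, mul_one] at this
  rw [this]; ring

/-- A relation between the abelianized Wirtinger relations is a multiple of the standard one. -/
theorem eq_zero_of_relation [IsDomain S] (hm : ¬ IsUnit (1 + (m : S))) {x : Fin n → S}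
    (hx : ∑ α, x α • D.relVec m α = 0) (h0 : x 0 = 0) : x = 0 := by
  refine Matrix.eq_zero_of_vecMul_eq_zero (D.det_presMatrix_ne_zero hm) ?_
  rw [Matrix.vecMul_eq_sum, ← hx]
  refine Finset.sum_congr rfl fun α _ => ?_
  by_cases hα : α = 0
  · rw [hα, h0, zero_smul, zero_smul]
  · congr 1
    ext; simp [presMatrix, hα]

theorem relation_eq_smul_weight [IsDomain S] (hm : ¬ IsUnit (1 + (m : S))) {x : Fin n → S}
    (hx : ∑ α, x α • D.relVec m α = 0) (α : Fin n) :
    x α = x 0 * ((D.weight m 0)⁻¹ : Sˣ) * D.weight m α := by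
  have := D.eq_zero_of_relation hm
    (x := fun α => x α - x 0 * ((D.weight m 0)⁻¹ : Sˣ) * D.weight m α) ?_ (by simp [mul_assoc])
  · exact sub_eq_zero.1 (congrFun this α)
  · simp only [sub_smul, Finset.sum_sub_distrib, hx, mul_smul, ← Finset.smul_sum,
      sum_weight_smul_relVec, smul_zero, sub_zero]

variable (m)

/-- the generator of the Alexander module that corresponds to a strand -/
def gen (i : Fin n) : D.AlexModule m := (D.relSpan m).mkQ (Pi.single i 1)

theorem gen_zero : D.gen m 0 = 0 :=
  (Submodule.Quotient.mk_eq_zero _).2 (D.single_zero_mem_relSpan m)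

theorem mkQ_eq_sum (v : Fin n → S) : (D.relSpan m).mkQ v = ∑ i, v i • D.gen m i := by
  conv_lhs => rw [pi_eq_sum_univ' v, map_sum]
  refine Finset.sum_congr rfl fun i _ => ?_
  rw [gen, ← map_smul]

theorem sum_relVec_smul_gen (α : Fin n) : ∑ i, D.relVec m α i • D.gen m i = 0 := by
  rw [← mkQ_eq_sum, Submodule.mkQ_apply, Submodule.Quotient.mk_eq_zero]
  exact D.relVec_mem_relSpan m α

theorem gen_relation (α : Fin n) :
    D.gen m (D.r α) + (m : S) • D.gen m (D.l α) - (1 + (m : S)) • D.gen m (D.o α) = 0 := by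
  rw [← sum_relVec_smul, sum_relVec_smul_gen]

variable {m} in
/-- The Alexander module is generated by the meridians of the strands, subject to the abelianized
Wirtinger relations and the triviality of the first meridian. -/
noncomputable def liftAlex {Z : Type*} [AddCommGroup Z] [Module S Z] (f : Fin n → Z) (h0 : f 0 = 0)
    (h : ∀ α, f (D.r α) + (m : S) • f (D.l α) - (1 + (m : S)) • f (D.o α) = 0) :
    D.AlexModule m →ₗ[S] Z :=
  (D.relSpan m).liftQ (Fintype.linearCombination S f) <| D.relSpan_le m
    (by simp [h0]) fun α => by
      rw [LinearMap.mem_ker, Fintype.linearCombination_apply, sum_relVec_smul, h]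

theorem liftAlex_gen {Z : Type*} [AddCommGroup Z] [Module S Z] (f : Fin n → Z) (h0 : f 0 = 0)
    (h : ∀ α, f (D.r α) + (m : S) • f (D.l α) - (1 + (m : S)) • f (D.o α) = 0) (i : Fin n) :
    D.liftAlex f h0 h (D.gen m i) = f i := by
  simp [liftAlex, gen]

theorem alex_hom_ext {Z : Type*} [AddCommGroup Z] [Module S Z] {f g : D.AlexModule m →ₗ[S] Z}
    (h : ∀ i, f (D.gen m i) = g (D.gen m i)) : f = g := by
  ext i
  exact h i

theorem det_smul_alex (x : D.AlexModule m) : (D.presMatrix m).det • x = 0 := by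
  obtain ⟨v, rfl⟩ := Submodule.mkQ_surjective _ x
  rw [← map_smul, Submodule.mkQ_apply, Submodule.Quotient.mk_eq_zero, relSpan_eq_range]
  refine ⟨Matrix.vecMul v (D.presMatrix m).adjugate, ?_⟩
  rw [Matrix.vecMulLinear_apply, Matrix.vecMul_vecMul, Matrix.adjugate_mul, Matrix.vecMul_smul,
    Matrix.vecMul_one]

end KnotDiagram

/-! ### Fox calculus: from the knot group to the Alexander module. -/

namespace KnotDiagram

section fox

variable {n : ℕ} [NeZero n] (D : KnotDiagram n)

/-- the meridian of a strand -/
def mer (i : Fin n) : D.KnotGroup := PresentedGroup.of i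

theorem mer_relation (α : Fin n) :
    D.mer (D.r α) * D.mer (D.o α) = D.mer (D.o α) * D.mer (D.l α) := by
  have : (PresentedGroup.mk D.wirtingerRels) (FreeGroup.of (D.r α) * FreeGroup.of (D.o α) *
      (FreeGroup.of (D.o α) * FreeGroup.of (D.l α))⁻¹) = 1 :=
    PresentedGroup.one_of_mem ⟨α, rfl⟩
  rw [map_mul, map_inv, mul_inv_eq_one, map_mul, map_mul] at this
  exact this

/-- A family of group elements that satisfies the Wirtinger relations defines a homomorphism. -/
def liftKnotGroup {G : Type*} [Group G] (f : Fin n → G)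
    (h : ∀ α, f (D.r α) * f (D.o α) = f (D.o α) * f (D.l α)) : D.KnotGroup →* G :=
  PresentedGroup.toGroup (f := f) (by
    rintro _ ⟨α, rfl⟩
    simp [h])

@[simp] theorem liftKnotGroup_mer {G : Type*} [Group G] (f : Fin n → G)
    (h : ∀ α, f (D.r α) * f (D.o α) = f (D.o α) * f (D.l α)) (i : Fin n) :
    D.liftKnotGroup f h (D.mer i) = f i := by
  simp [liftKnotGroup, mer]

/-- The step is an equivalence, so it also covers inverses of generators. -/
theorem knotGroup_induction {p : D.KnotGroup → Prop} (h1 : p 1)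
    (hs : ∀ i g, p (D.mer i * g) ↔ p g) (g : D.KnotGroup) : p g := by
  have hg : g ∈ Subgroup.closure (Set.range D.mer) := by
    have := PresentedGroup.closure_range_of D.wirtingerRels
    exact this.symm ▸ Subgroup.mem_top g
  induction hg using Subgroup.closure_induction_left with
  | one => exact h1
  | mul_left x hx y _ ih => obtain ⟨i, rfl⟩ := hx; exact (hs i y).2 ih
  | inv_mul_cancel x hx y _ ih =>
    obtain ⟨i, rfl⟩ := hx
    rw [← hs i]
    simpa using ih

theorem mer_abelianization (i j : Fin n) :
    Abelianization.of (D.mer i) = Abelianization.of (D.mer j) := by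
  have h : ∀ x y, Abelianization.of (D.mer (D.strand x)) =
      Abelianization.of (D.mer (D.strand y)) := by
    refine D.eq_of_next_eq fun x => ?_
    obtain ⟨y, rfl⟩ := D.next.symm.surjective x
    rw [Equiv.apply_symm_apply]
    revert y
    refine KnotCode.passage_cases (fun α => by rw [D.strand_over]) fun α => ?_
    have h := congrArg Abelianization.of (D.mer_relation α)
    rw [map_mul, map_mul, mul_comm, mul_left_cancel_iff] at h
    rcases hp : D.positive α
    · simpa [r, l, hp, outgoing, incoming] using h
    · simpa [r, l, hp, outgoing, incoming] using h.symm
  obtain ⟨α, rfl⟩ := D.strand_under_bijective.2 i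
  obtain ⟨β, rfl⟩ := D.strand_under_bijective.2 j
  exact h _ _

/-- the abelianization of the knot group -/
def degree : D.KnotGroup →* Multiplicative ℤ :=
  D.liftKnotGroup (fun _ => Multiplicative.ofAdd 1) fun _ => rfl

theorem mul_zpow_neg_degree_mem (g : D.KnotGroup) :
    g * D.mer 0 ^ (-(D.degree g).toAdd) ∈ commutator D.KnotGroup := by
  rw [← Abelianization.ker_of, MonoidHom.mem_ker]
  refine D.knotGroup_induction (p := fun g =>
    Abelianization.of (g * D.mer 0 ^ (-(D.degree g).toAdd)) = 1) (by simp) (fun i g => ?_) g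
  simp only [map_mul, degree, liftKnotGroup_mer, D.mer_abelianization i 0, toAdd_mul,
    toAdd_ofAdd, neg_add, zpow_add, zpow_neg, zpow_one]
  rw [mul_mul_mul_comm, map_inv, mul_inv_cancel, one_mul]

/-- the class in the Alexander invariant of an element of the commutator subgroup -/
def alexClass (g : commutator D.KnotGroup) : D.AlexanderInvariant :=
  Additive.ofMul (Abelianization.of g)

theorem alexClass_mul (g h : commutator D.KnotGroup) :
    D.alexClass (g * h) = D.alexClass g + D.alexClass h := by
  rw [alexClass, map_mul]; rfl

theorem alexClass_surjective : Function.Surjective D.alexClass := fun x =>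
  QuotientGroup.mk_surjective x.toMul

theorem deck_alexClass (g : commutator D.KnotGroup) :
    D.deck (D.alexClass g) = D.alexClass (MulAut.conjNormal (D.mer 0) g) := rfl

/-- the class of `g x₀ ^ (-|g|)` -/
def normClass (g : D.KnotGroup) : D.AlexanderInvariant :=
  D.alexClass ⟨_, D.mul_zpow_neg_degree_mem g⟩

/-- the class of `xᵢ x₀⁻¹` -/
def merClass (i : Fin n) : D.AlexanderInvariant := D.normClass (D.mer i)

theorem degree_mer (i : Fin n) : D.degree (D.mer i) = Multiplicative.ofAdd 1 := by simp [degree]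

theorem degree_eq_one {g : D.KnotGroup} (hg : g ∈ commutator D.KnotGroup) : D.degree g = 1 :=
  Abelianization.commutator_subset_ker D.degree hg

theorem normClass_coe (g : commutator D.KnotGroup) : D.normClass g = D.alexClass g := by
  rw [normClass]
  congr 1
  ext
  simp [D.degree_eq_one g.2]

theorem normClass_mer_mul (i : Fin n) (g : D.KnotGroup) :
    D.normClass (D.mer i * g) = D.merClass i + D.deck (D.normClass g) := by
  rw [merClass, normClass, normClass, normClass, deck_alexClass, ← alexClass_mul]
  congr 1
  ext
  simp only [map_mul, degree_mer, toAdd_mul, toAdd_ofAdd, neg_add, zpow_add, Subgroup.coe_mul,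
    MulAut.conjNormal_apply]
  group

theorem merClass_zero : D.merClass 0 = 0 := by
  have : D.merClass 0 = D.alexClass 1 := by
    rw [merClass, normClass]
    congr 1
    ext
    simp [degree_mer]
  rw [this]; rfl

theorem merClass_relation (α : Fin n) :
    D.merClass (D.r α) + D.deck (D.merClass (D.o α)) =
      D.merClass (D.o α) + D.deck (D.merClass (D.l α)) := by
  have := congrArg D.normClass (D.mer_relation α)
  rwa [normClass_mer_mul, normClass_mer_mul] at this

variable {S : Type*} [CommRing S] (m : Sˣ)

/-- The action of the knot group on the Alexander module by affine maps. -/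
def affineRep : D.KnotGroup →* Equiv.Perm (D.AlexModule m) :=
  D.liftKnotGroup
    (fun i => (MulAction.toPerm (-m)).trans (Equiv.addRight (D.gen m i))) fun α => by
      ext v
      have := D.gen_relation m α
      simp only [Equiv.Perm.mul_apply, Equiv.trans_apply, MulAction.toPerm_apply,
        Equiv.coe_addRight, Units.smul_def, Units.val_neg]
      rw [← sub_eq_zero, ← this]
      module

theorem affineRep_mer (i : Fin n) (v : D.AlexModule m) :
    D.affineRep m (D.mer i) v = -(m : S) • v + D.gen m i := by
  simp [affineRep, Units.smul_def]

/-- An element of degree `d` acts by an affine map with linear part `(-m) ^ d`. Elements in the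
kernel of `degree` therefore act by translations. -/
theorem affineRep_degree_one (g h : D.KnotGroup) (hg : D.degree g = 1) :
    D.affineRep m (g * h) 0 = D.affineRep m g 0 + D.affineRep m h 0 := by
  have key : ∀ g v, D.affineRep m g v =
      ((-m) ^ (D.degree g).toAdd : Sˣ) • v + D.affineRep m g 0 := by
    intro g
    refine D.knotGroup_induction (p := fun g => ∀ v, D.affineRep m g v =
      ((-m) ^ (D.degree g).toAdd : Sˣ) • v + D.affineRep m g 0) (by simp) (fun i g => ?_) g
    refine forall_congr' fun v => ?_
    simp only [map_mul, Equiv.Perm.mul_apply, affineRep_mer, degree_mer, toAdd_mul, toAdd_ofAdd,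
      zpow_add, zpow_one, mul_smul]
    rw [← add_assoc, add_left_inj, ← Units.val_neg, ← Units.smul_def, ← Units.smul_def, ← smul_add,
      smul_left_cancel_iff]
  rw [map_mul, Equiv.Perm.mul_apply, key g, hg]
  simp [add_comm]

/-- The comparison map from the Alexander invariant to the Alexander module, by Fox calculus. -/
def alexHom : D.AlexanderInvariant →+ D.AlexModule m :=
  MonoidHom.toAdditiveLeft (Abelianization.lift
    { toFun := fun g => Multiplicative.ofAdd (D.affineRep m g 0)
      map_one' := by simp
      map_mul' := fun g h => by
        rw [← ofAdd_add, ← D.affineRep_degree_one m _ _ (D.degree_eq_one g.2)]; rfl } :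
    Abelianization (commutator D.KnotGroup) →* Multiplicative (D.AlexModule m))

theorem alexHom_alexClass (g : commutator D.KnotGroup) :
    D.alexHom m (D.alexClass g) = D.affineRep m g 0 := rfl

/-- Powers of the base meridian fix the origin, because `gen m 0 = 0`; normalizing the degree does
not change the image of the origin. -/
theorem alexHom_normClass (g : D.KnotGroup) :
    D.alexHom m (D.normClass g) = D.affineRep m g 0 := by
  have h0 : ∀ v, D.affineRep m (D.mer 0) v = -(m : S) • v := fun v => by
    rw [affineRep_mer, gen_zero, add_zero]
  have hz : ∀ k : ℤ, D.affineRep m (D.mer 0 ^ k) 0 = 0 := by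
    intro k
    rw [map_zpow]
    refine Function.IsFixedPt.perm_zpow ?_ k
    rw [Function.IsFixedPt, h0, smul_zero]
  rw [normClass, alexHom_alexClass, map_mul, Equiv.Perm.mul_apply, hz]

theorem alexHom_merClass (i : Fin n) : D.alexHom m (D.merClass i) = D.gen m i := by
  rw [merClass, alexHom_normClass, affineRep_mer, smul_zero, zero_add]

theorem alexHom_deck (x : D.AlexanderInvariant) :
    D.alexHom m (D.deck x) = -(m : S) • D.alexHom m x := by
  obtain ⟨g, rfl⟩ := D.alexClass_surjective x
  have h : D.deck (D.alexClass g) = D.normClass (D.mer 0 * g) := by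
    rw [normClass_mer_mul, merClass_zero, zero_add, normClass_coe]
  rw [h, alexHom_normClass, map_mul, Equiv.Perm.mul_apply, affineRep_mer, gen_zero, add_zero,
    alexHom_alexClass]

variable {H : Type*} [AddCommGroup H] [Module S H] (j : D.AlexanderInvariant →+ H)
  (hj : ∀ x, j (D.deck x) = -(m : S) • j x)

/-- The universal property of the comparison map. -/
noncomputable def alexLift : D.AlexModule m →ₗ[S] H :=
  D.liftAlex (fun i => j (D.merClass i)) (by rw [merClass_zero, map_zero]) fun α => by
    have := congrArg j (D.merClass_relation α)
    rw [map_add, map_add, hj, hj] at this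
    rw [← sub_eq_zero] at this
    rw [← this]
    module

/-- Both sides obey the same recursion when a meridian is put in front of a word, the product rule
of Fox calculus. -/
theorem alexLift_alexHom (x : D.AlexanderInvariant) :
    D.alexLift m j hj (D.alexHom m x) = j x := by
  obtain ⟨g, rfl⟩ := D.alexClass_surjective x
  rw [← normClass_coe, alexHom_normClass]
  refine D.knotGroup_induction (p := fun g =>
    D.alexLift m j hj (D.affineRep m g 0) = j (D.normClass g)) ?_ (fun i g => ?_) _
  · have := D.normClass_coe 1
    rw [Subgroup.coe_one] at this
    rw [this, show D.alexClass 1 = 0 from rfl]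
    simp
  · rw [map_mul, Equiv.Perm.mul_apply, affineRep_mer, normClass_mer_mul, map_add, map_add, map_smul,
      hj, alexLift, liftAlex_gen, add_comm, add_right_inj, ← Units.val_neg, ← Units.smul_def,
      ← Units.smul_def, smul_left_cancel_iff]

/-- An extension of the Alexander invariant to an `S`-module that has the universal property is the
Alexander module. -/
noncomputable def alexEquiv (hs : Submodule.span S (Set.range j) = ⊤)
    (δ : H →ₗ[S] D.AlexModule m) (hδ : ∀ x, δ (j x) = D.alexHom m x) : H ≃ₗ[S] D.AlexModule m :=
  LinearEquiv.ofLinearMap δ (D.alexLift m j hj)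
    (D.alex_hom_ext m fun i => by
      rw [LinearMap.comp_apply, LinearMap.id_apply, ← alexHom_merClass, alexLift_alexHom, hδ])
    (LinearMap.ext_on_range hs fun x => by
      rw [LinearMap.comp_apply, LinearMap.id_apply, hδ, alexLift_alexHom])

end fox

end KnotDiagram

/-! ### The linearized complex at the canonical augmentation. -/

namespace KnotDiagram

section complex

variable {n : ℕ} [NeZero n] (D : KnotDiagram n) {S : Type*} [CommRing S] (m : Sˣ)

/-- The relation of a crossing for `Ψᴿ`: a multiple of the relation for the inverse of `m`. -/
def coVec (α : Fin n) : Fin n → S := (m : S) • D.relVec m⁻¹ α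

theorem sum_coVec_smul {Z : Type*} [AddCommGroup Z] [Module S Z] (α : Fin n) (f : Fin n → Z) :
    ∑ i, D.coVec m α i • f i = (m : S) • f (D.r α) + f (D.l α) - (1 + (m : S)) • f (D.o α) := by
  simp only [coVec, Pi.smul_apply, smul_assoc, ← Finset.smul_sum]
  rw [sum_relVec_smul]
  simp only [smul_sub, smul_add, smul_smul, mul_add, mul_one, Units.mul_inv, one_smul]
  rw [add_comm (m : S) 1]

theorem sum_coords_coVec (α : Fin n) : ∑ i, D.coVec m α i = 0 := by
  have := D.sum_coVec_smul m α (fun _ => (1 : S))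
  simp only [smul_eq_mul, mul_one] at this
  rw [this]; ring

/-- the linear part of `A i j` -/
noncomputable def linA (i j : Fin n) : DGAGen n →₀ S :=
  if h : i = j then 0 else Finsupp.single (DGAGen.a i j h) 1

@[simp] theorem linA_self (i : Fin n) : (linA i i : DGAGen n →₀ S) = 0 := by simp [linA]

theorem canonicalAug_matA (i j : Fin n) : canonicalAug m (matA m i j) = 1 + (m : S) := by
  by_cases h : i = j <;> simp [matA, h, canonicalAug]

theorem linearPart_algebraMap (ε : DGAAlg n S →ₐ[S] S) (s : S) :
    linearPart ε (algebraMap S _ s) = 0 := by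
  simp [linearPart, TrivSqZeroExt.algebraMap_eq_inl]

theorem linearPart_one (ε : DGAAlg n S →ₐ[S] S) : linearPart ε 1 = 0 := by
  simpa using linearPart_algebraMap ε 1

theorem linearPart_matA (i j : Fin n) :
    linearPart (canonicalAug m) (matA m i j) = (linA i j : DGAGen n →₀ S) := by
  by_cases h : i = j <;> simp [matA, h, linA, linearPart_algebraMap, linearPart_ι, -map_add,
    -map_one]

theorem canonicalAug_psiL2 (α i : Fin n) : canonicalAug m (D.psiL2 m α i) =
    (Pi.single (D.l α) (m : S) - Pi.single (D.o α) (1 + (m : S)) : Fin n → S) i := by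
  simp [psiL2, Pi.single_apply, apply_ite (canonicalAug m), canonicalAug_matA]

theorem canonicalAug_psiL (α i : Fin n) :
    canonicalAug m (D.psiL 1 m α i) = D.relVec m α i := by
  rw [psiL, map_add, canonicalAug_psiL2]
  simp [relVec, Pi.single_apply, apply_ite (canonicalAug m)]
  ring

theorem canonicalAug_psiR1 (α i : Fin n) : canonicalAug m (D.psiR1 1 m i α) =
    (Pi.single (D.r α) (m : S) : Fin n → S) i := by
  simp [psiR1, Pi.single_apply, apply_ite (canonicalAug m)]

theorem canonicalAug_psiR (α i : Fin n) :
    canonicalAug m (D.psiR 1 m i α) = D.coVec m α i := by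
  rw [psiR, map_sub, map_add, canonicalAug_psiR1]
  simp [coVec, relVec, Pi.single_apply, apply_ite (canonicalAug m), canonicalAug_matA, mul_sub,
    mul_add]
  congr 1
  exact add_comm _ _

theorem linearPart_psiL2 (α i : Fin n) : linearPart (canonicalAug m) (D.psiL2 m α i) =
    -(if i = D.o α then linA (D.l α) (D.o α) else 0) := by
  simp [psiL2, apply_ite (linearPart (canonicalAug m)), linearPart_matA, linearPart_algebraMap]

theorem linearPart_psiL (α i : Fin n) : linearPart (canonicalAug m) (D.psiL 1 m α i) =
    -(if i = D.o α then linA (D.l α) (D.o α) else 0) := by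
  rw [psiL, map_add, linearPart_psiL2]
  simp [apply_ite (linearPart (canonicalAug m)), linearPart_one]

theorem linearPart_psiR1 (α i : Fin n) :
    linearPart (canonicalAug m) (D.psiR1 1 m i α) = 0 := by
  simp [psiR1, apply_ite (linearPart (canonicalAug m)), linearPart_algebraMap]

theorem linearPart_psiR (α i : Fin n) : linearPart (canonicalAug m) (D.psiR 1 m i α) =
    -(if i = D.o α then linA (D.o α) (D.l α) else 0) := by
  rw [psiR, map_sub, map_add, linearPart_psiR1]
  simp [apply_ite (linearPart (canonicalAug m)), linearPart_one, linearPart_matA]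

theorem canonicalAug_ι_b (α i : Fin n) :
    canonicalAug m (FreeAlgebra.ι S (DGAGen.b α i)) = 0 := by simp [canonicalAug]

theorem canonicalAug_ι_c (α i : Fin n) :
    canonicalAug m (FreeAlgebra.ι S (DGAGen.c i α)) = 0 := by simp [canonicalAug]

theorem linDiff_single (g : DGAGen n) : D.linDiff m (Finsupp.single g 1) =
    linearPart (canonicalAug m) (D.diffGen 1 m g) := by
  simp [linDiff, linearizedDiff, diff_ι]

theorem linDiff_a (i j : Fin n) (h : i ≠ j) :
    D.linDiff m (Finsupp.single (DGAGen.a i j h) 1) = 0 := by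
  rw [linDiff_single, diffGen, map_zero]

theorem linDiff_linA (i j : Fin n) : D.linDiff m (linA i j) = 0 := by
  rw [linA]
  split_ifs
  · exact map_zero _
  · exact D.linDiff_a m _ _ _

/-- The last term is the linear part of Ψᴸ times the augmented `A`, all of whose entries are `1 +
m`. It does not depend on `i`, so it cancels in differences of generators at one crossing; the same
holds for `linDiff_c`. -/
theorem linDiff_b (α i : Fin n) : D.linDiff m (Finsupp.single (DGAGen.b α i) 1) =
    ∑ j, D.relVec m α j • linA j i - (1 + (m : S)) • linA (D.l α) (D.o α) := by
  rw [linDiff_single, diffGen, Matrix.mul_apply, map_sum]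
  simp only [linearPart_mul, canonicalAug_psiL, linearPart_psiL, linearPart_matA,
    canonicalAug_matA, Finset.sum_add_distrib, smul_neg, smul_ite, smul_zero,
    Finset.sum_neg_distrib, Finset.sum_ite_eq', Finset.mem_univ, if_true, sub_eq_add_neg]

theorem linDiff_c (i α : Fin n) : D.linDiff m (Finsupp.single (DGAGen.c i α) 1) =
    ∑ j, D.coVec m α j • linA i j - (1 + (m : S)) • linA (D.o α) (D.l α) := by
  rw [linDiff_single, diffGen, Matrix.mul_apply, map_sum]
  simp only [linearPart_mul, canonicalAug_psiR, linearPart_psiR, linearPart_matA,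
    canonicalAug_matA, Finset.sum_add_distrib, smul_neg, smul_ite, smul_zero,
    Finset.sum_neg_distrib, Finset.sum_ite_eq', Finset.mem_univ, if_true, sub_eq_add_neg]
  rw [add_comm]

theorem linDiff_d (α β : Fin n) : D.linDiff m (Finsupp.single (DGAGen.d α β) 1) =
    ∑ i, D.coVec m β i • Finsupp.single (DGAGen.b α i) (1 : S) -
      ∑ i, D.relVec m α i • Finsupp.single (DGAGen.c i β) (1 : S) := by
  rw [linDiff_single, diffGen, Matrix.sub_apply, Matrix.mul_apply, Matrix.mul_apply, map_sub,
    map_sum, map_sum]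
  simp only [linearPart_mul, matB, matC, canonicalAug_ι_b, canonicalAug_ι_c, linearPart_ι,
    canonicalAug_psiR, canonicalAug_psiL, zero_smul, zero_add, add_zero]

theorem linDiff_e (α : Fin n) : D.linDiff m (Finsupp.single (DGAGen.e α) 1) =
    (m : S) • Finsupp.single (DGAGen.b α (D.r α)) (1 : S) -
      ((m : S) • Finsupp.single (DGAGen.c (D.l α) α) (1 : S) -
        (1 + (m : S)) • Finsupp.single (DGAGen.c (D.o α) α) (1 : S)) := by
  rw [linDiff_single, diffGen, Matrix.sub_apply, Matrix.mul_apply, Matrix.mul_apply, map_sub,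
    map_sum, map_sum]
  simp only [linearPart_mul, matB, matC, canonicalAug_ι_b, canonicalAug_ι_c, linearPart_ι,
    canonicalAug_psiR1, canonicalAug_psiL2, zero_smul, zero_add, add_zero]
  simp [Pi.single_apply, sub_smul, Finset.sum_sub_distrib]

/-- The canonical augmentation is an augmentation of the differential graded algebra. -/
theorem canonicalAug_diff (x : DGAAlg n S) : canonicalAug m (D.diff 1 m x) = 0 := by
  have hb : ∀ α, ∑ j, D.relVec m α j = 0 := fun α => D.sum_coords_relVec α
  induction x using FreeAlgebra.induction with
  | grade0 s => simp [diff, Matrix.algebraMap_matrix_apply]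
  | grade1 g =>
    rw [diff_ι]
    cases g with
    | a i j h => simp [diffGen]
    | b α i =>
      simp [diffGen, Matrix.mul_apply, canonicalAug_psiL, canonicalAug_matA, ← Finset.sum_mul, hb]
    | c i α =>
      simp [diffGen, Matrix.mul_apply, canonicalAug_psiR, canonicalAug_matA, ← Finset.mul_sum,
        sum_coords_coVec]
    | d α β => simp [diffGen, Matrix.mul_apply, matB, matC, canonicalAug_ι_b, canonicalAug_ι_c]
    | e α => simp [diffGen, Matrix.mul_apply, matB, matC, canonicalAug_ι_b, canonicalAug_ι_c]
  | mul x y hx hy => rw [diff_mul, map_add, map_mul, map_mul, hx, hy, zero_mul, mul_zero, add_zero]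
  | add x y hx hy => rw [map_add, map_add, hx, hy, add_zero]

theorem linDiff_comp_linDiff : D.linDiff m ∘ₗ D.linDiff m = 0 := by
  ext1 g
  ext1
  simp only [LinearMap.comp_apply, Finsupp.lsingle_apply, LinearMap.zero_apply]
  cases g with
  | a i j h => rw [linDiff_a, map_zero]
  | b α i => simp [linDiff_b, linDiff_linA]
  | c i α => simp [linDiff_c, linDiff_linA]
  | d α β =>
    simp only [linDiff_d, map_sub, map_sum, map_smul, linDiff_b, linDiff_c, smul_sub,
      Finset.sum_sub_distrib, ← Finset.sum_smul, sum_coords_coVec, sum_coords_relVec, zero_smul,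
      sub_zero, Finset.smul_sum]
    rw [Finset.sum_comm, sub_eq_zero]
    simp only [smul_comm (D.coVec m _ _) (D.relVec m _ _)]
  | e α =>
    simp only [linDiff_e, map_sub, map_smul, linDiff_b, linDiff_c, sum_relVec_smul, sum_coVec_smul,
      linA_self]
    module

end complex

end KnotDiagram

/-! ### Degree one homology by coefficient matrices. -/

namespace Subquotient

variable {R M : Type*} [CommRing R] [AddCommGroup M] [Module R M] (Z B : Submodule R M)

/-- the class of an element of `Z` -/
def proj : Z →ₗ[R] Subquotient Z B := (B.submoduleOf Z).mkQ

theorem proj_surjective : Function.Surjective (proj Z B) := Submodule.mkQ_surjective _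

theorem proj_eq_iff {x y : Z} : proj Z B x = proj Z B y ↔ (x : M) - y ∈ B :=
  Submodule.Quotient.eq _

theorem mem_classesOf {N : Submodule R M} {x : Subquotient Z B} :
    x ∈ classesOf Z B N ↔ ∃ z : Z, (z : M) ∈ N ∧ proj Z B z = x := Iff.rfl

/-- A linear map on `M` that vanishes on `B` induces a map on the subquotient. -/
def lift {N : Type*} [AddCommGroup N] [Module R N] (f : M →ₗ[R] N) (h : B ≤ f.ker) :
    Subquotient Z B →ₗ[R] N :=
  (B.submoduleOf Z).liftQ (f ∘ₗ Z.subtype) fun _ hx => h hx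

theorem lift_proj {N : Type*} [AddCommGroup N] [Module R N] (f : M →ₗ[R] N) (h : B ≤ f.ker)
    (x : Z) : lift Z B f h (proj Z B x) = f x := rfl

end Subquotient

namespace KnotDiagram

section homology

variable {n : ℕ} [NeZero n] (D : KnotDiagram n) {S : Type*} [CommRing S] (m : Sˣ)

/-- The chain with given coefficients at the generators `b`. -/
noncomputable def bChain (β : Fin n → Fin n → S) : DGAGen n →₀ S :=
  ∑ α, ∑ i, β α i • Finsupp.single (DGAGen.b α i) 1

/-- The chain with given coefficients at the generators `c`. -/
noncomputable def cChain (γ : Fin n → Fin n → S) : DGAGen n →₀ S :=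
  ∑ α, ∑ i, γ α i • Finsupp.single (DGAGen.c i α) 1

theorem bChain_apply_b (β : Fin n → Fin n → S) (α i : Fin n) :
    bChain β (DGAGen.b α i) = β α i := by
  classical
  simp [bChain, Finsupp.finsetSum_apply, Finsupp.single_apply, ite_and]

theorem bChain_apply_c (β : Fin n → Fin n → S) (α i : Fin n) :
    bChain β (DGAGen.c i α) = 0 := by
  simp [bChain, Finsupp.finsetSum_apply]

theorem cChain_apply_c (γ : Fin n → Fin n → S) (α i : Fin n) :
    cChain γ (DGAGen.c i α) = γ α i := by
  classical
  simp [cChain, Finsupp.finsetSum_apply, Finsupp.single_apply, and_comm, ite_and]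

theorem cChain_apply_b (γ : Fin n → Fin n → S) (α i : Fin n) :
    cChain γ (DGAGen.b α i) = 0 := by
  simp [cChain, Finsupp.finsetSum_apply]

theorem bChain_add (β β' : Fin n → Fin n → S) : bChain (β + β') = bChain β + bChain β' := by
  simp [bChain, add_smul, Finset.sum_add_distrib]

theorem cChain_add (γ γ' : Fin n → Fin n → S) : cChain (γ + γ') = cChain γ + cChain γ' := by
  simp [cChain, add_smul, Finset.sum_add_distrib]

theorem bChain_zero : bChain (0 : Fin n → Fin n → S) = 0 := by simp [bChain]

theorem cChain_zero : cChain (0 : Fin n → Fin n → S) = 0 := by simp [cChain]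

theorem bChain_mem (β : Fin n → Fin n → S) : bChain β ∈ chainsDeg n S 1 :=
  Submodule.sum_mem _ fun _ _ => Submodule.sum_mem _ fun _ _ => Submodule.smul_mem _ _ <|
    Finsupp.single_mem_supported _ _ rfl

theorem cChain_mem (γ : Fin n → Fin n → S) : cChain γ ∈ chainsDeg n S 1 :=
  Submodule.sum_mem _ fun _ _ => Submodule.sum_mem _ fun _ _ => Submodule.smul_mem _ _ <|
    Finsupp.single_mem_supported _ _ rfl

theorem eq_bChain_add_cChain {z : DGAGen n →₀ S} (hz : z ∈ chainsDeg n S 1) :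
    z = bChain (fun α i => z (DGAGen.b α i)) + cChain (fun α i => z (DGAGen.c i α)) := by
  have h0 : ∀ (z : DGAGen n →₀ S), z ∈ chainsDeg n S 1 → ∀ g : DGAGen n, g.deg ≠ 1 → z g = 0 :=
    fun z hz g hg => Finsupp.notMem_support_iff.1 fun h => hg (hz h)
  have h1 := Submodule.add_mem _ (bChain_mem fun α i => z (DGAGen.b α i))
    (cChain_mem fun α i => z (DGAGen.c i α))
  ext g
  cases g with
  | b α i => rw [Finsupp.add_apply, bChain_apply_b, cChain_apply_b, add_zero]
  | c i α => rw [Finsupp.add_apply, bChain_apply_c, cChain_apply_c, zero_add]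
  | a i j h => rw [h0 _ hz _ (by simp [DGAGen.deg]), h0 _ h1 _ (by simp [DGAGen.deg])]
  | d α β => rw [h0 _ hz _ (by simp [DGAGen.deg]), h0 _ h1 _ (by simp [DGAGen.deg])]
  | e α => rw [h0 _ hz _ (by simp [DGAGen.deg]), h0 _ h1 _ (by simp [DGAGen.deg])]

/-- The chain of degree `0` with given coefficients. -/
noncomputable def aChain (A : Fin n → Fin n → S) : DGAGen n →₀ S :=
  ∑ i, ∑ j, A i j • linA i j

theorem aChain_apply (A : Fin n → Fin n → S) {i j : Fin n} (h : i ≠ j) :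
    aChain A (DGAGen.a i j h) = A i j := by
  classical
  rw [aChain, Finsupp.finsetSum_apply, Finset.sum_eq_single i, Finsupp.finsetSum_apply,
    Finset.sum_eq_single j]
  · simp [linA, h]
  · intro j' _ hj'
    by_cases h' : i = j' <;> simp [linA, h', hj']
  · simp
  · intro i' _ hi'
    rw [Finsupp.finsetSum_apply]
    refine Finset.sum_eq_zero fun j' _ => ?_
    by_cases h' : i' = j' <;> simp [linA, h', hi']
  · simp

theorem aChain_add (A A' : Fin n → Fin n → S) : aChain (A + A') = aChain A + aChain A' := by
  simp [aChain, add_smul, Finset.sum_add_distrib]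

/-- As `linA i i = 0`, a chain does not see the diagonal coefficients; the row sums recover them. -/
theorem eq_zero_of_aChain_eq_zero {A : Fin n → Fin n → S} (hA : aChain A = 0)
    (h : ∀ i, ∑ j, A i j = 0) : A = 0 := by
  have h1 : ∀ i j, i ≠ j → A i j = 0 := fun i j hij => by rw [← aChain_apply A hij, hA]; rfl
  ext i j
  by_cases hij : i = j
  · rw [← hij, ← Finset.sum_eq_single (f := A i) i (fun j _ hj => h1 i j hj.symm)
      (fun h => absurd (Finset.mem_univ _) h), h]; rfl
  · exact h1 i j hij

theorem linDiff_bChain {β : Fin n → Fin n → S} (h : ∀ α, ∑ i, β α i = 0) :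
    D.linDiff m (bChain β) = aChain fun i j => ∑ α, β α j * D.relVec m α i := by
  simp only [bChain, map_sum, map_smul, linDiff_b, smul_sub, Finset.sum_sub_distrib,
    ← Finset.sum_smul, h, zero_smul, sub_zero]
  simp only [aChain, Finset.smul_sum, smul_smul, Finset.sum_smul]
  rw [Finset.sum_comm]
  conv_rhs => rw [Finset.sum_comm]
  refine Finset.sum_congr rfl fun i _ => ?_
  rw [Finset.sum_comm]

theorem linDiff_cChain {γ : Fin n → Fin n → S} (h : ∀ α, ∑ i, γ α i = 0) :
    D.linDiff m (cChain γ) = aChain fun i j => ∑ α, γ α i * D.coVec m α j := by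
  simp only [cChain, map_sum, map_smul, linDiff_c, smul_sub, Finset.sum_sub_distrib,
    ← Finset.sum_smul, h, zero_smul, sub_zero]
  simp only [aChain, Finset.smul_sum, smul_smul, Finset.sum_smul]
  rw [Finset.sum_comm]
  refine Finset.sum_congr rfl fun i _ => ?_
  rw [Finset.sum_comm]

/-- The cycle condition for chains in the span of the differences of generators. -/
theorem linDiff_eq_zero_iff {β γ : Fin n → Fin n → S} (hβ : ∀ α, ∑ i, β α i = 0)
    (hγ : ∀ α, ∑ i, γ α i = 0) : D.linDiff m (bChain β + cChain γ) = 0 ↔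
      ∀ i j, ∑ α, β α j * D.relVec m α i + ∑ α, γ α i * D.coVec m α j = 0 := by
  rw [map_add, linDiff_bChain D m hβ, linDiff_cChain D m hγ, ← aChain_add]
  constructor
  · intro h i j
    refine congrFun (congrFun (eq_zero_of_aChain_eq_zero h fun i => ?_) i) j
    simp only [Pi.add_apply, Finset.sum_add_distrib]
    rw [Finset.sum_comm, Finset.sum_comm (f := fun j α => γ α i * D.coVec m α j)]
    simp only [← Finset.sum_mul, ← Finset.mul_sum, hβ, sum_coords_coVec, zero_mul, mul_zero,
      Finset.sum_const_zero, add_zero]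
  · intro h
    simp [aChain, h]

theorem mem_cycles {β γ : Fin n → Fin n → S} :
    bChain β + cChain γ ∈ D.cycles m 1 ↔ D.linDiff m (bChain β + cChain γ) = 0 :=
  ⟨fun h => h.2, fun h => ⟨Submodule.add_mem _ (bChain_mem β) (cChain_mem γ), h⟩⟩

theorem linDiff_d_mem (δ : Fin n → Fin n → S) :
    bChain (fun α i => ∑ β, δ α β * D.coVec m β i) -
      cChain (fun β i => ∑ α, δ α β * D.relVec m α i) ∈ D.boundaries m 1 := by
  refine ⟨∑ α, ∑ β, δ α β • Finsupp.single (DGAGen.d α β) 1, Submodule.sum_mem _ fun _ _ =>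
    Submodule.sum_mem _ fun _ _ => Submodule.smul_mem _ _ <|
      Finsupp.single_mem_supported _ _ rfl, ?_⟩
  simp only [map_sum, map_smul, linDiff_d, smul_sub, Finset.sum_sub_distrib, bChain, cChain,
    Finset.smul_sum, smul_smul, Finset.sum_smul]
  congr 1
  · exact Finset.sum_congr rfl fun α _ => Finset.sum_comm
  · rw [Finset.sum_comm]
    exact Finset.sum_congr rfl fun α _ => Finset.sum_comm

theorem linDiff_e_mem (s : Fin n → S) :
    bChain (fun α i => s α * (Pi.single (D.r α) (m : S) : Fin n → S) i) -
      cChain (fun α i => s α *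
        (Pi.single (D.l α) (m : S) - Pi.single (D.o α) (1 + (m : S)) : Fin n → S) i) ∈
      D.boundaries m 1 := by
  refine ⟨∑ α, s α • Finsupp.single (DGAGen.e α) 1, Submodule.sum_mem _ fun _ _ =>
    Submodule.smul_mem _ _ <| Finsupp.single_mem_supported _ _ rfl, ?_⟩
  simp only [map_sum, map_smul, linDiff_e, bChain, cChain, ← Finset.sum_sub_distrib]
  refine Finset.sum_congr rfl fun α _ => ?_
  simp only [mul_smul, ← Finset.smul_sum, ← smul_sub]
  congr 1
  simp [Pi.single_apply, sub_smul, Finset.sum_sub_distrib, ite_smul]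

theorem sub_mem_cycles {β γ : Fin n → Fin n → S}
    (h : bChain β - cChain γ ∈ D.boundaries m 1) : bChain β - cChain γ ∈ D.cycles m 1 := by
  refine ⟨Submodule.sub_mem _ (bChain_mem β) (cChain_mem γ), ?_⟩
  obtain ⟨y, _, hy⟩ := h
  rw [← hy]
  exact LinearMap.congr_fun (D.linDiff_comp_linDiff m) y

/-- the homology class of a cycle -/
noncomputable def hClass (z : DGAGen n →₀ S) (hz : z ∈ D.cycles m 1) : D.LinHomology m 1 :=
  Subquotient.proj (D.cycles m 1) (D.boundaries m 1) ⟨z, hz⟩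

theorem hClass_eq_iff {z z' : DGAGen n →₀ S} {hz : z ∈ D.cycles m 1} {hz' : z' ∈ D.cycles m 1} :
    D.hClass m z hz = D.hClass m z' hz' ↔ z - z' ∈ D.boundaries m 1 :=
  Subquotient.proj_eq_iff _ _

theorem hClass_surjective (x : D.LinHomology m 1) : ∃ z hz, D.hClass m z hz = x := by
  obtain ⟨⟨z, hz⟩, rfl⟩ := Subquotient.proj_surjective _ _ x
  exact ⟨z, hz, rfl⟩

theorem exists_hClass_bc (x : D.LinHomology m 1) :
    ∃ β γ, ∃ h : bChain β + cChain γ ∈ D.cycles m 1, D.hClass m (bChain β + cChain γ) h = x := by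
  obtain ⟨z, hz, rfl⟩ := D.hClass_surjective m x
  have h := eq_bChain_add_cChain hz.1
  refine ⟨_, _, h ▸ hz, ?_⟩
  rw [hClass_eq_iff, ← h, sub_self]
  exact zero_mem _

section lift

variable {Z : Type*} [AddCommGroup Z] [Module S Z]

/-- The map on homology induced by values at the generators `b` and `c`. -/
noncomputable def chainLift (fb fc : Fin n → Fin n → Z) : (DGAGen n →₀ S) →ₗ[S] Z :=
  Finsupp.linearCombination S fun g => match g with
    | .b α i => fb α i
    | .c i α => fc α i
    | _ => 0

theorem chainLift_add (fb fc : Fin n → Fin n → Z) (β γ : Fin n → Fin n → S) :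
    chainLift fb fc (bChain β + cChain γ) =
      ∑ α, ∑ i, β α i • fb α i + ∑ α, ∑ i, γ α i • fc α i := by
  simp [chainLift, bChain, cChain]

variable (fb fc : Fin n → Fin n → Z)
  (hd : ∀ α β, ∑ i, D.coVec m β i • fb α i = ∑ i, D.relVec m α i • fc β i)
  (he : ∀ α, (m : S) • fb α (D.r α) = (m : S) • fc α (D.l α) - (1 + (m : S)) • fc α (D.o α))

/-- A map on chains that vanishes on boundaries induces a map on homology. -/
noncomputable def homologyLift : D.LinHomology m 1 →ₗ[S] Z :=
  Subquotient.lift _ _ (chainLift fb fc) (by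
      rw [boundaries, chainsDeg, Finsupp.supported_eq_span_single, Submodule.map_span,
        Submodule.span_le]
      rintro _ ⟨_, ⟨g, hg, rfl⟩, rfl⟩
      cases g with
      | d α β =>
        rw [SetLike.mem_coe, LinearMap.mem_ker, linDiff_d]
        simp [chainLift, hd]
      | e α =>
        rw [SetLike.mem_coe, LinearMap.mem_ker, linDiff_e]
        simp only [map_sub, map_smul, chainLift, Finsupp.linearCombination_single, one_smul, he,
          sub_self]
      | a i j h => simp [DGAGen.deg] at hg
      | b α i => simp [DGAGen.deg] at hg
      | c i α => simp [DGAGen.deg] at hg)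

theorem homologyLift_hClass (z : DGAGen n →₀ S) (hz : z ∈ D.cycles m 1) :
    D.homologyLift m fb fc hd he (D.hClass m z hz) = chainLift fb fc z :=
  Subquotient.lift_proj _ _ _ _ _

end lift

end homology

end KnotDiagram

/-! ### Sections and retractions between the homology and the Alexander modules. -/

theorem isCompl_range_ker_of_comp_eq_id {R M N : Type*} [CommRing R] [AddCommGroup M] [AddCommGroup N]
    [Module R M] [Module R N] {s : N →ₗ[R] M} {r : M →ₗ[R] N} (h : r ∘ₗ s = LinearMap.id) :
    IsCompl s.range r.ker := by
  have h' : ∀ x, r (s x) = x := LinearMap.congr_fun h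
  refine ⟨?_, codisjoint_iff.2 (eq_top_iff.2 fun x _ => ?_)⟩
  · rw [Submodule.disjoint_def]
    rintro _ ⟨y, rfl⟩ hy
    rw [LinearMap.mem_ker, h'] at hy
    rw [hy, map_zero]
  · exact Submodule.mem_sup.2 ⟨s (r x), ⟨_, rfl⟩, x - s (r x),
      by rw [LinearMap.mem_ker, map_sub, h', sub_self], add_sub_cancel _ _⟩

namespace KnotDiagram

section splitting

variable {n : ℕ} [NeZero n] (D : KnotDiagram n) {S : Type*} [CommRing S] (m : Sˣ)

theorem bChain_smul (s : S) (β : Fin n → Fin n → S) : bChain (s • β) = s • bChain β := by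
  simp [bChain, Finset.smul_sum]

theorem cChain_smul (s : S) (γ : Fin n → Fin n → S) : cChain (s • γ) = s • cChain γ := by
  simp [cChain, Finset.smul_sum]

theorem sum_weight_mul_relVec (j : Fin n) :
    ∑ α, (D.weight m α : S) * D.relVec m α j = 0 := by
  simpa using congrFun (D.sum_weight_smul_relVec m) j

theorem sum_weight_mul_coVec (j : Fin n) :
    ∑ α, (D.weight m⁻¹ α : S) * D.coVec m α j = 0 := by
  have := D.sum_weight_mul_relVec m⁻¹ j
  simp only [coVec, Pi.smul_apply, smul_eq_mul, mul_left_comm, ← Finset.mul_sum, this, mul_zero]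

/-- The projection to the vectors with vanishing coordinate sum along the first basis vector. -/
def sumZero : (Fin n → S) →ₗ[S] (Fin n → S) where
  toFun v := v - (∑ i, v i) • Pi.single 0 1
  map_add' v w := by simp [Finset.sum_add_distrib, add_smul]; abel
  map_smul' s v := by simp [← Finset.mul_sum, smul_sub, mul_smul]

theorem sumZero_apply (v : Fin n → S) : sumZero v = v - (∑ i, v i) • Pi.single 0 1 := rfl

theorem sum_sumZero (v : Fin n → S) : ∑ i, sumZero v i = 0 := by
  simp [sumZero_apply, Finset.sum_sub_distrib, ← Finset.mul_sum]

theorem sumZero_of_sum_eq_zero {v : Fin n → S} (h : ∑ i, v i = 0) : sumZero v = v := by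
  simp [sumZero_apply, h]

theorem sumZero_single_zero : sumZero (Pi.single 0 1 : Fin n → S) = 0 := by
  simp [sumZero_apply]

theorem mkQ_sumZero (v : Fin n → S) : (D.relSpan m).mkQ (sumZero v) = (D.relSpan m).mkQ v := by
  have := D.gen_zero m
  rw [gen] at this
  rw [sumZero_apply, map_sub, map_smul, this, smul_zero, sub_zero]

/-- `sumZero` kills the extra relation `Pi.single 0 1` and fixes the Wirtinger relations, so on
vectors of coordinate sum zero the extra relation can be dispensed with. -/
theorem exists_eq_sum_relVec {v : Fin n → S} (hv : v ∈ D.relSpan m) (h : ∑ i, v i = 0) :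
    ∃ δ : Fin n → S, v = ∑ β, δ β • D.relVec m β := by
  rw [← sumZero_of_sum_eq_zero h]
  have : D.relSpan m ≤ (Submodule.span S (Set.range (D.relVec m))).comap sumZero :=
    D.relSpan_le m (by simp [sumZero_single_zero]) fun α => by
      rw [Submodule.mem_comap, sumZero_of_sum_eq_zero (D.sum_coords_relVec α)]
      exact Submodule.subset_span ⟨α, rfl⟩
  obtain ⟨δ, hδ⟩ := (Submodule.mem_span_range_iff_exists_fun S).1 (this hv)
  exact ⟨δ, hδ.symm⟩

/-- The cycle `∑ v_i κ_α c_{iα}`, with `κ` the relation between the columns of `Ψᴿ`. -/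
noncomputable def cCycle : (Fin n → S) →ₗ[S] D.cycles m 1 :=
  LinearMap.codRestrict _
    { toFun := fun v => bChain 0 + cChain fun α i => (D.weight m⁻¹ α : S) * sumZero v i
      map_add' := fun v w => by
        simp only [bChain_zero, zero_add, ← cChain_add, map_add, Pi.add_apply, mul_add]
        rfl
      map_smul' := fun s v => by
        simp only [bChain_zero, zero_add, ← cChain_smul, map_smul, Pi.smul_apply, smul_eq_mul,
          RingHom.id_apply, mul_left_comm _ s]
        rfl }
    fun v => by
      rw [LinearMap.coe_mk, AddHom.coe_mk, mem_cycles, linDiff_eq_zero_iff]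
      · intro i j
        simp only [Pi.zero_apply, zero_mul, Finset.sum_const_zero, zero_add]
        have := D.sum_weight_mul_coVec m j
        simp only [mul_right_comm _ (sumZero v i), ← Finset.sum_mul, this, zero_mul]
      · simp
      · simp [← Finset.mul_sum, sum_sumZero]

/-- The cycle `∑ κ_α v_i b_{αi}`, with `κ` the relation between the rows of `Ψᴸ`. -/
noncomputable def bCycle : (Fin n → S) →ₗ[S] D.cycles m 1 :=
  LinearMap.codRestrict _
    { toFun := fun v => (bChain fun α i => (D.weight m α : S) * sumZero v i) + cChain 0
      map_add' := fun v w => by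
        simp only [cChain_zero, add_zero, ← bChain_add, map_add, Pi.add_apply, mul_add]
        rfl
      map_smul' := fun s v => by
        simp only [cChain_zero, add_zero, ← bChain_smul, map_smul, Pi.smul_apply, smul_eq_mul,
          RingHom.id_apply, mul_left_comm _ s]
        rfl }
    fun v => by
      rw [LinearMap.coe_mk, AddHom.coe_mk, mem_cycles, linDiff_eq_zero_iff]
      · intro i j
        simp only [Pi.zero_apply, zero_mul, Finset.sum_const_zero, add_zero]
        have := D.sum_weight_mul_relVec m i
        simp only [mul_right_comm _ (sumZero v j), ← Finset.sum_mul, this, zero_mul]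
      · simp [← Finset.mul_sum, sum_sumZero]
      · simp

theorem coe_cCycle (v : Fin n → S) : (D.cCycle m v : DGAGen n →₀ S) =
    bChain 0 + cChain fun α i => (D.weight m⁻¹ α : S) * sumZero v i := rfl

theorem coe_bCycle (v : Fin n → S) : (D.bCycle m v : DGAGen n →₀ S) =
    (bChain fun α i => (D.weight m α : S) * sumZero v i) + cChain 0 := rfl

/-- Up to sign this is the boundary of `∑ κ_β d_{αβ}`, with `κ` the weights for `m⁻¹`: the `b` part
vanishes, as `κ` is a dependency between the vectors `coVec m β`. -/
theorem cCycle_relVec (α : Fin n) :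
    (D.cCycle m (D.relVec m α) : DGAGen n →₀ S) ∈ D.boundaries m 1 := by
  rw [coe_cCycle, sumZero_of_sum_eq_zero (D.sum_coords_relVec α), bChain_zero, zero_add]
  have := D.linDiff_d_mem m (fun α' β => if α' = α then (D.weight m⁻¹ β : S) else 0)
  convert Submodule.neg_mem _ this using 1
  have h : (fun α' i => ∑ β, (if α' = α then (D.weight m⁻¹ β : S) else 0) * D.coVec m β i) = 0 := by
    ext α' i
    split_ifs
    · exact D.sum_weight_mul_coVec m i
    · simp
  rw [h, bChain_zero, zero_sub, neg_neg]
  simp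

theorem bCycle_relVec (β : Fin n) :
    (D.bCycle m (D.relVec m⁻¹ β) : DGAGen n →₀ S) ∈ D.boundaries m 1 := by
  rw [coe_bCycle, sumZero_of_sum_eq_zero (D.sum_coords_relVec β), cChain_zero, add_zero,
    ← Submodule.smul_mem_iff_of_isUnit _ m.isUnit, ← bChain_smul]
  have := D.linDiff_d_mem m (fun α β' => if β' = β then (D.weight m α : S) else 0)
  convert this using 1
  have h : (fun β' i => ∑ α, (if β' = β then (D.weight m α : S) else 0) * D.relVec m α i) = 0 := by
    ext β' i
    split_ifs
    · exact D.sum_weight_mul_relVec m i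
    · simp
  rw [h, cChain_zero, sub_zero]
  congr 1
  ext α i
  simp [coVec, mul_left_comm]

/-- The inclusion of the Alexander module by the cycles in the span of the `c_{iα} - c_{jα}`. -/
noncomputable def cSection : D.AlexModule m →ₗ[S] D.LinHomology m 1 :=
  (D.relSpan m).liftQ (Subquotient.proj _ _ ∘ₗ D.cCycle m) <| D.relSpan_le m
    (by
      have : D.cCycle m (Pi.single 0 1) = 0 := by
        ext1
        simp only [coe_cCycle, sumZero_single_zero, Pi.zero_apply, mul_zero]
        exact (congrArg₂ (· + ·) bChain_zero cChain_zero).trans (add_zero _)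
      rw [LinearMap.mem_ker, LinearMap.comp_apply, this, map_zero])
    fun α => by
      rw [LinearMap.mem_ker, LinearMap.comp_apply, ← map_zero (Subquotient.proj _ _),
        Subquotient.proj_eq_iff, Submodule.coe_zero, sub_zero]
      exact D.cCycle_relVec m α

/-- The inclusion of the conjugate Alexander module by the cycles in the span of the
`b_{αi} - b_{αj}`. -/
noncomputable def bSection : D.AlexModule m⁻¹ →ₗ[S] D.LinHomology m 1 :=
  (D.relSpan m⁻¹).liftQ (Subquotient.proj _ _ ∘ₗ D.bCycle m) <| D.relSpan_le m⁻¹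
    (by
      have : D.bCycle m (Pi.single 0 1) = 0 := by
        ext1
        simp only [coe_bCycle, sumZero_single_zero, Pi.zero_apply, mul_zero]
        exact (congrArg₂ (· + ·) bChain_zero cChain_zero).trans (add_zero _)
      rw [LinearMap.mem_ker, LinearMap.comp_apply, this, map_zero])
    fun α => by
      rw [LinearMap.mem_ker, LinearMap.comp_apply, ← map_zero (Subquotient.proj _ _),
        Subquotient.proj_eq_iff, Submodule.coe_zero, sub_zero]
      exact D.bCycle_relVec m α

theorem cSection_mkQ (v : Fin n → S) : D.cSection m ((D.relSpan m).mkQ v) =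
    D.hClass m _ (D.cCycle m v).2 := rfl

theorem bSection_mkQ (v : Fin n → S) : D.bSection m ((D.relSpan m⁻¹).mkQ v) =
    D.hClass m _ (D.bCycle m v).2 := rfl

theorem sum_piSingle {Z : Type*} [AddCommGroup Z] (α : Fin n) (f : Fin n → Z) :
    ∑ i, (Pi.single α (f i) : Fin n → Z) = Pi.single α (∑ i, f i) :=
  (map_sum (AddMonoidHom.single (fun _ : Fin n => Z) α) f Finset.univ).symm

theorem sum_sum_piSingle_apply {Z : Type*} [AddCommGroup Z] (f : Fin n → Fin n → Z) (α : Fin n) :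
    (∑ α', ∑ i, (Pi.single α' (f α' i) : Fin n → Z)) α = ∑ i, f α i := by
  simp only [sum_piSingle]
  exact congrFun (Finset.univ_sum_single fun α' => ∑ i, f α' i) α

/-- The retraction of the linearized homology to copies of the Alexander module. -/
noncomputable def cRetract : D.LinHomology m 1 →ₗ[S] (Fin n → D.AlexModule m) :=
  -- The term added to `gen m i` does not depend on `i`, so values on differences are unaffected. It
  -- is chosen so that the boundary of `e α` goes to zero.
  D.homologyLift m (fun _ _ => 0) (fun α i => Pi.single α
      (D.gen m i + ((m : S) • D.gen m (D.l α) - (1 + (m : S)) • D.gen m (D.o α))))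
    (fun α β => by
      simp only [smul_zero, Finset.sum_const_zero, ← Pi.single_smul, smul_add]
      rw [sum_piSingle, Finset.sum_add_distrib, sum_relVec_smul_gen, ← Finset.sum_smul,
        sum_coords_relVec, zero_smul, add_zero, Pi.single_zero])
    (fun α => by
      simp only [smul_zero, ← Pi.single_smul, ← Pi.single_sub]
      rw [eq_comm, ← Pi.single_zero α]
      congr 1
      module)

/-- The retraction of the linearized homology to copies of the conjugate Alexander module. -/
noncomputable def bRetract : D.LinHomology m 1 →ₗ[S] (Fin n → D.AlexModule m⁻¹) :=
  -- Subtracting the generator of `r α` kills the only `b` in the boundary of `e α`.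
  D.homologyLift m (fun α i => Pi.single α (D.gen m⁻¹ i - D.gen m⁻¹ (D.r α))) (fun _ _ => 0)
    (fun α β => by
      simp only [smul_zero, Finset.sum_const_zero, ← Pi.single_smul, smul_sub]
      rw [sum_piSingle, Finset.sum_sub_distrib, ← Finset.sum_smul, sum_coords_coVec, zero_smul,
        sub_zero]
      simp only [coVec, Pi.smul_apply, smul_assoc, ← Finset.smul_sum]
      rw [sum_relVec_smul_gen, smul_zero, Pi.single_zero])
    (fun α => by simp)

/-- The sums of the coefficients, corrected so as to vanish on boundaries. -/
noncomputable def coeffSums : D.LinHomology m 1 →ₗ[S] (Fin n → S) :=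
  -- The ratio of the two values is forced by the boundary of `e α`: its coefficient sums are `m` on
  -- the `b` and `1` on the `c`.
  D.homologyLift m (fun α _ => Pi.single α 1) (fun α _ => Pi.single α (-(m : S)))
    (fun α β => by
      rw [← Finset.sum_smul, ← Finset.sum_smul, sum_coords_coVec, sum_coords_relVec, zero_smul,
        zero_smul])
    (fun α => by
      simp only [← Pi.single_smul, ← Pi.single_sub]
      congr 1
      simp only [smul_eq_mul]
      ring)

variable {β γ : Fin n → Fin n → S} (h : bChain β + cChain γ ∈ D.cycles m 1) (α : Fin n)

theorem cRetract_hClass : D.cRetract m (D.hClass m _ h) α = (D.relSpan m).mkQ (γ α) +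
    (∑ i, γ α i) • ((m : S) • D.gen m (D.l α) - (1 + (m : S)) • D.gen m (D.o α)) := by
  rw [cRetract, homologyLift_hClass, chainLift_add, mkQ_eq_sum, Finset.sum_smul]
  simp only [smul_zero, Finset.sum_const_zero, zero_add, ← Pi.single_smul, sum_sum_piSingle_apply,
    smul_add, Finset.sum_add_distrib]

theorem bRetract_hClass : D.bRetract m (D.hClass m _ h) α = (D.relSpan m⁻¹).mkQ (β α) -
    (∑ i, β α i) • D.gen m⁻¹ (D.r α) := by
  rw [bRetract, homologyLift_hClass, chainLift_add, mkQ_eq_sum, Finset.sum_smul,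
    ← Finset.sum_sub_distrib]
  simp only [smul_zero, Finset.sum_const_zero, add_zero, ← Pi.single_smul, sum_sum_piSingle_apply,
    smul_sub]

theorem coeffSums_hClass :
    D.coeffSums m (D.hClass m _ h) α = ∑ i, β α i - (m : S) * ∑ i, γ α i := by
  rw [coeffSums, homologyLift_hClass, chainLift_add]
  simp only [← Pi.single_smul, Pi.add_apply, sum_sum_piSingle_apply]
  simp [Finset.mul_sum, mul_comm, sub_eq_add_neg]

variable (x : D.AlexModule m) (y : D.AlexModule m⁻¹)

theorem cRetract_cSection : D.cRetract m (D.cSection m x) α = (D.weight m⁻¹ α : S) • x := by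
  obtain ⟨v, rfl⟩ := Submodule.mkQ_surjective _ x
  refine (D.cRetract_hClass m (D.cCycle m v).2 α).trans ?_
  simp only [← Finset.mul_sum, sum_sumZero, mul_zero, zero_smul, add_zero]
  change (D.relSpan m).mkQ ((D.weight m⁻¹ α : S) • sumZero v) = _
  rw [map_smul, mkQ_sumZero]

theorem bRetract_bSection : D.bRetract m (D.bSection m y) α = (D.weight m α : S) • y := by
  obtain ⟨v, rfl⟩ := Submodule.mkQ_surjective _ y
  refine (D.bRetract_hClass m (D.bCycle m v).2 α).trans ?_
  simp only [← Finset.mul_sum, sum_sumZero, mul_zero, zero_smul, sub_zero]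
  change (D.relSpan m⁻¹).mkQ ((D.weight m α : S) • sumZero v) = _
  rw [map_smul, mkQ_sumZero]

theorem cRetract_bSection : D.cRetract m (D.bSection m y) = 0 := by
  obtain ⟨v, rfl⟩ := Submodule.mkQ_surjective _ y
  ext1 α
  refine (D.cRetract_hClass m (D.bCycle m v).2 α).trans ?_
  simp [-Submodule.mkQ_apply]

theorem bRetract_cSection : D.bRetract m (D.cSection m x) = 0 := by
  obtain ⟨v, rfl⟩ := Submodule.mkQ_surjective _ x
  ext1 α
  refine (D.bRetract_hClass m (D.cCycle m v).2 α).trans ?_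
  simp [-Submodule.mkQ_apply]

theorem coeffSums_bSection : D.coeffSums m (D.bSection m y) = 0 := by
  obtain ⟨v, rfl⟩ := Submodule.mkQ_surjective _ y
  ext1 α
  refine (D.coeffSums_hClass m (D.bCycle m v).2 α).trans ?_
  simp [← Finset.mul_sum, sum_sumZero]

theorem cSection_injective : Function.Injective (D.cSection m) := fun x x' hx => by
  have := congrFun (congrArg (D.cRetract m) hx) 0
  rwa [cRetract_cSection, cRetract_cSection, ← Units.smul_def, ← Units.smul_def,
    smul_left_cancel_iff] at this

theorem bSection_injective : Function.Injective (D.bSection m) := fun x x' hx => by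
  have := congrFun (congrArg (D.bRetract m) hx) 0
  rwa [bRetract_bSection, bRetract_bSection, ← Units.smul_def, ← Units.smul_def,
    smul_left_cancel_iff] at this

theorem disjoint_range_section : Disjoint (D.cSection m).range (D.bSection m).range := by
  rw [Submodule.disjoint_def]
  rintro _ ⟨x, rfl⟩ ⟨y, hy⟩
  have := congrFun (congrArg (D.cRetract m) hy) 0
  rw [cRetract_bSection, cRetract_cSection, eq_comm, Pi.zero_apply, ← Units.smul_def,
    smul_eq_zero_iff_eq] at this
  rw [this, map_zero]

/-- Component `0` of each retraction, divided by its unit weight, gives a left inverse of the two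
sections taken together; its kernel is the complement. -/
theorem exists_isCompl_range_section :
    ∃ E, IsCompl ((D.cSection m).range ⊔ (D.bSection m).range) E := by
  have hs : LinearMap.range ((D.cSection m).coprod (D.bSection m)) =
    (D.cSection m).range ⊔ (D.bSection m).range := LinearMap.range_coprod _ _
  refine ⟨LinearMap.ker (((((D.weight m⁻¹ 0)⁻¹ : Sˣ) : S) •
    (LinearMap.proj 0 ∘ₗ D.cRetract m)).prod ((((D.weight m 0)⁻¹ : Sˣ) : S) •
      (LinearMap.proj 0 ∘ₗ D.bRetract m))), ?_⟩
  rw [← hs]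
  refine isCompl_range_ker_of_comp_eq_id ?_
  refine LinearMap.prod_ext (LinearMap.ext fun x => ?_) (LinearMap.ext fun y => ?_)
  · simp [cRetract_cSection, bRetract_cSection, smul_smul]
  · simp [cRetract_bSection, bRetract_bSection, smul_smul]

end splitting

end KnotDiagram

/-! ### Cycles in the span of the differences of generators. -/

namespace KnotDiagram

section classes

variable {n : ℕ} [NeZero n] (D : KnotDiagram n) {S : Type*} [CommRing S] {m : Sˣ}

theorem not_isUnit_one_add_inv (hm : ¬ IsUnit (1 + (m : S))) :
    ¬ IsUnit (1 + ((m⁻¹ : Sˣ) : S)) := fun h => hm <| by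
  have := m.isUnit.mul h
  rwa [mul_add, mul_one, Units.mul_inv, add_comm] at this

theorem sum_smul_coVec {x : Fin n → S} (h : ∀ j, ∑ α, x α * D.coVec m α j = 0) :
    ∑ α, x α • D.relVec m⁻¹ α = 0 := by
  ext j
  have := h j
  simp only [coVec, Pi.smul_apply, smul_eq_mul, mul_left_comm, ← Finset.mul_sum] at this
  simpa using this

theorem hClass_congr {z z' : DGAGen n →₀ S} (h : z = z') (hz : z ∈ D.cycles m 1) :
    D.hClass m z hz = D.hClass m z' (h ▸ hz) := by
  subst h; rfl

theorem bChain_mem_span {β : Fin n → Fin n → S} (hβ : ∀ α, ∑ i, β α i = 0) :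
    bChain β ∈ Submodule.span S {x | ∃ α i j : Fin n,
      x = Finsupp.single (DGAGen.b α i) (1 : S) - Finsupp.single (DGAGen.b α j) 1} := by
  have : bChain β = ∑ α, ∑ i, β α i •
      (Finsupp.single (DGAGen.b α i) (1 : S) - Finsupp.single (DGAGen.b α 0) 1) := by
    simp only [smul_sub, Finset.sum_sub_distrib, ← Finset.sum_smul, hβ, zero_smul, sub_zero, bChain]
  rw [this]
  exact Submodule.sum_mem _ fun α _ => Submodule.sum_mem _ fun i _ => Submodule.smul_mem _ _
    (Submodule.subset_span ⟨α, i, 0, rfl⟩)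

theorem cChain_mem_span {γ : Fin n → Fin n → S} (hγ : ∀ α, ∑ i, γ α i = 0) :
    cChain γ ∈ Submodule.span S {x | ∃ α i j : Fin n,
      x = Finsupp.single (DGAGen.c i α) (1 : S) - Finsupp.single (DGAGen.c j α) 1} := by
  have : cChain γ = ∑ α, ∑ i, γ α i •
      (Finsupp.single (DGAGen.c i α) (1 : S) - Finsupp.single (DGAGen.c 0 α) 1) := by
    simp only [smul_sub, Finset.sum_sub_distrib, ← Finset.sum_smul, hγ, zero_smul, sub_zero, cChain]
  rw [this]
  exact Submodule.sum_mem _ fun α _ => Submodule.sum_mem _ fun i _ => Submodule.smul_mem _ _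
    (Submodule.subset_span ⟨α, i, 0, rfl⟩)

theorem exists_bChain_of_mem_span {z : DGAGen n →₀ S}
    (hz : z ∈ Submodule.span S {x | ∃ α i j : Fin n,
      x = Finsupp.single (DGAGen.b α i) (1 : S) - Finsupp.single (DGAGen.b α j) 1}) :
    ∃ β : Fin n → Fin n → S, (∀ α, ∑ i, β α i = 0) ∧ z = bChain β := by
  induction hz using Submodule.span_induction with
  | mem x hx =>
    obtain ⟨α, i, j, rfl⟩ := hx
    refine ⟨Pi.single α (Pi.single i 1 - Pi.single j 1), fun α' => ?_, ?_⟩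
    · by_cases h : α' = α
      · subst h; simp
      · simp [h]
    · rw [bChain, Finset.sum_eq_single α (fun b _ hb => by simp [hb]) (by simp)]
      simp [sub_smul, Finset.sum_sub_distrib, Pi.single_apply, -Finsupp.smul_single]
  | zero => exact ⟨0, by simp, bChain_zero.symm⟩
  | add x y _ _ hx hy =>
    obtain ⟨β, h, rfl⟩ := hx
    obtain ⟨β', h', rfl⟩ := hy
    exact ⟨β + β', fun α => by simp [Finset.sum_add_distrib, h, h'], (bChain_add _ _).symm⟩
  | smul s x _ hx =>
    obtain ⟨β, h, rfl⟩ := hx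
    exact ⟨s • β, fun α => by simp [← Finset.mul_sum, h], (bChain_smul _ _).symm⟩

theorem exists_cChain_of_mem_span {z : DGAGen n →₀ S}
    (hz : z ∈ Submodule.span S {x | ∃ α i j : Fin n,
      x = Finsupp.single (DGAGen.c i α) (1 : S) - Finsupp.single (DGAGen.c j α) 1}) :
    ∃ γ : Fin n → Fin n → S, (∀ α, ∑ i, γ α i = 0) ∧ z = cChain γ := by
  induction hz using Submodule.span_induction with
  | mem x hx =>
    obtain ⟨α, i, j, rfl⟩ := hx
    refine ⟨Pi.single α (Pi.single i 1 - Pi.single j 1), fun α' => ?_, ?_⟩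
    · by_cases h : α' = α
      · subst h; simp
      · simp [h]
    · rw [cChain, Finset.sum_eq_single α (fun b _ hb => by simp [hb]) (by simp)]
      simp [sub_smul, Finset.sum_sub_distrib, Pi.single_apply, -Finsupp.smul_single]
  | zero => exact ⟨0, by simp, cChain_zero.symm⟩
  | add x y _ _ hx hy =>
    obtain ⟨γ, h, rfl⟩ := hx
    obtain ⟨γ', h', rfl⟩ := hy
    exact ⟨γ + γ', fun α => by simp [Finset.sum_add_distrib, h, h'], (cChain_add _ _).symm⟩
  | smul s x _ hx =>
    obtain ⟨γ, h, rfl⟩ := hx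
    exact ⟨s • γ, fun α => by simp [← Finset.mul_sum, h], (cChain_smul _ _).symm⟩

variable [IsDomain S] (hm : ¬ IsUnit (1 + (m : S)))

include hm

/-- For fixed `i`, the cycle condition makes `α ↦ β α i` a dependency between the relations, hence a
multiple of the weights. The multiplier is read off at crossing `0`. -/
theorem hClass_bChain_mem_range {β : Fin n → Fin n → S} (hβ : ∀ α, ∑ i, β α i = 0)
    (hz : bChain β + cChain 0 ∈ D.cycles m 1) :
    D.hClass m _ hz ∈ (D.bSection m).range := by
  have h := (D.linDiff_eq_zero_iff m hβ (by simp)).1 ((D.mem_cycles m).1 hz)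
  simp only [Pi.zero_apply, zero_mul, Finset.sum_const_zero, add_zero] at h
  refine ⟨(D.relSpan m⁻¹).mkQ fun i => β 0 i * ((D.weight m 0)⁻¹ : Sˣ), ?_⟩
  have e : (fun α i => (D.weight m α : S) * (β 0 i * ((D.weight m 0)⁻¹ : Sˣ))) = β := by
    ext α i
    rw [mul_comm]
    refine (D.relation_eq_smul_weight hm (x := fun α => β α i) ?_ α).symm
    ext j
    simpa using h j i
  rw [bSection_mkQ, hClass_eq_iff, coe_bCycle,
    sumZero_of_sum_eq_zero (by rw [← Finset.sum_mul, hβ, zero_mul]), e, sub_self]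
  exact zero_mem _

theorem hClass_cChain_mem_range {γ : Fin n → Fin n → S} (hγ : ∀ α, ∑ i, γ α i = 0)
    (hz : bChain 0 + cChain γ ∈ D.cycles m 1) :
    D.hClass m _ hz ∈ (D.cSection m).range := by
  have h := (D.linDiff_eq_zero_iff m (by simp) hγ).1 ((D.mem_cycles m).1 hz)
  simp only [Pi.zero_apply, zero_mul, Finset.sum_const_zero, zero_add] at h
  refine ⟨(D.relSpan m).mkQ fun i => γ 0 i * ((D.weight m⁻¹ 0)⁻¹ : Sˣ), ?_⟩
  have e : (fun α i => (D.weight m⁻¹ α : S) * (γ 0 i * ((D.weight m⁻¹ 0)⁻¹ : Sˣ))) = γ := by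
    ext α i
    rw [mul_comm]
    exact (D.relation_eq_smul_weight (not_isUnit_one_add_inv hm) (x := fun α => γ α i)
      (D.sum_smul_coVec (h i)) α).symm
  rw [cSection_mkQ, hClass_eq_iff, coe_cCycle,
    sumZero_of_sum_eq_zero (by rw [← Finset.sum_mul, hγ, zero_mul]), e, sub_self]
  exact zero_mem _

theorem range_bSection : (D.bSection m).range = D.bClasses m := by
  apply le_antisymm
  · rintro _ ⟨x, rfl⟩
    obtain ⟨v, rfl⟩ := Submodule.mkQ_surjective _ x
    refine (Subquotient.mem_classesOf _ _).2 ⟨D.bCycle m v, ?_, rfl⟩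
    rw [coe_bCycle, cChain_zero, add_zero]
    exact bChain_mem_span fun α => by rw [← Finset.mul_sum, sum_sumZero, mul_zero]
  · intro x hx
    obtain ⟨⟨z, hz⟩, hz', rfl⟩ := (Subquotient.mem_classesOf _ _).1 hx
    obtain ⟨β, hβ, h⟩ := exists_bChain_of_mem_span hz'
    have h' : z = bChain β + cChain 0 := by rw [cChain_zero, add_zero]; exact h
    have := D.hClass_bChain_mem_range hm hβ (h' ▸ hz)
    rwa [← D.hClass_congr h' hz] at this

theorem range_cSection : (D.cSection m).range = D.cClasses m := by
  apply le_antisymm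
  · rintro _ ⟨x, rfl⟩
    obtain ⟨v, rfl⟩ := Submodule.mkQ_surjective _ x
    refine (Subquotient.mem_classesOf _ _).2 ⟨D.cCycle m v, ?_, rfl⟩
    rw [coe_cCycle, bChain_zero, zero_add]
    exact cChain_mem_span fun α => by rw [← Finset.mul_sum, sum_sumZero, mul_zero]
  · intro x hx
    obtain ⟨⟨z, hz⟩, hz', rfl⟩ := (Subquotient.mem_classesOf _ _).1 hx
    obtain ⟨γ, hγ, h⟩ := exists_cChain_of_mem_span hz'
    have h' : z = bChain 0 + cChain γ := by rw [bChain_zero, zero_add]; exact h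
    have := D.hClass_cChain_mem_range hm hγ (h' ▸ hz)
    rwa [← D.hClass_congr h' hz] at this

end classes

/-! ### The torsion of the linearized homology. -/

section torsion

variable {n : ℕ} [NeZero n] (D : KnotDiagram n) {S : Type*} [CommRing S] (m : Sˣ)

/-- The relations with coefficients in a module between the abelianized Wirtinger relations. -/
def relKer (Z : Type*) [AddCommGroup Z] [Module S Z] : Submodule S (Fin n → Z) where
  carrier := {z | ∀ j, ∑ α, D.relVec m α j • z α = 0}
  add_mem' hx hy j := by simp [Finset.sum_add_distrib, hx j, hy j]
  zero_mem' j := by simp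
  smul_mem' s x hx j := by simp [smul_comm _ s, ← Finset.smul_sum, hx j]

theorem mem_relKer {Z : Type*} [AddCommGroup Z] [Module S Z] {z : Fin n → Z} :
    z ∈ D.relKer m Z ↔ ∀ j, ∑ α, D.relVec m α j • z α = 0 := Iff.rfl

/-- A class with vanishing coefficient sums is represented by a chain in the span of the
differences of generators. -/
theorem exists_rep_of_coeffSums_eq_zero {x : D.LinHomology m 1} (hx : D.coeffSums m x = 0) :
    ∃ β γ, (∀ α, ∑ i, β α i = 0) ∧ (∀ α, ∑ i, γ α i = 0) ∧
      ∃ h : bChain β + cChain γ ∈ D.cycles m 1, D.hClass m _ h = x := by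
  obtain ⟨β, γ, h, rfl⟩ := D.exists_hClass_bc m x
  have hs : ∀ α, ∑ i, β α i = m * ∑ i, γ α i := fun α => by
    have := congrFun hx α
    rwa [coeffSums_hClass, Pi.zero_apply, sub_eq_zero] at this
  -- The boundary of `e α` has coefficient sums `m` and `1` on the `b` and the `c`. Subtracting it
  -- `∑ i, γ α i` times, for every `α`, therefore clears all coefficient sums at once.
  have he := D.linDiff_e_mem m fun α => ∑ i, γ α i
  set β' : Fin n → Fin n → S := fun α i =>
    (∑ i, γ α i) * (Pi.single (D.r α) (m : S) : Fin n → S) i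
  set γ' : Fin n → Fin n → S := fun α i => (∑ i, γ α i) *
    (Pi.single (D.l α) (m : S) - Pi.single (D.o α) (1 + (m : S)) : Fin n → S) i
  have e1 : bChain β + cChain γ - (bChain β' - cChain γ') =
      bChain (β + (-1 : S) • β') + cChain (γ + γ') := by
    rw [bChain_add, cChain_add, bChain_smul, neg_one_smul]; abel
  refine ⟨β + (-1 : S) • β', γ + γ', fun α => ?_, fun α => ?_,
    e1 ▸ Submodule.sub_mem _ h (D.sub_mem_cycles m he), ?_⟩
  · simp [β', Finset.sum_add_distrib, hs α, ← Finset.mul_sum, mul_comm]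
  · simp only [γ', Pi.add_apply, Pi.sub_apply, Finset.sum_add_distrib, ← Finset.mul_sum,
      Finset.sum_sub_distrib, Finset.sum_pi_single', Finset.mem_univ, if_true]
    ring
  · rw [hClass_eq_iff, ← e1, sub_sub_cancel_left]
    exact Submodule.neg_mem _ he

/-- This is the cycle condition read modulo the relations: its `β` part is a combination of the
`relVec m α`, and what remains is `m` times the claim. -/
theorem cRetract_mem_relKer {x : D.LinHomology m 1} (hx : D.coeffSums m x = 0) :
    D.cRetract m x ∈ D.relKer m⁻¹ (D.AlexModule m) := by
  obtain ⟨β, γ, hβ, hγ, h, rfl⟩ := D.exists_rep_of_coeffSums_eq_zero m hx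
  have hc := (D.linDiff_eq_zero_iff m hβ hγ).1 ((D.mem_cycles m).1 h)
  intro j
  simp only [cRetract_hClass, hγ, zero_smul, add_zero, ← map_smul, ← map_sum]
  rw [← smul_eq_zero_iff_eq m, Units.smul_def, ← map_smul, Submodule.mkQ_apply,
    Submodule.Quotient.mk_eq_zero]
  have e : (m : S) • ∑ α, D.relVec m⁻¹ α j • γ α = -∑ α, β α j • D.relVec m α := by
    rw [eq_neg_iff_add_eq_zero]
    ext i
    rw [Pi.zero_apply, ← hc i j, add_comm]
    simp [coVec, Finset.mul_sum, mul_left_comm, mul_comm]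
  rw [e]
  exact Submodule.neg_mem _ (Submodule.sum_mem _ fun α _ => Submodule.smul_mem _ _
    (D.relVec_mem_relSpan m α))

/-- The map that describes the torsion of the linearized homology. -/
noncomputable def torsionMap :
    (D.coeffSums m).ker →ₗ[S] D.relKer m⁻¹ (D.AlexModule m) × D.AlexModule m⁻¹ :=
  (((D.cRetract m) ∘ₗ (D.coeffSums m).ker.subtype).codRestrict _
    fun x => D.cRetract_mem_relKer m x.2).prod
      (LinearMap.proj 0 ∘ₗ D.bRetract m ∘ₗ (D.coeffSums m).ker.subtype)

/-- If the `c` part is trivial modulo the relations, boundaries of the `d` remove it. A cycle in the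
`b` alone comes from `bSection`, and there component `0` of `bRetract` is a unit multiple of the
identity. -/
theorem torsionMap_injective [IsDomain S] (hm : ¬ IsUnit (1 + (m : S))) :
    Function.Injective (D.torsionMap m) := by
  rw [injective_iff_map_eq_zero]
  rintro ⟨x, hx⟩ h0
  have h1 : D.cRetract m x = 0 := congrArg Subtype.val (congrArg Prod.fst h0)
  have h2 : D.bRetract m x 0 = 0 := congrArg Prod.snd h0
  obtain ⟨β, γ, hβ, hγ, h, rfl⟩ := D.exists_rep_of_coeffSums_eq_zero m hx
  have h3 : ∀ α, ∃ δ : Fin n → S, γ α = ∑ β, δ β • D.relVec m β := fun α => by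
    refine D.exists_eq_sum_relVec m ?_ (hγ α)
    have := congrFun h1 α
    rwa [cRetract_hClass, hγ, zero_smul, add_zero, Pi.zero_apply, Submodule.mkQ_apply,
      Submodule.Quotient.mk_eq_zero] at this
  choose δ hδ using h3
  have hd := D.linDiff_d_mem m fun α β => δ β α
  have e0 : (fun β i => ∑ α, δ β α * D.relVec m α i) = γ := by
    ext β i
    rw [hδ]; simp
  rw [e0] at hd
  set β' : Fin n → Fin n → S := fun α i => ∑ β, δ β α * D.coVec m β i
  have e1 : bChain β + cChain γ + (bChain β' - cChain γ) = bChain (β + β') + cChain 0 := by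
    rw [bChain_add, cChain_zero]; abel
  have hz : bChain (β + β') + cChain 0 ∈ D.cycles m 1 :=
    e1 ▸ Submodule.add_mem _ h (D.sub_mem_cycles m hd)
  have e2 : D.hClass m _ h = D.hClass m _ hz := by
    rw [hClass_eq_iff, ← e1, sub_add_cancel_left]
    exact Submodule.neg_mem _ hd
  have hβ' : ∀ α, ∑ i, (β + β') α i = 0 := fun α => by
    simp only [β', Pi.add_apply, Finset.sum_add_distrib, hβ, zero_add]
    rw [Finset.sum_comm]
    simp only [← Finset.mul_sum, sum_coords_coVec, mul_zero, Finset.sum_const_zero]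
  obtain ⟨y, hy⟩ := D.hClass_bChain_mem_range hm hβ' hz
  rw [e2, ← hy, bRetract_bSection, ← Units.smul_def, smul_eq_zero_iff_eq] at h2
  ext1
  simp only [e2, ← hy, h2, map_zero, Submodule.coe_zero]

/-- Once `g` is lifted to vectors `γ`, its being a dependency says exactly that the cycle condition
can be solved for the `b` part. The second component is then corrected by `bSection`, invisible to
`cRetract`. -/
theorem torsionMap_surjective : Function.Surjective (D.torsionMap m) := by
  rintro ⟨⟨g, hg⟩, y⟩
  choose γ hγ using fun α => Submodule.mkQ_surjective (D.relSpan m) (g α)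
  have h1 : ∀ j, ∃ δ : Fin n → S, ∑ α, D.coVec m α j • sumZero (γ α) =
      ∑ β, δ β • D.relVec m β := fun j => by
    refine D.exists_eq_sum_relVec m ?_ ?_
    · rw [← Submodule.Quotient.mk_eq_zero, ← Submodule.mkQ_apply, map_sum]
      simp only [map_smul, mkQ_sumZero, hγ]
      simp only [coVec, Pi.smul_apply, smul_assoc, ← Finset.smul_sum]
      rw [hg j, smul_zero]
    · simp only [Finset.sum_apply, Pi.smul_apply, smul_eq_mul]
      rw [Finset.sum_comm]
      simp only [← Finset.mul_sum, sum_sumZero, mul_zero, Finset.sum_const_zero]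
  choose δ hδ using h1
  have h2 : ∑ j, ∑ β, δ j β • D.relVec m β = 0 := by
    simp only [← hδ]
    rw [Finset.sum_comm]
    simp only [← Finset.sum_smul, sum_coords_coVec, zero_smul, Finset.sum_const_zero]
  -- `sumZero` is needed for vanishing row sums. Its correction, in entry `0`, is by `h2` a
  -- dependency between the relations, so the cycle condition survives.
  set β' : Fin n → Fin n → S := fun α => sumZero fun j => -δ j α
  have hz : bChain β' + cChain (fun α => sumZero (γ α)) ∈ D.cycles m 1 := by
    rw [mem_cycles, linDiff_eq_zero_iff]
    · intro i j
      have e1 := congrFun (hδ j) i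
      have e2 := congrFun h2 i
      simp only [Finset.sum_apply, Pi.smul_apply, smul_eq_mul, Pi.zero_apply] at e1 e2
      simp only [mul_comm (sumZero (γ _) i), e1]
      rw [Finset.sum_comm] at e2
      simp only [← Finset.sum_mul] at e2
      simp only [β', sumZero_apply, Pi.sub_apply, Pi.smul_apply, smul_eq_mul, sub_mul,
        Finset.sum_sub_distrib, neg_mul, Finset.sum_neg_distrib, Finset.sum_mul,
        mul_right_comm _ ((Pi.single 0 1 : Fin n → S) j)]
      simp [← Finset.sum_mul, e2]
    · exact fun α => sum_sumZero _
    · exact fun α => sum_sumZero _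
  set x₀ := D.hClass m _ hz
  have hx₀ : D.coeffSums m x₀ = 0 := by
    ext1 α
    rw [coeffSums_hClass]
    simp [β', sum_sumZero]
  have hc : D.cRetract m x₀ = g := by
    ext1 α
    rw [cRetract_hClass, mkQ_sumZero, hγ, sum_sumZero, zero_smul, add_zero]
  refine ⟨⟨x₀ + D.bSection m (((D.weight m 0)⁻¹ : Sˣ) • (y - D.bRetract m x₀ 0)), ?_⟩, ?_⟩
  · rw [LinearMap.mem_ker, map_add, hx₀, coeffSums_bSection, zero_add]
  · refine Prod.ext (Subtype.ext ?_) ?_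
    · change D.cRetract m (x₀ + _) = g
      rw [map_add, cRetract_bSection, add_zero, hc]
    · change D.bRetract m (x₀ + _) 0 = y
      rw [map_add, Pi.add_apply, bRetract_bSection, ← Units.smul_def, smul_inv_smul,
        add_sub_cancel]

variable {m}

theorem det_smul_relKer (Z : Type*) [AddCommGroup Z] [Module S Z] {s : S} (h : ∀ z : Z, s • z = 0)
    (x : D.relKer m Z) : s • x = 0 := by
  ext α
  exact h _

/-- The torsion of the linearized homology. -/
noncomputable def torsionEquiv [IsDomain S] (hm : ¬ IsUnit (1 + (m : S))) :
    Submodule.torsion S (D.LinHomology m 1) ≃ₗ[S]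
      D.relKer m⁻¹ (D.AlexModule m) × D.AlexModule m⁻¹ :=
  have e := LinearEquiv.ofBijective _ ⟨D.torsionMap_injective m hm, D.torsionMap_surjective m⟩
  (LinearEquiv.ofEq _ _ (by
    apply le_antisymm
    · rintro x ⟨a, ha⟩
      rw [LinearMap.mem_ker]
      ext α
      have := congrFun (congrArg (D.coeffSums m) ha) α
      rw [Submonoid.smul_def, map_smul, map_zero, Pi.smul_apply, smul_eq_mul, Pi.zero_apply] at this
      exact (mul_eq_zero.1 this).resolve_left (nonZeroDivisors.ne_zero a.2)
    · intro x hx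
      -- One determinant annihilates the dependencies with coefficients in `AlexModule m`, the other
      -- annihilates `AlexModule m⁻¹`.
      refine ⟨⟨(D.presMatrix m).det * (D.presMatrix m⁻¹).det, mem_nonZeroDivisors_of_ne_zero
        (mul_ne_zero (D.det_presMatrix_ne_zero hm)
          (D.det_presMatrix_ne_zero (not_isUnit_one_add_inv hm)))⟩, ?_⟩
      rw [Submonoid.smul_def]
      refine congrArg Subtype.val (a₂ := 0)
        (a₁ := ((D.presMatrix m).det * (D.presMatrix m⁻¹).det) • (⟨x, hx⟩ : (D.coeffSums m).ker))
        (e.injective ?_)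
      rw [map_smul, map_zero]
      refine Prod.ext ?_ ?_
      · change (_ * _) • (e ⟨x, hx⟩).1 = 0
        rw [mul_comm, mul_smul, D.det_smul_relKer _ (D.det_smul_alex m), smul_zero]
      · change (_ * _) • (e ⟨x, hx⟩).2 = 0
        rw [mul_smul, D.det_smul_alex, smul_zero])).trans e

end torsion

end KnotDiagram

/-! ### Modules over Laurent polynomials from automorphisms. -/

section laurent

variable {k : Type*} [CommRing k]

theorem map_laurent_smul {M N : Type*} [AddCommGroup M] [Module k[T;T⁻¹] M] [AddCommGroup N]
    [Module k[T;T⁻¹] N] (f : M →+ N) (hC : ∀ (c : k) x, f (C c • x) = (C c : k[T;T⁻¹]) • f x)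
    (hT : ∀ x, f ((T 1 : k[T;T⁻¹]) • x) = (T 1 : k[T;T⁻¹]) • f x) (p : k[T;T⁻¹]) (x : M) :
    f (p • x) = p • f x := by
  have hT' : ∀ x, f ((T (-1) : k[T;T⁻¹]) • x) = (T (-1) : k[T;T⁻¹]) • f x := fun x => by
    have h1 : ∀ y : M, (T 1 : k[T;T⁻¹]) • (T (-1) : k[T;T⁻¹]) • y = y := fun y => by
      rw [smul_smul, ← T_add]; simp
    have h2 : ∀ y : N, (T (-1) : k[T;T⁻¹]) • (T 1 : k[T;T⁻¹]) • y = y := fun y => by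
      rw [smul_smul, ← T_add]; simp
    rw [← h2 (f _), ← hT, h1]
  induction p using LaurentPolynomial.induction_on generalizing x with
  | h_C a => exact hC a x
  | h_add hp hq => rw [add_smul, map_add, hp, hq, add_smul]
  | h_C_mul_T m a h =>
    rw [T_add, ← mul_assoc, mul_smul, h, hT, ← mul_smul]
  | h_C_mul_T_Z m a h =>
    rw [sub_eq_add_neg, T_add, ← mul_assoc, mul_smul, h, hT', ← mul_smul]

/-- A module with an automorphism, as a module over the Laurent polynomials. -/
def LaurentModule {V : Type*} [AddCommGroup V] [Module k V] (_u : V ≃ₗ[k] V) : Type _ := V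

namespace LaurentModule

variable {V : Type*} [AddCommGroup V] [Module k V] (u : V ≃ₗ[k] V)

instance : AddCommGroup (LaurentModule u) := inferInstanceAs (AddCommGroup V)

/-- the action of the Laurent polynomials -/
noncomputable def action : k[T;T⁻¹] →ₐ[k] Module.End k V :=
  AddMonoidAlgebra.lift k (Module.End k V) ℤ
    ((LinearEquiv.automorphismGroup.toLinearMapMonoidHom (R := k) (M := V)).comp (zpowersHom _ u))

noncomputable instance : Module k[T;T⁻¹] (LaurentModule u) :=
  Module.compHom V (action u).toRingHom

/-- The identity map to the Laurent module. -/
def of : V ≃+ LaurentModule u := AddEquiv.refl V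

theorem T_one_smul (x : V) : (T 1 : k[T;T⁻¹]) • of u x = of u (u x) := by
  change action u (T 1) x = _
  rw [action, show (T 1 : k[T;T⁻¹]) = AddMonoidAlgebra.single 1 1 from rfl,
    AddMonoidAlgebra.lift_single]
  simp [zpowersHom]
  rfl

theorem C_smul (c : k) (x : V) : (C c : k[T;T⁻¹]) • of u x = of u (c • x) := by
  change action u (C c) x = _
  rw [action, show (C c : k[T;T⁻¹]) = AddMonoidAlgebra.single 0 c from rfl,
    AddMonoidAlgebra.lift_single]
  simp [zpowersHom]
  rfl

end LaurentModule

end laurent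

/-! ### Order ideals. -/

section orderIdeal

variable {R : Type*} [CommRing R]

theorem orderIdeal_le_of_equiv {M N : Type*} [AddCommGroup M] [Module R M] [AddCommGroup N]
    [Module R N] (e : M ≃ₗ[R] N) : orderIdeal R M ≤ orderIdeal R N := by
  refine Ideal.span_mono ?_
  rintro x ⟨m, g, X, hg, hX, hx⟩
  refine ⟨m, e ∘ g, X, ?_, fun i => ?_, hx⟩
  · have := congrArg (Submodule.map e.toLinearMap) hg
    rwa [Submodule.map_span, Submodule.map_top, LinearEquiv.range, ← Set.range_comp] at this
  · simp only [Function.comp_apply, ← map_smul, ← map_sum, hX, map_zero]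

theorem orderIdeal_eq_of_equiv {M N : Type*} [AddCommGroup M] [Module R M] [AddCommGroup N]
    [Module R N] (e : M ≃ₗ[R] N) : orderIdeal R M = orderIdeal R N :=
  le_antisymm (orderIdeal_le_of_equiv e) (orderIdeal_le_of_equiv e.symm)

/-- The order ideal of a module with a square presentation matrix is generated by the
determinant. -/
theorem orderIdeal_of_presentation {n : ℕ} (M : Matrix (Fin n) (Fin n) R) :
    orderIdeal R ((Fin n → R) ⧸ Submodule.span R (Set.range M.row)) = Ideal.span {M.det} := by
  set π := (Submodule.span R (Set.range M.row)).mkQ with hπ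
  have hsum : ∀ v : Fin n → R, π v = ∑ j, v j • π (Pi.single j 1) := fun v => by
    conv_lhs => rw [pi_eq_sum_univ' v, map_sum]
    refine Finset.sum_congr rfl fun i _ => ?_
    rw [← map_smul]
  have hz : ∀ v, π v = 0 → ∃ z, v = Matrix.vecMul z M := fun v hv => by
    rw [hπ, Submodule.mkQ_apply, Submodule.Quotient.mk_eq_zero, ← range_vecMulLinear] at hv
    obtain ⟨z, hz⟩ := hv
    exact ⟨z, hz.symm⟩
  apply le_antisymm
  · refine Ideal.span_le.2 ?_
    rintro _ ⟨m, g, X, hg, hX, rfl⟩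
    rw [SetLike.mem_coe, Ideal.mem_span_singleton]
    choose V hV using fun i => Submodule.mkQ_surjective (Submodule.span R (Set.range M.row)) (g i)
    have hU : ∀ i : Fin n, ∃ U : Fin m → R, ∑ j, U j • g j = π (Pi.single i 1) := fun i =>
      (Submodule.mem_span_range_iff_exists_fun R).1 (hg ▸ Submodule.mem_top)
    choose U hU using hU
    have h1 : ∀ i, ∃ z, (X * Matrix.of V).row i = Matrix.vecMul z M := fun i => hz _ <| by
      have : (X * Matrix.of V).row i = ∑ j, X i j • V j := by
        ext l; simp [Matrix.row, Matrix.mul_apply]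
      rw [this, map_sum, ← hX i]
      exact Finset.sum_congr rfl fun j _ => by rw [map_smul, hπ, hV]
    have h2 : ∀ i, ∃ z, (1 - Matrix.of U * Matrix.of V).row i = Matrix.vecMul z M := fun i =>
        hz _ <| by
      have : (1 - Matrix.of U * Matrix.of V).row i = Pi.single i 1 - ∑ j, U i j • V j := by
        ext l; simp [Matrix.row, Matrix.mul_apply, Matrix.one_apply, Pi.single_apply, eq_comm]
      rw [this, map_sub, map_sum, ← hU, sub_eq_zero]
      exact Finset.sum_congr rfl fun j _ => by rw [map_smul, hπ, hV]
    choose Z₁ hZ₁ using h1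
    choose Z₂ hZ₂ using h2
    have e1 : X * Matrix.of V = Matrix.of Z₁ * M := by
      ext i l; exact congrFun (hZ₁ i) l
    have e2 : 1 - Matrix.of U * Matrix.of V = Matrix.of Z₂ * M := by
      ext i l; exact congrFun (hZ₂ i) l
    -- `V` and `U` express the two generating tuples through each other. The left side has
    -- determinant `X.det`, and `M.det` splits off on the right, although `X` and `M` may differ in
    -- size.
    have key : Matrix.fromBlocks X 0 (-Matrix.of U) 1 * Matrix.fromBlocks 1 (Matrix.of V) 0 1 =
        Matrix.fromBlocks X (Matrix.of Z₁) (-Matrix.of U) (Matrix.of Z₂) *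
          Matrix.fromBlocks 1 0 0 M := by
      rw [Matrix.fromBlocks_multiply, Matrix.fromBlocks_multiply]
      simp [e1, ← e2, sub_eq_neg_add]
      exact Matrix.neg_mul (Matrix.of U) _
    have := congrArg Matrix.det key
    rw [Matrix.det_mul, Matrix.det_mul, Matrix.det_fromBlocks_zero₁₂, Matrix.det_fromBlocks_zero₂₁,
      Matrix.det_fromBlocks_zero₁₂] at this
    simp only [Matrix.det_one, mul_one, one_mul] at this
    rw [this]
    exact dvd_mul_left _ _
  · rw [Ideal.span_le, Set.singleton_subset_iff]
    refine Ideal.subset_span ⟨n, fun i => π (Pi.single i 1), M, ?_, fun i => ?_, rfl⟩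
    · rw [eq_top_iff]
      rintro x -
      obtain ⟨v, rfl⟩ := Submodule.mkQ_surjective _ x
      rw [← hπ, hsum]
      exact Submodule.sum_mem _ fun j _ => Submodule.smul_mem _ _ (Submodule.subset_span ⟨j, rfl⟩)
    · rw [← hsum]
      exact (Submodule.Quotient.mk_eq_zero _).2 (Submodule.subset_span ⟨i, rfl⟩)

end orderIdeal

/-! ### The Alexander invariant over ℤ: order ideal, H_b and H_c. -/

namespace KnotDiagram

section invariant

theorem not_isUnit_one_add_T {k : Type*} [CommRing k] [Nontrivial k] :
    ¬ IsUnit (1 + (mu k : k[T;T⁻¹])) := fun h => by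
  have := h.map (LaurentPolynomial.eval₂ (RingHom.id k) (-1 : kˣ))
  rw [map_add, map_one, show ((mu k : (k[T;T⁻¹])ˣ) : k[T;T⁻¹]) = T 1 from rfl, eval₂_T] at this
  simp at this

variable {n : ℕ} [NeZero n] (D : KnotDiagram n)

/-- The Alexander invariant, with `-m` acting as the deck transformation, is the Alexander module. -/
theorem exists_alexEquiv {m : (ℤ[T;T⁻¹])ˣ}
    (hm : (m : ℤ[T;T⁻¹]) = T 1 ∨ (m : ℤ[T;T⁻¹]) = T (-1) ∨ (m : ℤ[T;T⁻¹]) = -T 1)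
    {H : Type*} [AddCommGroup H] [Module ℤ[T;T⁻¹] H] (j : D.AlexanderInvariant ≃+ H)
    (hj : ∀ x, j (D.deck x) = -(m : ℤ[T;T⁻¹]) • j x) :
    ∃ f : H ≃ₗ[ℤ[T;T⁻¹]] D.AlexModule m, ∀ x, f (j x) = D.alexHom m x := by
  let δ₀ : H →+ D.AlexModule m := (D.alexHom m).comp j.symm
  have h0 : ∀ x, δ₀ ((m : ℤ[T;T⁻¹]) • x) = (m : ℤ[T;T⁻¹]) • δ₀ x := fun x => by
    obtain ⟨y, rfl⟩ := j.surjective x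
    have : (m : ℤ[T;T⁻¹]) • j y = -j (D.deck y) := by rw [hj, neg_smul, neg_neg]
    rw [this, map_neg]
    simp [δ₀, alexHom_deck]
  -- In each case `T` is `m`, its inverse or its negative, so compatibility with `m` suffices.
  have hT : ∀ x, δ₀ ((T 1 : ℤ[T;T⁻¹]) • x) = (T 1 : ℤ[T;T⁻¹]) • δ₀ x := by
    rcases hm with h | h | h
    · rwa [h] at h0
    · intro x
      have h1 := h0 ((T 1 : ℤ[T;T⁻¹]) • x)
      rw [h, smul_smul, ← T_add, neg_add_cancel, T_zero, one_smul] at h1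
      rw [h1, smul_smul, ← T_add, add_neg_cancel, T_zero, one_smul]
    · intro x
      have := h0 x
      rwa [h, neg_smul, neg_smul, map_neg, neg_inj] at this
  have hlin := map_laurent_smul δ₀ (fun c x => by
    rw [show (C c : ℤ[T;T⁻¹]) = (c : ℤ[T;T⁻¹]) by simp, Int.cast_smul_eq_zsmul,
      Int.cast_smul_eq_zsmul, map_zsmul]) hT
  let δ : H →ₗ[ℤ[T;T⁻¹]] D.AlexModule m := { δ₀ with map_smul' := hlin }
  have hδ : ∀ x, δ (j x) = D.alexHom m x := fun x => congrArg (D.alexHom m) (j.symm_apply_apply x)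
  refine ⟨D.alexEquiv m j.toAddMonoidHom hj ?_ δ hδ, hδ⟩
  exact eq_top_iff.2 fun x _ => Submodule.subset_span (j.surjective x)

/-- The Alexander invariant is given the module structure in which `T` acts by minus the deck
transformation, or by the inverse of that, so that `-m` acts by `deck`. -/
theorem exists_addEquiv_alexModule {m : (ℤ[T;T⁻¹])ˣ}
    (hm : (m : ℤ[T;T⁻¹]) = T 1 ∨ (m : ℤ[T;T⁻¹]) = T (-1)) :
    ∃ f : D.AlexanderInvariant ≃+ D.AlexModule m,
      ∀ x, f (D.deck x) = -(m : ℤ[T;T⁻¹]) • f x := by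
  rcases hm with h | h
  · let u := D.deck.trans (LinearEquiv.neg ℤ)
    obtain ⟨f, -⟩ := D.exists_alexEquiv (Or.inl h) (LaurentModule.of u) fun x => by
      rw [h, neg_smul, LaurentModule.T_one_smul, ← map_neg]
      simp [u]
    refine ⟨(LaurentModule.of u).trans f.toAddEquiv, fun x => ?_⟩
    have : LaurentModule.of u (D.deck x) = -(m : ℤ[T;T⁻¹]) • LaurentModule.of u x := by
      rw [h, neg_smul, LaurentModule.T_one_smul, ← map_neg]
      simp [u]
    simp [this]
  · let u := (D.deck.trans (LinearEquiv.neg ℤ)).symm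
    have hu : ∀ x, LaurentModule.of u (D.deck x) = -(m : ℤ[T;T⁻¹]) • LaurentModule.of u x := by
      intro x
      have : LaurentModule.of u x = -((T 1 : ℤ[T;T⁻¹]) • LaurentModule.of u (D.deck x)) := by
        rw [LaurentModule.T_one_smul, ← map_neg]
        congr 1
        rw [← map_neg, eq_comm, LinearEquiv.symm_apply_eq]
        simp
      rw [this, h, neg_smul, smul_neg, neg_neg, smul_smul, ← T_add, neg_add_cancel, T_zero,
        one_smul]
    obtain ⟨f, -⟩ := D.exists_alexEquiv (Or.inr (Or.inl h)) (LaurentModule.of u) hu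
    refine ⟨(LaurentModule.of u).trans f.toAddEquiv, fun x => ?_⟩
    simp [hu]

/-- In the original structure `T` itself acts by `deck`, so the matrix to use is the one for `m =
-μ`. -/
theorem orderIdeal_alexanderInvariant :
    orderIdeal ℤ[T;T⁻¹] D.AlexanderInvariant = Ideal.span {(D.presMatrix (-mu ℤ)).det} := by
  obtain ⟨f, -⟩ := D.exists_alexEquiv (m := -mu ℤ) (Or.inr (Or.inr rfl)) (AddEquiv.refl _)
    fun x => by
      rw [Units.val_neg, neg_neg]
      exact (D.T_one_smul x).symm
  rw [orderIdeal_eq_of_equiv f]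
  exact orderIdeal_of_presentation _

theorem exists_addEquiv_cClasses : ∃ f : D.AlexanderInvariant ≃+ D.cClasses (mu ℤ),
    ∀ x, f ((T 1 : ℤ[T;T⁻¹]) • x) = -((T 1 : ℤ[T;T⁻¹]) • f x) := by
  obtain ⟨f, hf⟩ := D.exists_addEquiv_alexModule (m := mu ℤ) (Or.inl rfl)
  let g := (LinearEquiv.ofInjective _ (D.cSection_injective (mu ℤ))).trans
    (LinearEquiv.ofEq _ _ (D.range_cSection not_isUnit_one_add_T))
  refine ⟨f.trans g.toAddEquiv, fun x => ?_⟩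
  change g (f _) = -(_ • g (f x))
  rw [T_one_smul, hf, map_smul]
  exact neg_smul (T 1 : ℤ[T;T⁻¹]) (g (f x))

theorem exists_addEquiv_bClasses : ∃ f : D.AlexanderInvariant ≃+ D.bClasses (mu ℤ),
    ∀ x, f ((T (-1) : ℤ[T;T⁻¹]) • x) = -((T 1 : ℤ[T;T⁻¹]) • f x) := by
  obtain ⟨f, hf⟩ := D.exists_addEquiv_alexModule (m := (mu ℤ)⁻¹) (Or.inr rfl)
  let g := (LinearEquiv.ofInjective _ (D.bSection_injective (mu ℤ))).trans
    (LinearEquiv.ofEq _ _ (D.range_bSection not_isUnit_one_add_T))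
  refine ⟨f.trans g.toAddEquiv, fun x => ?_⟩
  change g (f _) = -(_ • g (f x))
  have h1 : (T 1 : ℤ[T;T⁻¹]) • (T (-1) : ℤ[T;T⁻¹]) • x = x := by
    rw [smul_smul, ← T_add]; simp
  have h2 := hf ((T (-1) : ℤ[T;T⁻¹]) • x)
  rw [← T_one_smul, h1] at h2
  rw [h2, ← map_smul, ← map_neg, smul_smul,
    show (T 1 : ℤ[T;T⁻¹]) * -(((mu ℤ)⁻¹ : (ℤ[T;T⁻¹])ˣ) : ℤ[T;T⁻¹]) = -1 from ?_, neg_one_smul,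
    neg_neg]
  rw [mul_neg, neg_inj]
  exact (mu ℤ).mul_inv

end invariant

end KnotDiagram

/-! ### Torsion modules over a principal ideal domain, by lengths of Hom modules. -/

section principal

variable {R : Type*} [CommRing R] [IsDomain R] [IsPrincipalIdealRing R]

/-- A square matrix over a principal ideal domain is equivalent to its transpose. -/
theorem Matrix.exists_transpose_eq {n : Type*} [Fintype n] [DecidableEq n] (M : Matrix n n R)
    (hM : M.det ≠ 0) :
    ∃ P Q : Matrix n n R, IsUnit P ∧ IsUnit Q ∧ M.transpose = P * M * Q := by
  have hinj : Function.Injective M.mulVecLin := by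
    rw [← LinearMap.ker_eq_bot, LinearMap.ker_eq_bot']
    exact fun v hv => Matrix.eq_zero_of_mulVec_eq_zero hM hv
  -- Smith normal form of the image of `M`: a basis `b` whose multiples `a i • b i` form a basis of
  -- the image. Pulled back along `M` it gives `c` with `M c_i = a_i b_i`, so `M = B * diagonal a *
  -- C⁻¹`, and the diagonal matrix equals its transpose.
  obtain ⟨b, a, ab, hab⟩ := Submodule.exists_smith_normal_form_of_rank_eq
    (N := M.mulVecLin.range) (Pi.basisFun R n) (LinearMap.finrank_range_of_inj hinj)
  let c : Module.Basis n R (n → R) := ab.map (LinearEquiv.ofInjective M.mulVecLin hinj).symm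
  have hc : ∀ i, M.mulVec (c i) = a i • b i := fun i => by
    rw [← hab i]
    exact congrArg Subtype.val ((LinearEquiv.ofInjective M.mulVecLin hinj).apply_symm_apply (ab i))
  have hu : ∀ v : Module.Basis n R (n → R), IsUnit ((Pi.basisFun R n).toMatrix v) := fun v =>
    IsUnit.of_mul_eq_one _ (Module.Basis.toMatrix_mul_toMatrix_flip (Pi.basisFun R n) v)
  obtain ⟨B, hB⟩ := hu b
  obtain ⟨C, hC⟩ := hu c
  have key : M * (C : Matrix n n R) = B * Matrix.diagonal a := by
    ext i j
    rw [Matrix.mul_diagonal, hB, hC]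
    have := congrFun (hc j) i
    simpa [Module.Basis.toMatrix_apply, Matrix.mul_apply, Matrix.mulVec, dotProduct,
      mul_comm] using this
  have hD : Matrix.diagonal a = (B⁻¹ : (Matrix n n R)ˣ) * M * (C : Matrix n n R) := by
    rw [mul_assoc, key, Units.inv_mul_cancel_left]
  have hM' : M = B * Matrix.diagonal a * (C⁻¹ : (Matrix n n R)ˣ) := by
    rw [← key, Units.mul_inv_cancel_right]
  have ht : ∀ U : (Matrix n n R)ˣ, IsUnit (U : Matrix n n R).transpose := fun U =>
    Matrix.isUnit_transpose _ |>.2 U.isUnit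
  refine ⟨Matrix.transpose ((C⁻¹ : (Matrix n n R)ˣ) : Matrix n n R) * (B⁻¹ : (Matrix n n R)ˣ),
    C * Matrix.transpose (B : Matrix n n R), (ht _).mul (Units.isUnit _),
    (Units.isUnit _).mul (ht _), ?_⟩
  conv_lhs => rw [hM']
  rw [Matrix.transpose_mul, Matrix.transpose_mul, Matrix.diagonal_transpose, hD]
  simp only [mul_assoc]

/-- If `I ⊔ (b) = (d)` and `b = d c`, the homomorphisms are the maps `x ↦ r x c`, and `r` matters
only modulo `d`. -/
theorem nonempty_quotientHom_equiv (I : Ideal R) {b : R} (hb : b ≠ 0) :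
    Nonempty (((R ⧸ I) →ₗ[R] (R ⧸ Ideal.span {b})) ≃ₗ[R] R ⧸ (I ⊔ Ideal.span {b})) := by
  obtain ⟨d, hd⟩ := IsPrincipalIdealRing.principal (I ⊔ Ideal.span {b})
  rw [Ideal.submodule_span_eq] at hd
  have hbd : b ∈ Ideal.span {d} := hd ▸ le_sup_right (a := I) (Ideal.mem_span_singleton_self b)
  obtain ⟨c, rfl⟩ := Ideal.mem_span_singleton.1 hbd
  have hI : ∀ x ∈ I, x ∈ Ideal.span {d} := fun x hx => hd ▸ le_sup_left (a := I) hx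
  have hc : c ≠ 0 := right_ne_zero_of_mul hb
  have hd0 : d ≠ 0 := left_ne_zero_of_mul hb
  let f : R →ₗ[R] ((R ⧸ I) →ₗ[R] (R ⧸ Ideal.span {d * c})) :=
    LinearMap.toSpanSingleton R _ (I.liftQ (LinearMap.toSpanSingleton R _
      (Ideal.Quotient.mk (Ideal.span {d * c}) c)) fun x hx => by
        obtain ⟨y, rfl⟩ := Ideal.mem_span_singleton.1 (hI x hx)
        rw [LinearMap.mem_ker, LinearMap.toSpanSingleton_apply, Algebra.smul_def,
          Ideal.Quotient.algebraMap_eq, ← map_mul, Ideal.Quotient.eq_zero_iff_mem,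
          Ideal.mem_span_singleton]
        exact ⟨y, by ring⟩)
  have hf : ∀ r x, f r (Ideal.Quotient.mk I x) = Ideal.Quotient.mk _ (r * (x * c)) := fun r x => by
    change r • x • Ideal.Quotient.mk _ c = _
    rw [Algebra.smul_def, Algebra.smul_def, Ideal.Quotient.algebraMap_eq, ← map_mul, ← map_mul]
  have hker : f.ker = I ⊔ Ideal.span {d * c} := by
    rw [hd]
    ext r
    have : f r = 0 ↔ Ideal.Quotient.mk (Ideal.span {d * c}) (r * c) = 0 := by
      constructor
      · intro h
        have := hf r 1
        rwa [h, LinearMap.zero_apply, one_mul, eq_comm] at this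
      · intro h
        refine LinearMap.ext fun x => ?_
        obtain ⟨x, rfl⟩ := Ideal.Quotient.mk_surjective x
        rw [hf, mul_left_comm, map_mul, h, mul_zero, LinearMap.zero_apply]
    rw [LinearMap.mem_ker, this, Ideal.Quotient.eq_zero_iff_mem, Ideal.mem_span_singleton,
      Ideal.mem_span_singleton, mul_dvd_mul_iff_right hc]
  have hsurj : Function.Surjective f := by
    intro g
    obtain ⟨y, hy⟩ := Ideal.Quotient.mk_surjective (g (Ideal.Quotient.mk I 1))
    have hy' : ∀ x, g (Ideal.Quotient.mk I x) = Ideal.Quotient.mk _ (x * y) := fun x => by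
      have : Ideal.Quotient.mk I x = x • Ideal.Quotient.mk I 1 := by
        rw [Algebra.smul_def, Ideal.Quotient.algebraMap_eq, map_one, mul_one]
      rw [this, map_smul, ← hy, Algebra.smul_def, Ideal.Quotient.algebraMap_eq, ← map_mul]
    have hdy : d * c ∣ d * y := by
      have h1 : (I ⊔ Ideal.span {d * c}) ≤
          Submodule.comap (LinearMap.toSpanSingleton R R y) (Ideal.span {d * c}) := by
        refine sup_le (fun x hx => ?_) fun x hx => ?_
        · change x * y ∈ Ideal.span {d * c}
          rw [← Ideal.Quotient.eq_zero_iff_mem, ← hy', Ideal.Quotient.eq_zero_iff_mem.2 hx,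
            map_zero]
        · exact Ideal.mul_mem_right y _ hx
      rw [hd] at h1
      exact Ideal.mem_span_singleton.1 (h1 (Ideal.mem_span_singleton_self d))
    obtain ⟨z, rfl⟩ := (mul_dvd_mul_iff_left hd0).1 hdy
    refine ⟨z, LinearMap.ext fun x => ?_⟩
    obtain ⟨x, rfl⟩ := Ideal.Quotient.mk_surjective x
    rw [hf, hy']
    congr 1
    ring
  exact ⟨((Submodule.quotEquivOfEq _ _ hker).symm.trans (f.quotKerEquivOfSurjective hsurj)).symm⟩

/-- The ideal is `(p ^ e)` for some `e ≤ s`. The length `e` is written as a count of exponents `t`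
so that it can be summed over cyclic summands. -/
theorem length_quotient_sup_pow (J : Ideal R) {p : R} (hp : Prime p) (s : ℕ) :
    Module.length R (R ⧸ (J ⊔ Ideal.span {p ^ s})) =
      ∑ t ∈ Finset.Icc 1 s, open Classical in if J ≤ Ideal.span {p ^ t} then 1 else 0 := by
  classical
  obtain ⟨d, hd⟩ := IsPrincipalIdealRing.principal (J ⊔ Ideal.span {p ^ s})
  rw [Ideal.submodule_span_eq] at hd
  have h1 : d ∣ p ^ s := Ideal.mem_span_singleton.1
    (hd ▸ le_sup_right (a := J) (Ideal.mem_span_singleton_self _))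
  obtain ⟨e, he, hde⟩ := (dvd_prime_pow hp s).1 h1
  rw [Ideal.span_singleton_eq_span_singleton.2 hde] at hd
  have h2 : ∀ t ∈ Finset.Icc 1 s, (J ≤ Ideal.span {p ^ t} ↔ t ≤ e) := fun t ht => by
    have h3 : J ≤ Ideal.span {p ^ t} ↔ J ⊔ Ideal.span {p ^ s} ≤ Ideal.span {p ^ t} := by
      rw [sup_le_iff, Ideal.span_singleton_le_span_singleton]
      exact ⟨fun h => ⟨h, pow_dvd_pow p (Finset.mem_Icc.1 ht).2⟩, And.left⟩
    rw [h3, hd, Ideal.span_singleton_le_span_singleton, pow_dvd_pow_iff hp.ne_zero hp.not_isUnit]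
  rw [hd]
  have h4 := Ring.ord_pow (mem_nonZeroDivisors_of_ne_zero hp.ne_zero) e
  rw [Ring.ord_of_irreducible hp.irreducible, Ring.ord] at h4
  rw [h4, Finset.sum_congr rfl fun t ht => if_congr (h2 t ht) rfl rfl, ← Finset.sum_filter,
    Finset.sum_const, nsmul_one, nsmul_one]
  congr 1
  rw [show (Finset.Icc 1 s).filter (fun t => t ≤ e) = Finset.Icc 1 e by ext; simp; omega]
  simp

theorem length_hom_pi {ι : Type*} [Fintype ι] (Q : ι → Ideal R) {p : R} (hp : Prime p) (s : ℕ) :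
    Module.length R ((∀ i, R ⧸ Q i) →ₗ[R] (R ⧸ Ideal.span {p ^ s})) =
      ((∑ t ∈ Finset.Icc 1 s, Nat.card {i // Q i ≤ Ideal.span {p ^ t}} : ℕ) : ℕ∞) := by
  classical
  have e := (LinearMap.lsum R (fun i => R ⧸ Q i) R (M := R ⧸ Ideal.span {p ^ s})).symm
  rw [e.length_eq, Module.length_pi_of_fintype]
  simp only [(nonempty_quotientHom_equiv (Q _) (pow_ne_zero s hp.ne_zero)).some.length_eq,
    length_quotient_sup_pow _ hp]
  rw [Finset.sum_comm, Nat.cast_sum]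
  refine Finset.sum_congr rfl fun t _ => ?_
  rw [Nat.card_eq_fintype_card, Fintype.card_subtype, Finset.sum_boole]

theorem eq_of_sum_Icc_eq {f g : ℕ → ℕ}
    (h : ∀ s, ∑ t ∈ Finset.Icc 1 s, f t = ∑ t ∈ Finset.Icc 1 s, g t) {t : ℕ} (ht : t ≠ 0) :
    f t = g t := by
  obtain ⟨s, rfl⟩ := Nat.exists_eq_succ_of_ne_zero ht
  have h1 := h s
  have h2 := h (s + 1)
  rw [Finset.sum_Icc_succ_top (by omega), Finset.sum_Icc_succ_top (by omega), h1] at h2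
  exact add_left_cancel h2

theorem card_le_span_eq_of_length_hom_eq {ι₁ ι₂ : Type*} [Fintype ι₁] [Fintype ι₂]
    {Q₁ : ι₁ → Ideal R} {Q₂ : ι₂ → Ideal R} {p : R} (hp : Prime p)
    (h : ∀ s, Module.length R ((∀ i, R ⧸ Q₁ i) →ₗ[R] (R ⧸ Ideal.span {p ^ s})) =
      Module.length R ((∀ i, R ⧸ Q₂ i) →ₗ[R] (R ⧸ Ideal.span {p ^ s}))) {t : ℕ} (ht : t ≠ 0) :
    Nat.card {i // Q₁ i ≤ Ideal.span {p ^ t}} = Nat.card {i // Q₂ i ≤ Ideal.span {p ^ t}} :=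
  eq_of_sum_Icc_eq (fun s => Nat.cast_injective
    ((length_hom_pi Q₁ hp s).symm.trans ((h s).trans (length_hom_pi Q₂ hp s)))) ht

end principal

section uniqueness

universe u

variable {R : Type u} [CommRing R] [IsDomain R] [IsPrincipalIdealRing R]

/-- Summands with exponent zero are trivial and are dropped, so that summands can later be matched
by their ideals. -/
theorem exists_primary_decomposition (N : Type u) [AddCommGroup N] [Module R N] [Module.Finite R N]
    (hN : Module.IsTorsion R N) :
    ∃ (ι : Type u) (_ : Fintype ι) (p : ι → R) (e : ι → ℕ), (∀ i, Prime (p i)) ∧ (∀ i, e i ≠ 0) ∧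
      Nonempty (N ≃ₗ[R] ∀ i, R ⧸ Ideal.span {p i ^ e i}) := by
  classical
  obtain ⟨ι, _, p, hp, e, ⟨f⟩⟩ := Module.equiv_directSum_of_isTorsion hN
  refine ⟨{i // e i ≠ 0}, inferInstance, fun i => p i, fun i => e i, fun i => (hp i).prime,
    fun i => i.2, ⟨(f.trans (DirectSum.linearEquivFunOnFintype R ι _)).trans
      (LinearEquiv.ofBijective
        (LinearMap.pi fun i : {i // e i ≠ 0} => LinearMap.proj i.1) ⟨?_, fun y => ?_⟩)⟩⟩
  · rw [injective_iff_map_eq_zero]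
    intro x hx
    ext i
    by_cases hi : e i = 0
    · obtain ⟨y, hy⟩ := Ideal.Quotient.mk_surjective (x i)
      rw [Pi.zero_apply, ← hy, Ideal.Quotient.eq_zero_iff_mem, Ideal.mem_span_singleton, hi,
        pow_zero]
      exact one_dvd y
    · exact congrFun hx ⟨i, hi⟩
  · refine ⟨fun i => if h : e i = 0 then 0 else y ⟨i, h⟩, ?_⟩
    ext i
    exact dif_neg i.2

/-- Increments of the lengths in `s` count the summands whose ideal lies in `(p ^ s)`, and
increments of those counts give the number of summands `R ⧸ (p ^ s)`. Summands with equal ideals are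
then paired. -/
theorem nonempty_equiv_of_length_hom_eq {N₁ N₂ : Type u} [AddCommGroup N₁] [Module R N₁]
    [Module.Finite R N₁] [AddCommGroup N₂] [Module R N₂] [Module.Finite R N₂]
    (hN₁ : Module.IsTorsion R N₁) (hN₂ : Module.IsTorsion R N₂)
    (h : ∀ (p : R) (s : ℕ), Prime p → Module.length R (N₁ →ₗ[R] (R ⧸ Ideal.span {p ^ s})) =
      Module.length R (N₂ →ₗ[R] (R ⧸ Ideal.span {p ^ s}))) : Nonempty (N₁ ≃ₗ[R] N₂) := by
  classical
  obtain ⟨ι₁, _, p₁, e₁, hp₁, he₁, ⟨f₁⟩⟩ := exists_primary_decomposition N₁ hN₁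
  obtain ⟨ι₂, _, p₂, e₂, hp₂, he₂, ⟨f₂⟩⟩ := exists_primary_decomposition N₂ hN₂
  have key : ∀ {ι : Type u} [Fintype ι] {q : ι → R} {e : ι → ℕ} (hq : ∀ i, Prime (q i)) {p : R}
      (hp : Prime p) {s : ℕ} (hs : s ≠ 0),
      Nat.card {i // Ideal.span {q i ^ e i} = Ideal.span {p ^ s}} +
        Nat.card {i // Ideal.span {q i ^ e i} ≤ Ideal.span {p ^ (s + 1)}} =
          Nat.card {i // Ideal.span {q i ^ e i} ≤ Ideal.span {p ^ s}} := by
    intro ι _ q e hq p hp s hs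
    have h1 : ∀ i, Ideal.span {q i ^ e i} = Ideal.span {p ^ s} ↔
        p ^ s ∣ q i ^ e i ∧ ¬ p ^ (s + 1) ∣ q i ^ e i := fun i => by
      rw [Ideal.span_singleton_eq_span_singleton]
      constructor
      · intro ha
        refine ⟨ha.symm.dvd, fun hd => ?_⟩
        have := (pow_dvd_pow_iff hp.ne_zero hp.not_isUnit).1 (hd.trans ha.dvd)
        omega
      · rintro ⟨ha, hb⟩
        have hpq : Associated p (q i) :=
          hp.associated_of_dvd (hq i) (hp.dvd_of_dvd_pow ((dvd_pow_self p hs).trans ha))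
        rw [(hpq.pow_pow (n := s)).dvd_iff_dvd_left,
          pow_dvd_pow_iff (hq i).ne_zero (hq i).not_isUnit] at ha
        rw [(hpq.pow_pow (n := s + 1)).dvd_iff_dvd_left,
          pow_dvd_pow_iff (hq i).ne_zero (hq i).not_isUnit] at hb
        rw [show e i = s by omega]
        exact hpq.symm.pow_pow
    simp only [Ideal.span_singleton_le_span_singleton, h1, Nat.card_eq_fintype_card]
    rw [← Fintype.card_subtype_or_disjoint]
    · refine Fintype.card_congr (Equiv.subtypeEquivRight fun i => ?_)
      constructor
      · rintro (h | h)
        exacts [h.1, (pow_dvd_pow p s.le_succ).trans h]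
      · intro h
        by_cases h' : p ^ (s + 1) ∣ q i ^ e i
        exacts [Or.inr h', Or.inl ⟨h, h'⟩]
    · rw [Pi.disjoint_iff]
      intro i
      rw [Prop.disjoint_iff]
      tauto
  have hcard : ∀ {p : R} {s : ℕ}, Prime p → s ≠ 0 →
      Nat.card {i // Ideal.span {p₁ i ^ e₁ i} = Ideal.span {p ^ s}} =
        Nat.card {i // Ideal.span {p₂ i ^ e₂ i} = Ideal.span {p ^ s}} := by
    intro p s hp hs
    have h' : ∀ s, _ := fun s =>
      (f₁.congrLeft (R ⧸ Ideal.span {p ^ s}) R).length_eq.symm.trans ((h p s hp).trans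
        (f₂.congrLeft (R ⧸ Ideal.span {p ^ s}) R).length_eq)
    have h1 := key hp₁ hp hs (e := e₁)
    have h2 := key hp₂ hp hs (e := e₂)
    rw [card_le_span_eq_of_length_hom_eq hp h' hs, card_le_span_eq_of_length_hom_eq hp h'
      s.succ_ne_zero] at h1
    exact add_right_cancel (h1.trans h2.symm)
  have hfib : ∀ I : Ideal R, Nonempty ({i // Ideal.span {p₁ i ^ e₁ i} = I} ≃
      {i // Ideal.span {p₂ i ^ e₂ i} = I}) := fun I => by
    have : Nat.card {i // Ideal.span {p₁ i ^ e₁ i} = I} =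
        Nat.card {i // Ideal.span {p₂ i ^ e₂ i} = I} := by
      by_cases h1 : Nonempty {i // Ideal.span {p₁ i ^ e₁ i} = I}
      · obtain ⟨i, rfl⟩ := h1
        exact hcard (hp₁ i) (he₁ i)
      by_cases h2 : Nonempty {i // Ideal.span {p₂ i ^ e₂ i} = I}
      · obtain ⟨i, rfl⟩ := h2
        exact hcard (hp₂ i) (he₂ i)
      rw [not_nonempty_iff] at h1 h2
      rw [Nat.card_of_isEmpty, Nat.card_of_isEmpty]
    exact ⟨Classical.choice (Finite.card_eq.1 this)⟩
  let g : ι₁ ≃ ι₂ := Equiv.ofFiberEquiv fun I => (hfib I).some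
  have hg : ∀ i, Ideal.span {p₁ i ^ e₁ i} = Ideal.span {p₂ (g i) ^ e₂ (g i)} := fun i =>
    (Equiv.ofFiberEquiv_map (fun I => (hfib I).some) i).symm
  exact ⟨f₁.trans ((LinearEquiv.piCongrRight fun i => Submodule.quotEquivOfEq _ _ (hg i)).trans
    ((LinearEquiv.piCongrLeft R (fun i => R ⧸ Ideal.span {p₂ i ^ e₂ i}) g).trans f₂.symm))⟩

/-- A homomorphism into a product is a family of homomorphisms. -/
def homPiEquiv (N : Type*) [AddCommGroup N] [Module R N] {ι : Type*} (Z : ι → Type*)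
    [∀ i, AddCommGroup (Z i)] [∀ i, Module R (Z i)] :
    (N →ₗ[R] ∀ i, Z i) ≃ₗ[R] ∀ i, N →ₗ[R] Z i where
  toFun g i := LinearMap.proj i ∘ₗ g
  invFun := LinearMap.pi
  map_add' _ _ := rfl
  map_smul' _ _ := rfl
  left_inv _ := rfl
  right_inv _ := rfl

/-- `End N` is the sum of the `R ⧸ (q_i, q_j)` over all pairs. Such an ideal lies in `(p ^ t)`
exactly if both members of the pair do, which produces the square. -/
theorem length_hom_end {N : Type u} [AddCommGroup N] [Module R N] {ι : Type u} [Fintype ι]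
    {q : ι → R} (hq : ∀ i, q i ≠ 0) (f : N ≃ₗ[R] ∀ i, R ⧸ Ideal.span {q i}) {p : R} (hp : Prime p)
    (s : ℕ) :
    Module.length R ((N × N × (N →ₗ[R] N)) →ₗ[R] (R ⧸ Ideal.span {p ^ s})) =
      ((∑ t ∈ Finset.Icc 1 s, (2 * Nat.card {i // Ideal.span {q i} ≤ Ideal.span {p ^ t}} +
        Nat.card {i // Ideal.span {q i} ≤ Ideal.span {p ^ t}} ^ 2) : ℕ) : ℕ∞) := by
  classical
  have e : (N →ₗ[R] N) ≃ₗ[R] ∀ i : (_ : ι) × ι, R ⧸ (Ideal.span {q i.1} ⊔ Ideal.span {q i.2}) := by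
    refine (f.arrowCongr f).trans ((LinearMap.lsum R (fun i => R ⧸ Ideal.span {q i}) R).symm.trans
      ((LinearEquiv.piCongrRight fun i => ?_).trans (LinearEquiv.piCurry R
        (fun i j => R ⧸ (Ideal.span {q i} ⊔ Ideal.span {q j}))).symm))
    exact (homPiEquiv _ _).trans
      (LinearEquiv.piCongrRight fun j => (nonempty_quotientHom_equiv _ (hq j)).some)
  have h2 := ((LinearMap.coprodEquiv R).symm : ((N × N × (N →ₗ[R] N)) →ₗ[R]
    (R ⧸ Ideal.span {p ^ s})) ≃ₗ[R] _).length_eq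
  have h3 := ((LinearMap.coprodEquiv R).symm : ((N × (N →ₗ[R] N)) →ₗ[R]
    (R ⧸ Ideal.span {p ^ s})) ≃ₗ[R] _).length_eq
  rw [h2, Module.length_prod, h3, Module.length_prod,
    (f.congrLeft (R ⧸ Ideal.span {p ^ s}) R).length_eq,
    (e.congrLeft (R ⧸ Ideal.span {p ^ s}) R).length_eq, length_hom_pi _ hp, length_hom_pi _ hp,
    ← Nat.cast_add, ← Nat.cast_add, ← Finset.sum_add_distrib, ← Finset.sum_add_distrib]
  congr 1
  refine Finset.sum_congr rfl fun t _ => ?_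
  rw [← add_assoc, ← two_mul, sq, ← Nat.card_prod]
  congr 1
  exact Nat.card_congr (((Equiv.sigmaEquivProd ι ι).subtypeEquiv fun i => sup_le_iff).trans
    (Equiv.subtypeProdEquivProd (p := fun i => Ideal.span {q i} ≤ Ideal.span {p ^ t})
      (q := fun i => Ideal.span {q i} ≤ Ideal.span {p ^ t})))

/-- A finitely generated torsion module `N` is determined by `N ⊕ N ⊕ End N`. -/
theorem nonempty_equiv_of_prod_end_equiv {N₁ N₂ : Type u} [AddCommGroup N₁] [Module R N₁]
    [Module.Finite R N₁] [AddCommGroup N₂] [Module R N₂] [Module.Finite R N₂]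
    (hN₁ : Module.IsTorsion R N₁) (hN₂ : Module.IsTorsion R N₂)
    (g : (N₁ × N₁ × (N₁ →ₗ[R] N₁)) ≃ₗ[R] (N₂ × N₂ × (N₂ →ₗ[R] N₂))) : Nonempty (N₁ ≃ₗ[R] N₂) := by
  obtain ⟨ι₁, _, p₁, e₁, hp₁, -, ⟨f₁⟩⟩ := exists_primary_decomposition N₁ hN₁
  obtain ⟨ι₂, _, p₂, e₂, hp₂, -, ⟨f₂⟩⟩ := exists_primary_decomposition N₂ hN₂
  refine nonempty_equiv_of_length_hom_eq hN₁ hN₂ fun p s hp => ?_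
  rw [(f₁.congrLeft (R ⧸ Ideal.span {p ^ s}) R).length_eq,
    (f₂.congrLeft (R ⧸ Ideal.span {p ^ s}) R).length_eq, length_hom_pi _ hp, length_hom_pi _ hp]
  congr 1
  refine Finset.sum_congr rfl fun t ht => ?_
  have h := eq_of_sum_Icc_eq (fun s => Nat.cast_injective
    ((length_hom_end (fun i => pow_ne_zero _ (hp₁ i).ne_zero) f₁ hp s).symm.trans
      ((g.congrLeft (R ⧸ Ideal.span {p ^ s}) R).length_eq.trans
        (length_hom_end (fun i => pow_ne_zero _ (hp₂ i).ne_zero) f₂ hp s))))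
    (t := t) (Nat.one_le_iff_ne_zero.1 (Finset.mem_Icc.1 ht).1)
  -- `2 a + a ^ 2` determines `a` by completing the square.
  have h' : (Nat.card {i // Ideal.span {p₁ i ^ e₁ i} ≤ Ideal.span {p ^ t}} + 1) ^ 2 =
      (Nat.card {i // Ideal.span {p₂ i ^ e₂ i} ≤ Ideal.span {p ^ t}} + 1) ^ 2 := by
    linarith
  exact Nat.succ_injective (Nat.pow_left_injective (n := 2) (by norm_num) h')

end uniqueness

/-! ### Matrices acting on vectors over a module. -/

section matrixAction

variable {R : Type*} [CommRing R] {ι : Type*} [Fintype ι] [DecidableEq ι] (Z : Type*)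
  [AddCommGroup Z] [Module R Z]

/-- The action of a matrix on vectors with entries in a module. -/
def Matrix.act (M : Matrix ι ι R) : (ι → Z) →ₗ[R] (ι → Z) :=
  LinearMap.pi fun i => ∑ j, M i j • LinearMap.proj j

theorem Matrix.act_apply (M : Matrix ι ι R) (f : ι → Z) (i : ι) :
    M.act Z f i = ∑ j, M i j • f j := by
  simp [Matrix.act]

theorem Matrix.act_mul (M N : Matrix ι ι R) : (M * N).act Z = M.act Z ∘ₗ N.act Z := by
  refine LinearMap.ext fun f => funext fun i => ?_
  simp only [Matrix.act_apply, LinearMap.comp_apply, Matrix.mul_apply, Finset.sum_smul,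
    Finset.smul_sum, mul_smul]
  exact Finset.sum_comm

theorem Matrix.act_one : (1 : Matrix ι ι R).act Z = LinearMap.id := by
  refine LinearMap.ext fun f => funext fun i => ?_
  simp [Matrix.act_apply, Matrix.one_apply]

/-- The action of an invertible matrix. -/
def Matrix.actEquiv (M : (Matrix ι ι R)ˣ) : (ι → Z) ≃ₗ[R] (ι → Z) :=
  LinearEquiv.ofLinearMap ((M : Matrix ι ι R).act Z) (((M⁻¹ : (Matrix ι ι R)ˣ) : Matrix ι ι R).act Z)
    (by rw [← Matrix.act_mul, Units.mul_inv, Matrix.act_one])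
    (by rw [← Matrix.act_mul, Units.inv_mul, Matrix.act_one])

theorem Matrix.nonempty_ker_act_transpose_equiv [IsDomain R] [IsPrincipalIdealRing R]
    (M : Matrix ι ι R) (hM : M.det ≠ 0) :
    Nonempty ((M.transpose.act Z).ker ≃ₗ[R] (M.act Z).ker) := by
  obtain ⟨_, _, ⟨P, rfl⟩, ⟨Q, rfl⟩, h⟩ := M.exists_transpose_eq hM
  refine ⟨(LinearEquiv.ofEq _ _ ?_).trans ((Matrix.actEquiv Z Q).ofSubmodule' (M.act Z).ker)⟩
  rw [h, Matrix.act_mul, Matrix.act_mul]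
  ext f
  rw [LinearMap.mem_ker, Submodule.mem_comap, LinearMap.mem_ker]
  exact (Matrix.actEquiv Z P).map_eq_zero_iff

end matrixAction

/-! ### Strand colourings and dual dependencies as kernels. -/

namespace KnotDiagram

variable {n : ℕ} [NeZero n] (D : KnotDiagram n) {S : Type*} [CommRing S] (m : Sˣ)
  (Z : Type*) [AddCommGroup Z] [Module S Z]

theorem mem_ker_act_presMatrix (f : Fin n → Z) :
    f ∈ ((D.presMatrix m).act Z).ker ↔ f 0 = 0 ∧
      ∀ α, f (D.r α) + (m : S) • f (D.l α) - (1 + (m : S)) • f (D.o α) = 0 := by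
  have h0 : (D.presMatrix m).act Z f 0 = f 0 := by
    simp [Matrix.act_apply, presMatrix, Pi.single_apply]
  have h1 : ∀ α, α ≠ 0 → (D.presMatrix m).act Z f α = ∑ i, D.relVec m α i • f i := fun α hα => by
    simp [Matrix.act_apply, presMatrix, hα]
  rw [LinearMap.mem_ker]
  constructor
  · intro h
    have h2 : f 0 = 0 := h0.symm.trans (congrFun h 0)
    have h3 : ∀ α, α ≠ 0 → ∑ i, D.relVec m α i • f i = 0 := fun α hα =>
      (h1 α hα).symm.trans (congrFun h α)
    refine ⟨h2, fun α => ?_⟩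
    rw [← sum_relVec_smul]
    by_cases hα : α = 0
    · have h4 := D.sum_weight_smul m f
      rw [← Finset.add_sum_erase _ _ (Finset.mem_univ (0 : Fin n)),
        Finset.sum_eq_zero (s := Finset.univ.erase 0) fun β hβ => by
          rw [h3 β (Finset.ne_of_mem_erase hβ), smul_zero], add_zero] at h4
      rw [hα]
      exact (smul_eq_zero_iff_eq (D.weight m 0)).1 h4
    · exact h3 α hα
  · rintro ⟨h2, h3⟩
    funext α
    by_cases hα : α = 0
    · rw [hα, h0, h2, Pi.zero_apply]
    · rw [h1 α hα, sum_relVec_smul, h3, Pi.zero_apply]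

/-- Homomorphisms from the Alexander module are colourings of the strands. -/
noncomputable def homEquiv : (D.AlexModule m →ₗ[S] Z) ≃ₗ[S] ((D.presMatrix m).act Z).ker where
  toFun g := ⟨fun i => g (D.gen m i), by
    rw [mem_ker_act_presMatrix, gen_zero, map_zero]
    refine ⟨rfl, fun α => ?_⟩
    rw [← map_smul, ← map_smul, ← map_add, ← map_sub, gen_relation, map_zero]⟩
  map_add' _ _ := rfl
  map_smul' _ _ := rfl
  invFun f := D.liftAlex f.1 ((D.mem_ker_act_presMatrix m Z f.1).1 f.2).1
    ((D.mem_ker_act_presMatrix m Z f.1).1 f.2).2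
  left_inv g := D.alex_hom_ext m fun i => D.liftAlex_gen m _ _ _ i
  right_inv f := Subtype.ext (funext fun i => D.liftAlex_gen m _ _ _ i)

theorem mem_ker_act_transpose (z : Fin n → Z) :
    z ∈ ((D.presMatrix m).transpose.act Z).ker ↔ z 0 = 0 ∧ z ∈ D.relKer m Z := by
  have key : ∀ j, (D.presMatrix m).transpose.act Z z j =
      (∑ α, D.relVec m α j • z α) - D.relVec m 0 j • z 0 + (Pi.single 0 1 : Fin n → S) j • z 0 := by
    intro j
    rw [Matrix.act_apply, ← Finset.add_sum_erase _ _ (Finset.mem_univ (0 : Fin n)),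
      ← Finset.add_sum_erase (a := 0) _ (fun α => D.relVec m α j • z α) (Finset.mem_univ _),
      add_sub_cancel_left, add_comm]
    congr 1
    refine Finset.sum_congr rfl fun α hα => ?_
    simp [presMatrix, Finset.ne_of_mem_erase hα]
  rw [LinearMap.mem_ker, mem_relKer]
  constructor
  · intro h
    -- In the sum of all `n` equations the Wirtinger relations drop out, since their coordinates sum
    -- to zero, and `z 0` is left.
    have h0 : z 0 = 0 := by
      have h1 : ∑ j, (D.presMatrix m).transpose.act Z z j = 0 := by simp [h]
      simp only [key, Finset.sum_add_distrib, Finset.sum_sub_distrib, ← Finset.sum_smul] at h1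
      rw [Finset.sum_comm] at h1
      simpa [← Finset.sum_smul, sum_coords_relVec] using h1
    refine ⟨h0, fun j => ?_⟩
    have := congrFun h j
    rwa [key, h0, smul_zero, smul_zero, sub_zero, add_zero] at this
  · rintro ⟨h0, h⟩
    funext j
    rw [key, h, h0, smul_zero, smul_zero, sub_zero, add_zero, Pi.zero_apply]

theorem weight_smul_mem_relKer (z : Z) : (fun α => (D.weight m α : S) • z) ∈ D.relKer m Z := by
  intro j
  simp only [smul_smul, ← Finset.sum_smul]
  have := congrFun (D.sum_weight_smul_relVec m) j
  simp only [Finset.sum_apply, Pi.smul_apply, smul_eq_mul, Pi.zero_apply] at this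
  rw [Finset.sum_congr rfl fun α _ => mul_comm _ _, this, zero_smul]

/-- the multiples of the standard relation -/
noncomputable def weightHom : Z →ₗ[S] D.relKer m Z where
  toFun z := ⟨fun α => (D.weight m α : S) • z, D.weight_smul_mem_relKer m Z z⟩
  map_add' _ _ := Subtype.ext (funext fun _ => smul_add _ _ _)
  map_smul' _ _ := Subtype.ext (funext fun _ => smul_comm _ _ _)

theorem weightHom_apply (z : Z) (α : Fin n) :
    (D.weightHom m Z z : Fin n → Z) α = (D.weight m α : S) • z := rfl

/-- A relation is the sum of a multiple of the standard one and a relation in which crossing `0`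
does not occur. -/
noncomputable def relKerEquiv :
    D.relKer m Z ≃ₗ[S] Z × ((D.presMatrix m).transpose.act Z).ker :=
  LinearEquiv.ofLinearMap
    ((((D.weight m 0)⁻¹ : Sˣ) : S) • LinearMap.proj (φ := fun _ : Fin n => Z) 0 ∘ₗ
        (D.relKer m Z).subtype |>.prod
      (LinearMap.codRestrict _ ((D.relKer m Z).subtype - LinearMap.pi fun α =>
        ((D.weight m α * (D.weight m 0)⁻¹ : Sˣ) : S) •
          LinearMap.proj (φ := fun _ : Fin n => Z) 0 ∘ₗ (D.relKer m Z).subtype) fun z => by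
        rw [mem_ker_act_transpose]
        refine ⟨by simp, Submodule.sub_mem _ z.2 ?_⟩
        convert D.weight_smul_mem_relKer m Z ((((D.weight m 0)⁻¹ : Sˣ) : S) • z.1 0) using 1
        ext α
        simp [mul_smul]))
    (LinearMap.coprod (D.weightHom m Z)
      (Submodule.inclusion fun z hz => ((D.mem_ker_act_transpose m Z z).1 hz).2))
    (by
      refine LinearMap.ext fun ⟨z, y⟩ => ?_
      have hy := ((D.mem_ker_act_transpose m Z y.1).1 y.2).1
      refine Prod.ext ?_ (Subtype.ext (funext fun α => ?_))
      · simp [hy, smul_smul, weightHom_apply]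
      · simp [hy, smul_smul, mul_assoc, weightHom_apply])
    (by
      refine LinearMap.ext fun z => Subtype.ext (funext fun α => ?_)
      simp [smul_smul, weightHom_apply]
      rw [mul_comm, add_sub_cancel])

end KnotDiagram

/-! ### Colourings of the regions and duality of the Alexander module. -/

namespace KnotDiagram

section dehn

variable {n : ℕ} [NeZero n] (D : KnotDiagram n) {S : Type*} [CommRing S] (m : Sˣ)
  (Z : Type*) [AddCommGroup Z] [Module S Z]

/-- the first edge of a strand -/
noncomputable def edge (i : Fin n) : Fin n × Bool :=
  ((Equiv.ofBijective _ D.strand_under_bijective).symm i, false)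

theorem strand_edge (i : Fin n) : D.strand (D.edge i) = i :=
  (Equiv.ofBijective _ D.strand_under_bijective).apply_symm_apply i

/-- the weighted difference of the values on the two sides of an edge -/
noncomputable def edgeDiff (x : Fin n × Bool) : (D.Face → Z) →ₗ[S] Z :=
  (((-m) ^ (-D.index x) : Sˣ) : S) •
    (LinearMap.proj (R := S) (φ := fun _ => Z) (D.left x) - LinearMap.proj (R := S) (φ := fun _ => Z) (D.right x))

theorem edgeDiff_apply (x : Fin n × Bool) (Φ : D.Face → Z) :
    D.edgeDiff m Z x Φ = (((-m) ^ (-D.index x) : Sˣ) : S) • (Φ (D.left x) - Φ (D.right x)) := rfl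

/-- Colourings of the faces that induce a colouring of the strands, and vanish on both sides of
the first edge of the strand `0`. -/
noncomputable def faceColorings : Submodule S (D.Face → Z) :=
  (⨅ α, (D.edgeDiff m Z (α, true) - D.edgeDiff m Z (D.ov α)).ker) ⊓
    ((LinearMap.proj (R := S) (φ := fun _ => Z) (D.left (D.edge 0))).ker ⊓
      (LinearMap.proj (R := S) (φ := fun _ => Z) (D.right (D.edge 0))).ker)

theorem mem_faceColorings {Φ : D.Face → Z} : Φ ∈ D.faceColorings m Z ↔
    (∀ α, D.edgeDiff m Z (α, true) Φ = D.edgeDiff m Z (D.ov α) Φ) ∧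
      Φ (D.left (D.edge 0)) = 0 ∧ Φ (D.right (D.edge 0)) = 0 := by
  simp [faceColorings, sub_eq_zero]

variable {m Z} in
theorem edgeDiff_edge_strand {Φ : D.Face → Z} (hΦ : Φ ∈ D.faceColorings m Z) (x : Fin n × Bool) :
    D.edgeDiff m Z (D.edge (D.strand x)) Φ = D.edgeDiff m Z x Φ :=
  D.eq_of_strand_eq (u := fun x => D.edgeDiff m Z x Φ) ((D.mem_faceColorings m Z).1 hΦ).1
    (D.strand_edge _)

/-- the colouring of the strands that is induced by a colouring of the faces -/
noncomputable def strandColoring : D.faceColorings m Z →ₗ[S] ((D.presMatrix m).act Z).ker :=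
  LinearMap.codRestrict _ ((LinearMap.pi fun i => D.edgeDiff m Z (D.edge i)) ∘ₗ
    (D.faceColorings m Z).subtype) fun ⟨Φ, hΦ⟩ => by
      rw [mem_ker_act_presMatrix]
      refine ⟨?_, fun α => ?_⟩
      · have := ((D.mem_faceColorings m Z).1 hΦ).2
        simp [edgeDiff_apply, this.1, this.2]
      · rw [← sum_relVec_smul, ← smul_eq_zero_iff_eq (D.weight m α), Units.smul_def,
          weight_smul_relVec]
        have h : ∀ x, (((-m) ^ D.index x : Sˣ) : S) •
            D.edgeDiff m Z (D.edge (D.strand x)) Φ = Φ (D.left x) - Φ (D.right x) := fun x => by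
          rw [D.edgeDiff_edge_strand hΦ, edgeDiff_apply, smul_smul, ← Units.val_mul, ← zpow_add,
            add_neg_cancel, zpow_zero, Units.val_one, one_smul]
        simp only [LinearMap.comp_apply, LinearMap.pi_apply, Submodule.subtype_apply, h]
        rw [sub_eq_zero]
        exact D.difference_in_eq_out Φ α

/-- A strand colouring, weighted by powers of `-m`, is a flow on the edges and so a difference of
values on the faces. This step needs `Z` to be a vector space over `k`. Subtracting a constant
normalizes the base faces. -/
theorem strandColoring_surjective (k : Type*) [Field k] [Algebra k S] :
    Function.Surjective (D.strandColoring m Z) := by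
  rintro ⟨f, hf⟩
  rw [mem_ker_act_presMatrix] at hf
  let := Module.compHom Z (algebraMap k S)
  obtain ⟨Φ, hΦ⟩ := D.exists_face_function k D.card_face.ge
    (fun x => (((-m) ^ D.index x : Sˣ) : S) • f (D.strand x)) fun α => by
      have := D.weight_smul_relVec m α f
      rw [sum_relVec_smul, hf.2, smul_zero, eq_comm, sub_eq_zero] at this
      exact this
  have hd : ∀ x, D.edgeDiff m Z x (fun F => Φ F - Φ (D.left (D.edge 0))) = f (D.strand x) :=
    fun x => by
      rw [edgeDiff_apply, sub_sub_sub_cancel_right, hΦ, smul_smul, ← Units.val_mul, ← zpow_add,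
        neg_add_cancel, zpow_zero, Units.val_one, one_smul]
  refine ⟨⟨fun F => Φ F - Φ (D.left (D.edge 0)), (D.mem_faceColorings m Z).2
    ⟨fun α => ?_, sub_self _, ?_⟩⟩, Subtype.ext (funext fun i => ?_)⟩
  · rw [hd, hd]
    exact congrArg f (D.strand_over α)
  · have := hΦ (D.edge 0)
    rw [strand_edge, hf.1, smul_zero, sub_eq_zero] at this
    rw [this, sub_self]
  · exact (hd (D.edge i)).trans (congrArg f (D.strand_edge i))

/-- the dual difference of the values on the two sides of an edge -/
noncomputable def dualDiff (x : Fin n × Bool) : (D.Face → Z) →ₗ[S] Z :=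
  (((-m)⁻¹ : Sˣ) : S) • (LinearMap.proj (R := S) (φ := fun _ => Z) (D.left x)) -
    LinearMap.proj (R := S) (φ := fun _ => Z) (D.right x)

theorem dualDiff_apply (x : Fin n × Bool) (Φ : D.Face → Z) :
    D.dualDiff m Z x Φ = (((-m)⁻¹ : Sˣ) : S) • Φ (D.left x) - Φ (D.right x) := rfl

variable {m Z}

theorem face_relation_of_pos {Φ : D.Face → Z} (hΦ : Φ ∈ D.faceColorings m Z) {α : Fin n}
    (h : D.positive α = true) : Φ (D.left (α, true)) - Φ (D.right (α, true)) =
      (((-m)⁻¹ : Sˣ) : S) • (Φ (D.left (D.ov α)) - Φ (D.right (D.ov α))) := by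
  have := ((D.mem_faceColorings m Z).1 hΦ).1 α
  rw [edgeDiff_apply, edgeDiff_apply, D.index_over, D.index_ov_of_pos h, neg_add, zpow_add,
    Units.val_mul, mul_smul, zpow_neg_one, ← Units.smul_def, ← Units.smul_def] at this
  exact smul_left_cancel _ this

theorem face_relation_of_neg {Φ : D.Face → Z} (hΦ : Φ ∈ D.faceColorings m Z) {α : Fin n}
    (h : D.positive α = false) : Φ (D.left (D.ov α)) - Φ (D.right (D.ov α)) =
      (((-m)⁻¹ : Sˣ) : S) • (Φ (D.left (α, true)) - Φ (D.right (α, true))) := by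
  have := ((D.mem_faceColorings m Z).1 hΦ).1 α
  rw [edgeDiff_apply, edgeDiff_apply, D.index_over, D.index_un_of_neg h, neg_add, zpow_add,
    Units.val_mul, mul_smul, zpow_neg_one, ← Units.smul_def, ← Units.smul_def] at this
  exact (smul_left_cancel _ this).symm

/-- Constancy of `edgeDiff` along the overpass is one equation between the values on the four
regions at the crossing. Regrouped, it is constancy of `dualDiff` along the underpass; this is the
source of the duality. -/
theorem dualDiff_un {Φ : D.Face → Z} (hΦ : Φ ∈ D.faceColorings m Z) (α : Fin n) :
    D.dualDiff m Z (D.un α) Φ = D.dualDiff m Z (α, false) Φ := by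
  rw [dualDiff_apply, dualDiff_apply]
  rcases h : D.positive α
  · have := D.face_relation_of_neg hΦ h
    rw [D.left_un_of_neg h, ← D.left_ov_of_neg h, ← D.right_over_of_neg h, D.right_under_of_neg h,
      sub_eq_sub_iff_sub_eq_sub, ← smul_sub]
    exact this.symm
  · have := D.face_relation_of_pos hΦ h
    rw [D.left_un_of_pos h, ← D.right_over_of_pos h, ← D.left_ov_of_pos h, D.right_under_of_pos h,
      eq_comm, sub_eq_sub_iff_sub_eq_sub, ← smul_sub]
    exact this.symm

theorem dualDiff_over {Φ : D.Face → Z} (hΦ : Φ ∈ D.faceColorings m Z) (α : Fin n) :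
    (((-m) ^ (-D.index (α, true)) : Sˣ) : S) •
        (D.dualDiff m Z (α, false) Φ - D.dualDiff m Z (α, true) Φ) =
      (((-m) ^ (-D.index (D.ov α)) : Sˣ) : S) •
        (D.dualDiff m Z (α, false) Φ - D.dualDiff m Z (D.ov α) Φ) := by
  rcases h : D.positive α
  · have h1 := sub_eq_iff_eq_add.1 (D.face_relation_of_neg hΦ h)
    rw [D.index_over, D.index_un_of_neg h, neg_add, zpow_add, zpow_neg_one, Units.val_mul, mul_smul]
    congr 1
    simp only [dualDiff_apply, D.right_under_of_neg h, ← D.right_over_of_neg h, h1]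
    module
  · have h1 := sub_eq_iff_eq_add.1 (D.face_relation_of_pos hΦ h)
    rw [D.index_over, D.index_ov_of_pos h, neg_add, zpow_add, zpow_neg_one, Units.val_mul, mul_smul]
    congr 1
    simp only [dualDiff_apply, D.right_under_of_pos h, ← D.left_ov_of_pos h, h1]
    module

theorem weight_inv_mul_relVec (α j : Fin n) (m : Sˣ) :
    (D.weight m⁻¹ α : S) * D.relVec m⁻¹ α j =
      ((((-m) ^ (-D.index (D.ov α)) : Sˣ) : S) * (Pi.single j 1 : Fin n → S) (D.strand (D.ov α)) +
        (((-m) ^ (-D.index (D.un α)) : Sˣ) : S) * (Pi.single j 1 : Fin n → S) (D.strand (D.un α))) -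
      ((((-m) ^ (-D.index (α, true)) : Sˣ) : S) * (Pi.single j 1 : Fin n → S) (D.strand (α, true)) +
        (((-m) ^ (-D.index (α, false)) : Sˣ) : S) *
          (Pi.single j 1 : Fin n → S) (D.strand (α, false))) := by
  have h := D.weight_smul_relVec m⁻¹ α (Pi.single j 1 : Fin n → S)
  simp only [← inv_neg, inv_zpow', smul_eq_mul] at h
  rw [← h]
  congr 1
  simp [Pi.single_apply]

/-- In the expansion of each relation over the four edges of its crossing, `dualDiff_un` and
`dualDiff_over` allow `dualDiff` to be evaluated at each edge instead of at the outgoing underpass.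
The sum then cancels edge by edge. -/
theorem dualColoring_mem {Φ : D.Face → Z} (hΦ : Φ ∈ D.faceColorings m Z) :
    (fun α => (D.weight m⁻¹ α : S) • D.dualDiff m Z (α, false) Φ) ∈ D.relKer m⁻¹ Z := by
  intro j
  simp only [smul_smul, mul_comm (D.relVec m⁻¹ _ j), weight_inv_mul_relVec]
  set u : Fin n × Bool → Z := fun x => ((((-m) ^ (-D.index x) : Sˣ) : S) *
    (Pi.single j 1 : Fin n → S) (D.strand x)) • D.dualDiff m Z x Φ with hu
  have h := D.sum_next u
  rw [KnotCode.sum_passages, KnotCode.sum_passages, ← sub_eq_zero, ← Finset.sum_sub_distrib] at h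
  rw [← h]
  refine Finset.sum_congr rfl fun α _ => ?_
  change _ = u (D.ov α) + u (D.un α) - (u (α, true) + u (α, false))
  have h1 := D.dualDiff_over hΦ α
  have h2 : D.strand (α, true) = D.strand (D.ov α) := D.strand_over α
  simp only [hu, D.dualDiff_un hΦ, h2]
  linear_combination (norm := module) (-(Pi.single j 1 : Fin n → S) (D.strand (D.ov α))) • h1

/-- The relation between the abelianized Wirtinger relations that is dual to a colouring of the
faces. -/
noncomputable def dualColoring (m : Sˣ) (Z : Type*) [AddCommGroup Z] [Module S Z] :
    D.faceColorings m Z →ₗ[S] ((D.presMatrix m⁻¹).transpose.act Z).ker :=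
  LinearMap.codRestrict _ ((LinearMap.pi fun α => (D.weight m⁻¹ α : S) •
    (D.dualDiff m Z (α, false) - D.dualDiff m Z (0, false))) ∘ₗ
      (D.faceColorings m Z).subtype) fun ⟨Φ, hΦ⟩ => by
    rw [mem_ker_act_transpose]
    refine ⟨by simp, ?_⟩
    convert Submodule.sub_mem _ (D.dualColoring_mem hΦ)
      (D.weight_smul_mem_relKer m⁻¹ Z (D.dualDiff m Z (0, false) Φ)) using 1
    ext α
    exact smul_sub _ _ _

/-- If `dualDiff` has one value `c` at all underpasses, `dualDiff_over` carries this to every edge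
of each strand. The base edge gives `c = 0`. Then `Φ` times `(-m)` to the minus Alexander number is
the same on all faces, hence zero. -/
theorem dualColoring_injective (m : Sˣ) (Z : Type*) [AddCommGroup Z] [Module S Z] :
    Function.Injective (D.dualColoring m Z) := by
  rw [injective_iff_map_eq_zero]
  rintro ⟨Φ, hΦ⟩ h
  have h0 := ((D.mem_faceColorings m Z).1 hΦ).2
  set c := D.dualDiff m Z (0, false) Φ with hc
  have h1 : ∀ α, D.dualDiff m Z (α, false) Φ = c := fun α => by
    have h2 : (D.weight m⁻¹ α : S) • (D.dualDiff m Z (α, false) Φ - c) = 0 :=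
      congrFun (congrArg Subtype.val h) α
    rw [← Units.smul_def, smul_eq_zero_iff_eq] at h2
    exact sub_eq_zero.1 h2
  have h2 : ∀ x, (((-m) ^ (-D.index x) : Sˣ) : S) • (c - D.dualDiff m Z x Φ) = 0 := fun x => by
    obtain ⟨α, -, h3⟩ := D.exists_under x
      (u := fun x => (((-m) ^ (-D.index x) : Sˣ) : S) • (c - D.dualDiff m Z x Φ)) fun α => by
        have := D.dualDiff_over hΦ α
        rwa [h1] at this
    rw [h3, h1, sub_self, smul_zero]
  have h3 : ∀ x, D.dualDiff m Z x Φ = c := fun x => by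
    have := h2 x
    rw [← Units.smul_def, smul_eq_zero_iff_eq] at this
    exact (sub_eq_zero.1 this).symm
  have h4 : c = 0 := by
    rw [← h3 (D.edge 0), dualDiff_apply, h0.1, h0.2, smul_zero, sub_zero]
  have h5 : ∀ F, (((-m) ^ (-D.numbering F) : Sˣ) : S) • Φ F = 0 := fun F => by
    rw [D.face_const (u := fun F => (((-m) ^ (-D.numbering F) : Sˣ) : S) • Φ F) (fun x => ?_) F
      (D.left (D.edge 0)), h0.1, smul_zero]
    have := h3 x
    rw [h4, dualDiff_apply, sub_eq_zero] at this
    rw [← this, D.numbering_left, neg_add, zpow_add, zpow_neg_one, Units.val_mul, mul_smul]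
  refine Subtype.ext (funext fun F => ?_)
  have := h5 F
  rwa [← Units.smul_def, smul_eq_zero_iff_eq] at this

/-- An inequality between the sizes of the Alexander module and of its dual. -/
theorem length_ker_act_le (k : Type*) [Field k] [Algebra k S] (m : Sˣ) (Z : Type*) [AddCommGroup Z]
    [Module S Z] : Module.length S ((D.presMatrix m).act Z).ker ≤
      Module.length S ((D.presMatrix m⁻¹).transpose.act Z).ker :=
  (Module.length_le_of_surjective _ (D.strandColoring_surjective m Z k)).trans
    (Module.length_le_of_injective _ (D.dualColoring_injective m Z))

/-- Homomorphisms out of the Alexander module form the kernel of the presentation matrix, and over a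
principal ideal domain the transposed matrix has an isomorphic kernel. -/
theorem length_hom_le [IsDomain S] [IsPrincipalIdealRing S] (k : Type*) [Field k] [Algebra k S]
    {m : Sˣ} (hm : ¬ IsUnit (1 + (m : S))) (Z : Type*) [AddCommGroup Z] [Module S Z] :
    Module.length S (D.AlexModule m →ₗ[S] Z) ≤ Module.length S (D.AlexModule m⁻¹ →ₗ[S] Z) := by
  rw [(D.homEquiv m Z).length_eq, (D.homEquiv m⁻¹ Z).length_eq,
    ← (Matrix.nonempty_ker_act_transpose_equiv Z _
      (D.det_presMatrix_ne_zero (not_isUnit_one_add_inv hm))).some.length_eq]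
  exact D.length_ker_act_le k m Z

theorem isTorsion_alexModule [IsDomain S] {m : Sˣ} (hm : ¬ IsUnit (1 + (m : S))) :
    Module.IsTorsion S (D.AlexModule m) := fun x =>
  ⟨⟨_, mem_nonZeroDivisors_of_ne_zero (D.det_presMatrix_ne_zero hm)⟩, D.det_smul_alex m x⟩

end dehn

/-! ### The torsion over a principal ideal domain determines the Alexander module. -/

section duality

universe u

variable {n : ℕ} [NeZero n] (D : KnotDiagram n) {S : Type u} [CommRing S] [IsDomain S]
  [IsPrincipalIdealRing S]

/-- Over a principal ideal domain, the Alexander module does not change when `t` is replaced by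
its inverse. -/
theorem nonempty_alexModule_inv_equiv (k : Type*) [Field k] [Algebra k S] {m : Sˣ}
    (hm : ¬ IsUnit (1 + (m : S))) : Nonempty (D.AlexModule m⁻¹ ≃ₗ[S] D.AlexModule m) := by
  refine nonempty_equiv_of_length_hom_eq (D.isTorsion_alexModule (not_isUnit_one_add_inv hm))
    (D.isTorsion_alexModule hm) fun p s _ => le_antisymm ?_ ?_
  · have := D.length_hom_le k (not_isUnit_one_add_inv hm) (S ⧸ Ideal.span {p ^ s})
    rwa [inv_inv] at this
  · exact D.length_hom_le k hm _

/-- The torsion of the linearized homology over a principal ideal domain. -/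
theorem nonempty_torsion_equiv (k : Type*) [Field k] [Algebra k S] {m : Sˣ}
    (hm : ¬ IsUnit (1 + (m : S))) : Nonempty (Submodule.torsion S (D.LinHomology m 1) ≃ₗ[S]
      D.AlexModule m × D.AlexModule m × (D.AlexModule m →ₗ[S] D.AlexModule m)) := by
  obtain ⟨e⟩ := D.nonempty_alexModule_inv_equiv k hm
  have e₁ := (Matrix.nonempty_ker_act_transpose_equiv (D.AlexModule m) _
      (D.det_presMatrix_ne_zero (not_isUnit_one_add_inv hm))).some.trans
        ((D.homEquiv m⁻¹ (D.AlexModule m)).symm.trans (e.congrLeft (D.AlexModule m) S))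
  have e₂ := (D.relKerEquiv m⁻¹ (D.AlexModule m)).trans ((LinearEquiv.refl S _).prodCongr e₁)
  exact ⟨(D.torsionEquiv hm).trans ((LinearEquiv.prodComm S _ _).trans (e.prodCongr e₂))⟩

end duality

section laurent

universe u

variable {k : Type u} [Field k]

/-- The Laurent polynomials are a localization of `k[X]`, so every ideal is generated by the image
of its contraction. -/
instance : IsPrincipalIdealRing k[T;T⁻¹] := by
  constructor
  intro I
  obtain ⟨p, hp⟩ := IsPrincipalIdealRing.principal
    (I.under (Polynomial k))
  refine ⟨algebraMap _ _ p, ?_⟩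
  rw [← IsLocalization.map_under (Submonoid.powers (Polynomial.X : Polynomial k)) k[T;T⁻¹] I, hp,
    Ideal.submodule_span_eq, Ideal.map_span, Set.image_singleton, Ideal.submodule_span_eq]

/-- Over a field, the linearized homology determines the Alexander module. -/
theorem nonempty_alexModule_equiv {n₁ n₂ : ℕ} [NeZero n₁] [NeZero n₂] (D₁ : KnotDiagram n₁)
    (D₂ : KnotDiagram n₂)
    (f : D₁.LinHomology (mu k) 1 ≃ₗ[k[T;T⁻¹]] D₂.LinHomology (mu k) 1) :
    Nonempty (D₁.AlexModule (mu k) ≃ₗ[k[T;T⁻¹]] D₂.AlexModule (mu k)) := by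
  have hm := not_isUnit_one_add_T (k := k)
  obtain ⟨e₁⟩ := D₁.nonempty_torsion_equiv k hm
  obtain ⟨e₂⟩ := D₂.nonempty_torsion_equiv k hm
  have hf : (Submodule.torsion k[T;T⁻¹] (D₁.LinHomology (mu k) 1)).map f.toLinearMap =
      Submodule.torsion k[T;T⁻¹] (D₂.LinHomology (mu k) 1) := by
    ext y
    constructor
    · rintro ⟨x, ⟨a, ha⟩, rfl⟩
      exact ⟨a, by
        rw [Submonoid.smul_def] at ha ⊢
        rw [LinearEquiv.coe_coe, ← map_smul, ha, map_zero]⟩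
    · rintro ⟨a, ha⟩
      refine ⟨f.symm y, ⟨a, ?_⟩, f.apply_symm_apply y⟩
      rw [Submonoid.smul_def] at ha ⊢
      rw [← map_smul, ha, map_zero]
  exact nonempty_equiv_of_prod_end_equiv (D₁.isTorsion_alexModule hm) (D₂.isTorsion_alexModule hm)
    (e₁.symm.trans ((f.submoduleMap _).trans ((LinearEquiv.ofEq _ _ hf).trans e₂)))

end laurent

end KnotDiagram

/-! ### The Alexander invariant with coefficients in a field. -/

namespace KnotDiagram

section baseChange

variable {n : ℕ} [NeZero n] (D : KnotDiagram n) (k : Type*) [CommRing k]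

/-- the deck transformation of the Alexander invariant with coefficients in `k`, up to sign -/
noncomputable def negDeck : (k ⊗[ℤ] D.AlexanderInvariant) ≃ₗ[k] (k ⊗[ℤ] D.AlexanderInvariant) :=
  (D.deck.baseChange ℤ k _ _).trans (LinearEquiv.neg k)

theorem negDeck_apply (x : k ⊗[ℤ] D.AlexanderInvariant) :
    D.negDeck k x = -D.deck.toLinearMap.baseChange k x := rfl

/-- An application of `alexEquiv`: the tensors `1 ⊗ x` span, and the Fox calculus map `alexHom`
extends to the tensor product by scalars from `k`. -/
theorem nonempty_negDeck_equiv :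
    Nonempty (LaurentModule (D.negDeck k) ≃ₗ[k[T;T⁻¹]] D.AlexModule (mu k)) := by
  let j : D.AlexanderInvariant →+ LaurentModule (D.negDeck k) :=
    (LaurentModule.of (D.negDeck k)).toAddMonoidHom.comp
      (TensorProduct.mk ℤ k D.AlexanderInvariant 1).toAddMonoidHom
  have hj : ∀ x, j (D.deck x) = -((mu k : (k[T;T⁻¹])ˣ) : k[T;T⁻¹]) • j x := fun x => by
    change LaurentModule.of _ (1 ⊗ₜ D.deck x) = -(T 1) • LaurentModule.of _ (1 ⊗ₜ x)
    rw [neg_smul, LaurentModule.T_one_smul, negDeck_apply, ← map_neg, neg_neg]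
    rfl
  let δ₀ : (k ⊗[ℤ] D.AlexanderInvariant) →ₗ[k] D.AlexModule (mu k) :=
    (D.alexHom (mu k)).toIntLinearMap.liftBaseChange k
  have h0 : ∀ (c : k) x, δ₀ (c ⊗ₜ x) = c • D.alexHom (mu k) x := fun c x => by simp [δ₀]
  have hC : ∀ (c : k) x, δ₀ (c • x) = (C c : k[T;T⁻¹]) • δ₀ x := fun c x => by
    rw [map_smul, ← algebraMap_smul k[T;T⁻¹] c (δ₀ x)]
    rfl
  have hT : ∀ x, δ₀ (D.negDeck k x) = (T 1 : k[T;T⁻¹]) • δ₀ x := fun x => by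
    induction x with
    | zero => simp
    | add x y hx hy => rw [map_add, map_add, hx, hy, map_add, smul_add]
    | tmul c x =>
      rw [negDeck_apply, LinearMap.baseChange_tmul, map_neg, h0, h0, LinearEquiv.coe_coe,
        alexHom_deck, neg_smul, smul_neg, neg_neg, smul_comm]
      rfl
  let δ : LaurentModule (D.negDeck k) →ₗ[k[T;T⁻¹]] D.AlexModule (mu k) :=
    { δ₀.toAddMonoidHom.comp (LaurentModule.of (D.negDeck k)).symm.toAddMonoidHom with
      map_smul' := map_laurent_smul
        (δ₀.toAddMonoidHom.comp (LaurentModule.of (D.negDeck k)).symm.toAddMonoidHom)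
        (fun c x => by
          obtain ⟨x, rfl⟩ := (LaurentModule.of (D.negDeck k)).surjective x
          rw [LaurentModule.C_smul]
          exact hC c x)
        (fun x => by
          obtain ⟨x, rfl⟩ := (LaurentModule.of (D.negDeck k)).surjective x
          rw [LaurentModule.T_one_smul]
          exact hT x) }
  refine ⟨D.alexEquiv (mu k) j hj (eq_top_iff.2 fun x _ => ?_) δ fun x => ?_⟩
  · obtain ⟨x, rfl⟩ := (LaurentModule.of (D.negDeck k)).surjective x
    induction x with
    | zero => rw [map_zero]; exact zero_mem _
    | add x y hx hy => rw [map_add]; exact add_mem (hx trivial) (hy trivial)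
    | tmul c x =>
      have : LaurentModule.of (D.negDeck k) (c ⊗ₜ x) = (C c : k[T;T⁻¹]) • j x := by
        change _ = (C c : k[T;T⁻¹]) • LaurentModule.of _ (1 ⊗ₜ x)
        rw [LaurentModule.C_smul, TensorProduct.smul_tmul', smul_eq_mul, mul_one]
      rw [this]
      exact Submodule.smul_mem _ _ (Submodule.subset_span ⟨x, rfl⟩)
  · exact (h0 1 x).trans (one_smul _ _)

end baseChange

/-- Over a field, the linearized homology determines the Alexander invariant. -/
theorem exists_baseChange_equiv {k : Type*} [Field k] {n₁ n₂ : ℕ} [NeZero n₁] [NeZero n₂]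
    (D₁ : KnotDiagram n₁) (D₂ : KnotDiagram n₂)
    (f : D₁.LinHomology (mu k) 1 ≃ₗ[k[T;T⁻¹]] D₂.LinHomology (mu k) 1) :
    ∃ f : (k ⊗[ℤ] D₁.AlexanderInvariant) ≃ₗ[k] (k ⊗[ℤ] D₂.AlexanderInvariant),
      ∀ x, f (D₁.deck.toLinearMap.baseChange k x) = D₂.deck.toLinearMap.baseChange k (f x) := by
  obtain ⟨g⟩ := nonempty_alexModule_equiv D₁ D₂ f
  obtain ⟨e₁⟩ := D₁.nonempty_negDeck_equiv k
  obtain ⟨e₂⟩ := D₂.nonempty_negDeck_equiv k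
  let h := e₁.trans (g.trans e₂.symm)
  let o₁ := LaurentModule.of (D₁.negDeck k)
  let o₂ := LaurentModule.of (D₂.negDeck k)
  refine ⟨((o₁.trans h.toAddEquiv).trans o₂.symm).toLinearEquiv fun c x => ?_, fun x => ?_⟩
  · change o₂.symm (h (o₁ (c • x))) = c • o₂.symm (h (o₁ x))
    rw [AddEquiv.symm_apply_eq, ← LaurentModule.C_smul, map_smul, ← LaurentModule.C_smul]
    rfl
  · change o₂.symm (h (o₁ _)) = D₂.deck.toLinearMap.baseChange k (o₂.symm (h (o₁ x)))
    have h1 : D₁.deck.toLinearMap.baseChange k x = -D₁.negDeck k x := by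
      rw [negDeck_apply, neg_neg]
    have h2 : ∀ y, D₂.deck.toLinearMap.baseChange k y = -D₂.negDeck k y := fun y => by
      rw [negDeck_apply, neg_neg]
    rw [h1, h2, map_neg, map_neg, map_neg, neg_inj, AddEquiv.symm_apply_eq,
      ← LaurentModule.T_one_smul, map_smul, ← LaurentModule.T_one_smul]
    rfl

end KnotDiagram

/-! ### Localization of the linearized homology at the nonzero integers. -/

/-- A homomorphism of abelian groups that is a localization at the nonzero integers. -/
structure IsRationalization {M N : Type*} [AddCommGroup M] [AddCommGroup N] (g : M →+ N) : Prop where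
  bijective : ∀ a : ℤ, a ≠ 0 → Function.Bijective fun y : N => a • y
  surj : ∀ y : N, ∃ (a : ℤ) (x : M), a ≠ 0 ∧ a • y = g x
  exists_of_eq_zero : ∀ x : M, g x = 0 → ∃ a : ℤ, a ≠ 0 ∧ a • x = 0

namespace IsRationalization

variable {M N M' N' : Type*} [AddCommGroup M] [AddCommGroup N] [AddCommGroup M'] [AddCommGroup N']
  {g : M →+ N} {g' : M' →+ N'}

theorem isLocalizedModule (h : IsRationalization g) :
    IsLocalizedModule (nonZeroDivisors ℤ) g.toIntLinearMap := by
  refine ⟨fun a => ?_, fun y => ?_, fun {x₁ x₂} hx => ?_⟩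
  · rw [Module.End.isUnit_iff]
    exact h.bijective a (nonZeroDivisors.ne_zero a.2)
  · obtain ⟨a, x, ha, hx⟩ := h.surj y
    exact ⟨⟨x, ⟨a, mem_nonZeroDivisors_of_ne_zero ha⟩⟩, hx⟩
  · obtain ⟨a, ha, h0⟩ := h.exists_of_eq_zero (x₁ - x₂) (by
      rw [map_sub, sub_eq_zero]
      exact hx)
    refine ⟨⟨a, mem_nonZeroDivisors_of_ne_zero ha⟩, ?_⟩
    rwa [smul_sub, sub_eq_zero] at h0

theorem exists_addEquiv (h : IsRationalization g) (h' : IsRationalization g') (f : M ≃+ M') :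
    ∃ e : N ≃+ N', ∀ x, e (g x) = g' (f x) := by
  have := h.isLocalizedModule
  have := h'.isLocalizedModule
  let l := IsLocalizedModule.linearEquiv (nonZeroDivisors ℤ) g.toIntLinearMap
    (g'.toIntLinearMap ∘ₗ f.toIntLinearEquiv.toLinearMap)
  exact ⟨l.toAddEquiv, fun x => IsLocalizedModule.linearEquiv_apply _ _ _ x⟩

end IsRationalization

namespace KnotDiagram

section scalars

variable {n : ℕ} [NeZero n] (D : KnotDiagram n) {S S' : Type*} [CommRing S] [CommRing S']
  (φ : S →+* S') (m : Sˣ)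

theorem map_relVec (α i : Fin n) : φ (D.relVec m α i) = D.relVec (Units.map φ m) α i := by
  simp [relVec, Pi.single_apply, apply_ite φ]

theorem map_coVec (α i : Fin n) : φ (D.coVec m α i) = D.coVec (Units.map φ m) α i := by
  simp [coVec, map_relVec]

/-- the change of scalars on chains -/
noncomputable def mapChain : (DGAGen n →₀ S) →ₛₗ[φ] (DGAGen n →₀ S') where
  toFun := Finsupp.mapRange φ (map_zero φ)
  map_add' := Finsupp.mapRange_add (map_add φ)
  map_smul' s x := by
    ext g
    simp

theorem mapChain_single (g : DGAGen n) (s : S) :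
    mapChain φ (Finsupp.single g s) = Finsupp.single g (φ s) := by
  simp [mapChain]

theorem mapChain_injective (hφ : Function.Injective φ) :
    Function.Injective (mapChain (n := n) φ) :=
  Finsupp.mapRange_injective φ (map_zero φ) hφ

theorem mapChain_mem {i : ℕ} {z : DGAGen n →₀ S} (hz : z ∈ chainsDeg n S i) :
    mapChain φ z ∈ chainsDeg n S' i :=
  fun _ hg => hz (Finsupp.support_mapRange (hf := map_zero φ) hg)

theorem mem_chainsDeg_of_mapChain (hφ : Function.Injective φ) {i : ℕ} {z : DGAGen n →₀ S}
    (hz : mapChain φ z ∈ chainsDeg n S' i) : z ∈ chainsDeg n S i := by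
  rwa [chainsDeg, Finsupp.mem_supported, mapChain, LinearMap.coe_mk, AddHom.coe_mk,
    Finsupp.support_mapRange_of_injective _ _ hφ] at hz

theorem mapChain_linA (i j : Fin n) : mapChain φ (linA i j) = linA i j := by
  rw [linA, linA]
  split_ifs
  · exact map_zero _
  · rw [mapChain_single, map_one]

theorem mapChain_linDiff (z : DGAGen n →₀ S) :
    mapChain φ (D.linDiff m z) = D.linDiff (Units.map φ m) (mapChain φ z) := by
  induction z using Finsupp.induction_linear with
  | zero => simp
  | add x y hx hy => rw [map_add, map_add, hx, hy, map_add, map_add]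
  | single g s =>
    rw [← mul_one s, ← smul_eq_mul, ← Finsupp.smul_single, map_smul, map_smulₛₗ, map_smulₛₗ,
      map_smul, mapChain_single, map_one]
    congr 1
    cases g with
    | a i j h => rw [linDiff_a, linDiff_a, map_zero]
    | b α i => simp [linDiff_b, mapChain_linA, map_relVec]
    | c i α => simp [linDiff_c, mapChain_linA, map_coVec]
    | d α β => simp [linDiff_d, map_coVec, map_relVec, mapChain_single]
    | e α => simp [linDiff_e, mapChain_single]

theorem mapChain_mem_cycles {i : ℕ} {z : DGAGen n →₀ S} (hz : z ∈ D.cycles m i) :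
    mapChain φ z ∈ D.cycles (Units.map φ m) i :=
  ⟨mapChain_mem φ hz.1, (D.mapChain_linDiff φ m z).symm.trans
    ((congrArg (mapChain φ) hz.2).trans (map_zero _))⟩

theorem mapChain_mem_boundaries {i : ℕ} {z : DGAGen n →₀ S} (hz : z ∈ D.boundaries m i) :
    mapChain φ z ∈ D.boundaries (Units.map φ m) i := by
  obtain ⟨y, hy, rfl⟩ := hz
  exact ⟨mapChain φ y, mapChain_mem φ hy, (D.mapChain_linDiff φ m y).symm⟩

/-- the change of scalars on the linearized homology -/
noncomputable def mapHomology (i : ℕ) :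
    D.LinHomology m i →ₛₗ[φ] D.LinHomology (Units.map (φ : S →* S') m) i :=
  Submodule.liftQ _ ((Subquotient.proj _ _).comp ((mapChain φ).restrict
    (p := D.cycles m i) (q := D.cycles (Units.map (φ : S →* S') m) i)
      fun _ => D.mapChain_mem_cycles φ m))
    fun z hz => by
      rw [LinearMap.mem_ker, LinearMap.comp_apply, ← map_zero (Subquotient.proj _ _),
        Subquotient.proj_eq_iff]
      exact (sub_zero (mapChain φ z.1)).symm ▸ D.mapChain_mem_boundaries φ m hz

theorem mapHomology_proj (i : ℕ) (z : D.cycles m i) :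
    D.mapHomology φ m i (Subquotient.proj _ _ z) =
      Subquotient.proj _ _ ⟨mapChain φ z.1, D.mapChain_mem_cycles φ m z.2⟩ := rfl

variable {φ} in
theorem exists_smul_eq_mapChain (hd : ∀ s : S', ∃ (a : ℤ) (s₀ : S), a ≠ 0 ∧ a • s = φ s₀)
    (z : DGAGen n →₀ S') : ∃ (a : ℤ) (z₀ : DGAGen n →₀ S), a ≠ 0 ∧ a • z = mapChain φ z₀ := by
  induction z using Finsupp.induction_linear with
  | zero => exact ⟨1, 0, one_ne_zero, by simp⟩
  | add x y hx hy =>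
    obtain ⟨a, x₀, ha, hx⟩ := hx
    obtain ⟨b, y₀, hb, hy⟩ := hy
    refine ⟨a * b, b • x₀ + a • y₀, mul_ne_zero ha hb, ?_⟩
    rw [map_add, map_zsmul, map_zsmul, ← hx, ← hy]
    module
  | single g s =>
    obtain ⟨a, s₀, ha, h⟩ := hd s
    refine ⟨a, Finsupp.single g s₀, ha, ?_⟩
    rw [Finsupp.smul_single, h]
    simp [mapChain]

variable {φ} in
/-- If `S'` is the localization of `S` at the nonzero integers, then so is the linearized homology
over `S'`. -/
theorem isRationalization_mapHomology [Algebra ℚ S'] (hφ : Function.Injective φ)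
    (hd : ∀ s : S', ∃ (a : ℤ) (s₀ : S), a ≠ 0 ∧ a • s = φ s₀) (i : ℕ) :
    IsRationalization (D.mapHomology φ m i).toAddMonoidHom := by
  refine ⟨fun a ha => ?_, fun y => ?_, fun x hx => ?_⟩
  · have ha' : (a : S') * algebraMap ℚ S' (a : ℚ)⁻¹ = 1 := by
      rw [← map_intCast (algebraMap ℚ S'), ← map_mul, mul_inv_cancel₀, map_one]
      exact Int.cast_ne_zero.2 ha
    refine Function.bijective_iff_has_inverse.2
      ⟨fun x => algebraMap ℚ S' (a : ℚ)⁻¹ • x, fun x => ?_, fun x => ?_⟩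
    · change algebraMap ℚ S' (a : ℚ)⁻¹ • a • x = x
      rw [← Int.cast_smul_eq_zsmul S', smul_smul, mul_comm, ha', one_smul]
    · change a • algebraMap ℚ S' (a : ℚ)⁻¹ • x = x
      rw [← Int.cast_smul_eq_zsmul S', smul_smul, ha', one_smul]
  · obtain ⟨⟨z, hz⟩, rfl⟩ := Subquotient.proj_surjective _ _ y
    obtain ⟨a, z₀, ha, h⟩ := exists_smul_eq_mapChain hd z
    have h0 : mapChain φ z₀ ∈ D.cycles (Units.map φ m) i := h ▸ zsmul_mem hz a
    have hz₀ : z₀ ∈ D.cycles m i := by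
      refine ⟨mem_chainsDeg_of_mapChain φ hφ h0.1, mapChain_injective φ hφ ?_⟩
      rw [mapChain_linDiff, map_zero]
      exact h0.2
    refine ⟨a, Subquotient.proj _ _ ⟨z₀, hz₀⟩, ha, ?_⟩
    change _ = D.mapHomology φ m i (Subquotient.proj _ _ ⟨z₀, hz₀⟩)
    rw [mapHomology_proj, ← map_zsmul]
    congr 1
    exact Subtype.ext h
  · obtain ⟨z, rfl⟩ := Subquotient.proj_surjective _ _ x
    replace hx : D.mapHomology φ m i (Subquotient.proj (D.cycles m i) (D.boundaries m i) z) = 0 := hx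
    rw [mapHomology_proj, ← map_zero (Subquotient.proj _ _), Subquotient.proj_eq_iff] at hx
    obtain ⟨w, hw, h⟩ := hx
    rw [Submodule.coe_zero, sub_zero] at h
    obtain ⟨a, w₀, ha, h'⟩ := exists_smul_eq_mapChain hd w
    refine ⟨a, ha, ?_⟩
    rw [← map_zsmul, ← map_zero (Subquotient.proj _ _), Subquotient.proj_eq_iff, Submodule.coe_zero,
      sub_zero]
    refine ⟨w₀, mem_chainsDeg_of_mapChain φ hφ (h' ▸ zsmul_mem hw a), mapChain_injective φ hφ ?_⟩
    rw [mapChain_linDiff, ← h', map_zsmul, h, ← map_zsmul]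
    rfl

end scalars

end KnotDiagram

/-! ### Laurent polynomials over ℤ, ℚ and ℤ/p; Gauss's lemma. -/

section laurent

variable {k k' : Type*} [CommRing k] [CommRing k']

/-- the change of coefficients of Laurent polynomials -/
noncomputable def mapLaurent (f : k →+* k') : k[T;T⁻¹] →+* k'[T;T⁻¹] :=
  AddMonoidAlgebra.mapRingHom ℤ f

theorem mapLaurent_injective {f : k →+* k'} (hf : Function.Injective f) :
    Function.Injective (mapLaurent f) := fun x y h => by
  ext m
  apply hf
  rw [← AddMonoidAlgebra.coeff_mapRingHom, ← AddMonoidAlgebra.coeff_mapRingHom]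
  exact congrArg (fun z : k'[T;T⁻¹] => z.coeff m) h

theorem mapLaurent_C_mul_T (f : k →+* k') (a : k) (j : ℤ) :
    mapLaurent f (C a * T j) = C (f a) * T j := by
  rw [← LaurentPolynomial.single_eq_C_mul_T, ← LaurentPolynomial.single_eq_C_mul_T]
  exact AddMonoidAlgebra.mapRingHom_single _ _ _

theorem map_mu (f : k →+* k') : Units.map (mapLaurent f : k[T;T⁻¹] →* k'[T;T⁻¹])
    (KnotDiagram.mu k) = KnotDiagram.mu k' := by
  ext1
  change mapLaurent f (T 1) = T 1
  have := mapLaurent_C_mul_T f 1 1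
  rwa [map_one, map_one, map_one, one_mul, one_mul] at this

theorem exists_smul_eq_mapLaurent (p : ℚ[T;T⁻¹]) :
    ∃ (a : ℤ) (q : ℤ[T;T⁻¹]), a ≠ 0 ∧ a • p = mapLaurent (Int.castRingHom ℚ) q := by
  induction p using LaurentPolynomial.induction_on' with
  | add p q hp hq =>
    obtain ⟨a, p₀, ha, hp⟩ := hp
    obtain ⟨b, q₀, hb, hq⟩ := hq
    refine ⟨a * b, b • p₀ + a • q₀, mul_ne_zero ha hb, ?_⟩
    rw [map_add, map_zsmul, map_zsmul, ← hp, ← hq]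
    module
  | C_mul_T j c =>
    refine ⟨c.den, C c.num * T j, by exact_mod_cast c.den_nz, ?_⟩
    rw [mapLaurent_C_mul_T, ← smul_mul_assoc, ← map_zsmul, zsmul_eq_mul, Int.cast_natCast,
      Rat.den_mul_eq_num]
    rfl

/-- the evaluation of a Laurent polynomial with integer coefficients at `-1` -/
noncomputable def evalNegOne : ℤ[T;T⁻¹] →+* ℤ :=
  LaurentPolynomial.eval₂ (RingHom.id ℤ) (-1 : ℤˣ)

theorem dvd_of_mapLaurent_eq_zero {p : ℕ} {x : ℤ[T;T⁻¹]}
    (hx : mapLaurent (Int.castRingHom (ZMod p)) x = 0) : ∃ y, x = (p : ℤ[T;T⁻¹]) * y := by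
  have h : ∀ m, (p : ℤ) ∣ x.coeff m := fun m => by
    rw [← ZMod.intCast_zmod_eq_zero_iff_dvd]
    exact (AddMonoidAlgebra.coeff_mapRingHom _ x m).symm.trans
      (congrArg (fun z : (ZMod p)[T;T⁻¹] => z.coeff m) hx)
  refine ⟨AddMonoidAlgebra.ofCoeff (x.coeff.mapRange (fun a => a / p) (by simp)), ?_⟩
  rw [← nsmul_eq_mul]
  ext m
  rw [AddMonoidAlgebra.coeff_smul]
  simp [Int.mul_ediv_cancel' (h m)]

/-- Gauss's lemma: no prime divides `d₂`, since its value at `-1` is a unit. As Laurent polynomials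
over `ZMod p` form a domain, every prime factor of `a` divides `x` and can be cancelled. -/
theorem dvd_of_nsmul_eq_mul {d₁ d₂ : ℤ[T;T⁻¹]} (h₂ : IsUnit (evalNegOne d₂)) (a : ℕ) (ha : a ≠ 0)
    (x : ℤ[T;T⁻¹]) (h : (a : ℤ[T;T⁻¹]) * d₁ = d₂ * x) : d₂ ∣ d₁ := by
  induction a using induction_on_primes generalizing x with
  | zero => exact absurd rfl ha
  | one => exact ⟨x, by rw [← h, Nat.cast_one, one_mul]⟩
  | prime_mul p a hp ih =>
    have := Fact.mk hp
    have h1 : mapLaurent (Int.castRingHom (ZMod p)) d₂ ≠ 0 := fun h0 => by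
      obtain ⟨y, rfl⟩ := dvd_of_mapLaurent_eq_zero h0
      rw [map_mul, map_natCast, IsUnit.mul_iff] at h₂
      exact (Nat.prime_iff_prime_int.1 hp).not_isUnit h₂.1
    have h2 : mapLaurent (Int.castRingHom (ZMod p)) x = 0 := by
      have := congrArg (mapLaurent (Int.castRingHom (ZMod p))) h
      rw [map_mul, map_mul, map_natCast, Nat.cast_mul] at this
      rw [show ((p : ℕ) : (ZMod p)[T;T⁻¹]) = 0 from by
        rw [← map_natCast (C : ZMod p →+* (ZMod p)[T;T⁻¹]), ZMod.natCast_self, map_zero],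
        zero_mul, zero_mul, eq_comm] at this
      exact (mul_eq_zero.1 this).resolve_left h1
    obtain ⟨y, rfl⟩ := dvd_of_mapLaurent_eq_zero h2
    refine ih (right_ne_zero_of_mul ha) y ?_
    have h3 : (p : ℤ[T;T⁻¹]) ≠ 0 := fun h0 => by
      have := congrArg evalNegOne h0
      rw [map_natCast, map_zero] at this
      exact hp.ne_zero (by exact_mod_cast this)
    refine mul_left_cancel₀ h3 ?_
    rw [← mul_assoc, ← Nat.cast_mul, h]
    ring

theorem dvd_of_mapLaurent_dvd {d₁ d₂ : ℤ[T;T⁻¹]} (h₂ : IsUnit (evalNegOne d₂))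
    (h : mapLaurent (Int.castRingHom ℚ) d₂ ∣ mapLaurent (Int.castRingHom ℚ) d₁) : d₂ ∣ d₁ := by
  obtain ⟨q, hq⟩ := h
  obtain ⟨a, x, ha, hx⟩ := exists_smul_eq_mapLaurent q
  have h1 : a • d₁ = d₂ * x := by
    apply mapLaurent_injective (f := Int.castRingHom ℚ) Int.cast_injective
    rw [map_zsmul, hq, map_mul, ← hx, mul_smul_comm]
  rw [zsmul_eq_mul] at h1
  rcases Int.natAbs_eq a with h2 | h2
  · refine dvd_of_nsmul_eq_mul h₂ a.natAbs (Int.natAbs_ne_zero.2 ha) x ?_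
    rwa [h2, Int.cast_natCast] at h1
  · refine dvd_of_nsmul_eq_mul h₂ a.natAbs (Int.natAbs_ne_zero.2 ha) (-x) ?_
    rw [h2, Int.cast_neg, Int.cast_natCast] at h1
    rw [mul_neg, ← h1, neg_mul, neg_neg]

end laurent

/-! ### The Alexander polynomial and the main theorem. -/

namespace KnotDiagram

/-- The value `μ = -1` is `t = 1`, where the Alexander polynomial of a knot is `± 1`. -/
theorem isUnit_evalNegOne_det {n : ℕ} [NeZero n] (D : KnotDiagram n) :
    IsUnit (evalNegOne (D.presMatrix (mu ℤ)).det) := by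
  rw [map_det_presMatrix]
  refine D.isUnit_det_presMatrix ?_
  change evalNegOne (T 1) = -1
  rw [evalNegOne, eval₂_T]
  rfl

variable {n₁ n₂ : ℕ} [NeZero n₁] [NeZero n₂] (D₁ : KnotDiagram n₁) (D₂ : KnotDiagram n₂)

/-- The linearized homology over the integers determines the one over the rationals. -/
theorem nonempty_rat_equiv
    (f : D₁.LinHomology (mu ℤ) 1 ≃ₗ[ℤ[T;T⁻¹]] D₂.LinHomology (mu ℤ) 1) :
    Nonempty (D₁.LinHomology (mu ℚ) 1 ≃ₗ[ℚ[T;T⁻¹]] D₂.LinHomology (mu ℚ) 1) := by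
  rw [← map_mu (Int.castRingHom ℚ)]
  set φ := mapLaurent (Int.castRingHom ℚ)
  have hφ : Function.Injective φ := mapLaurent_injective Int.cast_injective
  have l₁ := D₁.isRationalization_mapHomology (mu ℤ) hφ exists_smul_eq_mapLaurent 1
  have l₂ := D₂.isRationalization_mapHomology (mu ℤ) hφ exists_smul_eq_mapLaurent 1
  obtain ⟨e, he⟩ := l₁.exists_addEquiv l₂ f.toAddEquiv
  have hφT : φ (T 1) = T 1 := congrArg Units.val (map_mu (Int.castRingHom ℚ))
  refine ⟨{ e with map_smul' := map_laurent_smul e.toAddMonoidHom (fun c x => ?_) fun x => ?_ }⟩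
  -- Multiplication by the denominator is injective on the target and turns the rational scalar into
  -- an integer, with which the additive map `e` commutes.
  · apply (l₂.bijective c.den (by exact_mod_cast c.den_nz)).1
    have hc : ∀ {V : Type} [AddCommGroup V] [Module ℚ[T;T⁻¹] V] (y : V),
        (c.den : ℤ) • (C c : ℚ[T;T⁻¹]) • y = c.num • y := fun y => by
      rw [← Int.cast_smul_eq_zsmul ℚ[T;T⁻¹], ← Int.cast_smul_eq_zsmul ℚ[T;T⁻¹], smul_smul]
      congr 1
      rw [← map_intCast (C : ℚ →+* ℚ[T;T⁻¹]), ← map_intCast (C : ℚ →+* ℚ[T;T⁻¹]), ← map_mul,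
        Int.cast_natCast, Rat.den_mul_eq_num]
    change (c.den : ℤ) • e _ = (c.den : ℤ) • (C c : ℚ[T;T⁻¹]) • e x
    rw [hc, ← map_zsmul, hc, map_zsmul]
  -- Up to a nonzero integer every class comes from integral homology, where `e` restricts to the
  -- linear map `f`.
  · obtain ⟨a, y, ha, hy⟩ := l₁.surj x
    apply (l₂.bijective a ha).1
    have h₁ : (T 1 : ℚ[T;T⁻¹]) • (D₁.mapHomology φ (mu ℤ) 1).toAddMonoidHom y =
        (D₁.mapHomology φ (mu ℤ) 1).toAddMonoidHom ((T 1 : ℤ[T;T⁻¹]) • y) :=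
      (((D₁.mapHomology φ (mu ℤ) 1).map_smulₛₗ (T 1) y).trans (by rw [hφT]; rfl)).symm
    have h₂ : ∀ z, (T 1 : ℚ[T;T⁻¹]) • (D₂.mapHomology φ (mu ℤ) 1).toAddMonoidHom z =
        (D₂.mapHomology φ (mu ℤ) 1).toAddMonoidHom ((T 1 : ℤ[T;T⁻¹]) • z) := fun z =>
      (((D₂.mapHomology φ (mu ℤ) 1).map_smulₛₗ (T 1) z).trans (by rw [hφT]; rfl)).symm
    change a • e _ = a • (T 1 : ℚ[T;T⁻¹]) • e x
    rw [← map_zsmul, smul_comm, hy, h₁, he, smul_comm, ← map_zsmul, hy, he, h₂]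
    congr 1
    exact map_smul f _ _

theorem associated_det (f : D₁.LinHomology (mu ℤ) 1 ≃ₗ[ℤ[T;T⁻¹]] D₂.LinHomology (mu ℤ) 1) :
    Associated (D₁.presMatrix (mu ℤ)).det (D₂.presMatrix (mu ℤ)).det := by
  obtain ⟨g⟩ := nonempty_rat_equiv D₁ D₂ f
  obtain ⟨e⟩ := nonempty_alexModule_equiv D₁ D₂ g
  have h := orderIdeal_eq_of_equiv e
  have h1 : ∀ {n : ℕ} [NeZero n] (D : KnotDiagram n),
      orderIdeal ℚ[T;T⁻¹] (D.AlexModule (mu ℚ)) =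
        Ideal.span {mapLaurent (Int.castRingHom ℚ) (D.presMatrix (mu ℤ)).det} := fun D => by
    rw [map_det_presMatrix, map_mu]
    exact orderIdeal_of_presentation _
  rw [h1, h1] at h
  exact associated_of_dvd_dvd
    (dvd_of_mapLaurent_dvd (isUnit_evalNegOne_det D₁)
      (Ideal.span_singleton_le_span_singleton.1 h.ge))
    (dvd_of_mapLaurent_dvd (isUnit_evalNegOne_det D₂)
      (Ideal.span_singleton_le_span_singleton.1 h.le))

/-- The linearized homology determines the Alexander polynomial. -/
theorem associated_of_isAlexanderPolynomial
    (f : D₁.LinHomology (mu ℤ) 1 ≃ₗ[ℤ[T;T⁻¹]] D₂.LinHomology (mu ℤ) 1) {Δ₁ Δ₂ : ℤ[T;T⁻¹]}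
    (h₁ : D₁.IsAlexanderPolynomial Δ₁) (h₂ : D₂.IsAlexanderPolynomial Δ₂) :
    Associated Δ₁ Δ₂ := by
  -- The substitution `T ↦ -T` carries the matrix for `μ` to the one for `-μ`, whose determinant
  -- generates the order ideal.
  have h : ∀ {n : ℕ} [NeZero n] (D : KnotDiagram n) {Δ : ℤ[T;T⁻¹]}, D.IsAlexanderPolynomial Δ →
      Associated Δ (eval₂ (C : ℤ →+* ℤ[T;T⁻¹]) (-mu ℤ) (D.presMatrix (mu ℤ)).det) :=
    fun D Δ hΔ => by
      rw [map_det_presMatrix, ← Ideal.span_singleton_eq_span_singleton, hΔ,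
        orderIdeal_alexanderInvariant]
      congr 4
      ext1
      change -T 1 = eval₂ C (-mu ℤ) (T 1)
      rw [eval₂_T]
      simp
      rfl
  exact (h D₁ h₁).trans (((associated_det D₁ D₂ f).map _).trans (h D₂ h₂).symm)

end KnotDiagram

theorem mainTheorem6 :
    -- the Alexander invariant as an explicit direct summand of the linearized homology
    (∀ (n : ℕ) [NeZero n] (D : KnotDiagram n),
      (∀ x, KnotDiagram.canonicalAug (KnotDiagram.mu ℤ) (D.diff 1 (KnotDiagram.mu ℤ) x) = 0) ∧
      D.linDiff (KnotDiagram.mu ℤ) ∘ₗ D.linDiff (KnotDiagram.mu ℤ) = 0 ∧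
      (∃ f : D.AlexanderInvariant ≃+ D.cClasses (KnotDiagram.mu ℤ),
        ∀ x, f ((T 1 : ℤ[T;T⁻¹]) • x) = -((T 1 : ℤ[T;T⁻¹]) • f x)) ∧
      (∃ f : D.AlexanderInvariant ≃+ D.bClasses (KnotDiagram.mu ℤ),
        ∀ x, f ((T (-1) : ℤ[T;T⁻¹]) • x) = -((T 1 : ℤ[T;T⁻¹]) • f x)) ∧
      Disjoint (D.cClasses (KnotDiagram.mu ℤ)) (D.bClasses (KnotDiagram.mu ℤ)) ∧
      (∃ E : Submodule ℤ[T;T⁻¹] (D.LinHomology (KnotDiagram.mu ℤ) 1),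
        IsCompl (D.cClasses (KnotDiagram.mu ℤ) ⊔ D.bClasses (KnotDiagram.mu ℤ)) E) ∧
      (∃ Δ, D.IsAlexanderPolynomial Δ)) ∧
    -- over a field, the linearized homology determines the Alexander invariant
    (∀ (k : Type*) [Field k] (n₁ n₂ : ℕ) [NeZero n₁] [NeZero n₂]
      (D₁ : KnotDiagram n₁) (D₂ : KnotDiagram n₂),
      Nonempty (D₁.LinHomology (KnotDiagram.mu k) 1 ≃ₗ[k[T;T⁻¹]]
        D₂.LinHomology (KnotDiagram.mu k) 1) →
      ∃ f : (k ⊗[ℤ] D₁.AlexanderInvariant) ≃ₗ[k] (k ⊗[ℤ] D₂.AlexanderInvariant),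
        ∀ x, f (D₁.deck.toLinearMap.baseChange k x) = D₂.deck.toLinearMap.baseChange k (f x)) ∧
    -- the linearized homology determines the Alexander polynomial
    (∀ (n₁ n₂ : ℕ) [NeZero n₁] [NeZero n₂] (D₁ : KnotDiagram n₁) (D₂ : KnotDiagram n₂),
      Nonempty (D₁.LinHomology (KnotDiagram.mu ℤ) 1 ≃ₗ[ℤ[T;T⁻¹]]
        D₂.LinHomology (KnotDiagram.mu ℤ) 1) →
      ∀ Δ₁ Δ₂, D₁.IsAlexanderPolynomial Δ₁ → D₂.IsAlexanderPolynomial Δ₂ →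
        Associated Δ₁ Δ₂) := by
  refine ⟨fun n _ D => ⟨D.canonicalAug_diff _, D.linDiff_comp_linDiff _,
    D.exists_addEquiv_cClasses, D.exists_addEquiv_bClasses, ?_, ?_,
    _, D.orderIdeal_alexanderInvariant.symm⟩,
    fun k _ n₁ n₂ _ _ D₁ D₂ ⟨f⟩ => KnotDiagram.exists_baseChange_equiv D₁ D₂ f,
    fun n₁ n₂ _ _ D₁ D₂ ⟨f⟩ Δ₁ Δ₂ h₁ h₂ =>
      KnotDiagram.associated_of_isAlexanderPolynomial D₁ D₂ f h₁ h₂⟩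
  · rw [← D.range_cSection KnotDiagram.not_isUnit_one_add_T,
      ← D.range_bSection KnotDiagram.not_isUnit_one_add_T]
    exact D.disjoint_range_section _
  · rw [← D.range_cSection KnotDiagram.not_isUnit_one_add_T,
      ← D.range_bSection KnotDiagram.not_isUnit_one_add_T]
    exact D.exists_isCompl_range_section _
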